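/- An oriented virtual knot diagram is a smooth immersion of the circle into the plane with finitely many multiple points, all of them transverse double points, each marked either as a classical crossing (with over/under information) or as a virtual crossing. A virtual knot is an equivalence class of such diagrams under virtual isotopy; equivalently, an equivalence class of Gauss codes (words recording the signed over- and under-passages of the classical crossings) modulo the Reidemeister moves, relabelling of crossings and change of base point. The virtual crossing number $v(K)$ is the least number of virtual crossings in a diagram of $K$. For an integer $n\ge 1$, a virtual knot $K$ is $n$-periodic if it has a diagram that misses the origin and is invariant under the rotation of the plane by $2\pi/n$ about the origin. The virtual knot group $VG_K$ of a diagram of $K$ is generated by the short arcs of the diagram (the arcs between consecutive crossings, classical or virtual) and two commuting elements $s,q$, with the following relations. At a classical crossing, let $x,x'$ be the incoming and outgoing overcrossing arcs and $y,y'$ the incoming and outgoing undercrossing arcs; then $x'=sxs^{-1}$, $y'=xyx'^{-1}$ if the crossing is positive, and $x'=s^{-1}xs$, $y'=x'^{-1}yx$ if it is negative. At a virtual crossing, the strand passing from left to right of the other one has outgoing arc $z'=qzq^{-1}$, where $z$ is its incoming arc, and the strand passing from right to left has $z'=q^{-1}zq$. (If there are no crossings, there is one arc and the only relation is $sq=qs$.)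 The virtual Alexander module of $K$ is the module over $\mathbb{Z}[s^{\pm1},t^{\pm1},q^{\pm1}]$ presented by the square matrix of Fox derivatives of these relations (other than $sq=qs$; if there are no crossings, adjoin the trivial relation) with respect to the short arcs, evaluated by sending every arc to $t$, and $s,q$ to $s,q$. The virtual Alexander polynomial $H_K(s,t,q)$ is a generator of its zeroth elementary ideal, i.e. the determinant of this matrix; it is well defined up to multiplication by units. **Proposition.** Let $p$ be a prime, $r\ge 0$ an integer, and let $K$ be a $p^r$-periodic virtual knot such that $H_K(s,t,q)$ is non-zero modulo $p$. Then $p^r\le v(K)$. -/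

import Mathlib

open scoped ContDiff LaurentPolynomial

/-! ### Crossing words

Travelling once around a diagram from a base point, one passes each crossing twice.  A crossing
word records these passages in order. -/

/-- How a strand passes through a crossing. -/
inductive PassageKind
  | over
  | under
  | virt
  deriving DecidableEq

/-- The kind of the other passage through the same crossing. -/
def PassageKind.opp : PassageKind → PassageKind
  | .over => .under
  | .under => .over
  | .virt => .virt

/-- A passage through a crossing: the label of the crossing, the kind of the passage, and a sign.
At a classical crossing the sign is the writhe of the crossing (so both passages carry the same
sign).  At a virtual crossing it is `1` for the strand that passes from left to right of the other
strand (as seen when both strands point upwards), and `-1` for the strand that passes from right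
to left. -/
@[ext]
structure Passage (α : Type) where
  label : α
  kind : PassageKind
  sign : ℤˣ

/-- Renaming of the crossings. -/
def Passage.relabel {α β : Type} (f : α → β) (l : Passage α) : Passage β :=
  ⟨f l.label, l.kind, l.sign⟩

/-! ### Gauss codes, Reidemeister moves and virtual knots -/

/-- A word is a Gauss code if all its crossings are classical, and every crossing that occurs is
passed exactly twice, once over and once under, with the same sign. -/
def IsGaussCode (w : List (Passage ℕ)) : Prop :=
  (∀ l ∈ w, l.kind ≠ .virt) ∧ w.Nodup ∧
  (∀ l ∈ w, (⟨l.label, l.kind.opp, l.sign⟩ : Passage ℕ) ∈ w) ∧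
  (∀ l ∈ w, ∀ l' ∈ w, l.label = l'.label → l.kind = l'.kind → l = l')

/-- Gauss codes of oriented (virtual) knots. -/
def GaussCode : Type := {w : List (Passage ℕ) // IsGaussCode w}

/-- The two letters `x`, `y` in this order if `o = 1`, in the opposite order if `o = -1`. -/
def orderedPair {β : Type} (o : ℤˣ) (x y : β) : List β := if o = 1 then [x, y] else [y, x]

/-- The three pairs of adjacent passages involved in a third Reidemeister move, on the top, the
middle and the bottom strand.  The crossings of top and middle, top and bottom, middle and bottom
strand have labels `x`, `y`, `z` and signs `a`, `b`, `c`.  For the given signs there are two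
possible configurations of the three oriented strands, `σ = 1` and `σ = -1`, one on either side
of the move. -/
def r3Top (σ a b c : ℤˣ) (x y : ℕ) : List (Passage ℕ) :=
  orderedPair (σ * a * b * c) ⟨x, .over, a⟩ ⟨y, .over, b⟩

/-- The pair on the middle strand; see `r3Top`. -/
def r3Middle (σ a c : ℤˣ) (x z : ℕ) : List (Passage ℕ) :=
  orderedPair (σ * a) ⟨x, .under, a⟩ ⟨z, .over, c⟩

/-- The pair on the bottom strand; see `r3Top`. -/
def r3Bottom (σ b c : ℤˣ) (y z : ℕ) : List (Passage ℕ) :=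
  orderedPair (σ * b) ⟨y, .under, b⟩ ⟨z, .under, c⟩

/-- Elementary changes of a Gauss code: renaming the crossings, moving the base point, and the
three Reidemeister moves (with all orientations, signs and cyclic positions). -/
inductive GaussMove : List (Passage ℕ) → List (Passage ℕ) → Prop
  | relabel (f : Equiv.Perm ℕ) (w : List (Passage ℕ)) :
      GaussMove w (w.map (Passage.relabel f))
  | rotate (u v : List (Passage ℕ)) : GaussMove (u ++ v) (v ++ u)
  | r1 (x : ℕ) (k : PassageKind) (a : ℤˣ) (u v : List (Passage ℕ)) :
      GaussMove (u ++ [⟨x, k, a⟩, ⟨x, k.opp, a⟩] ++ v) (u ++ v)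
  | r2_parallel (x y : ℕ) (k : PassageKind) (a : ℤˣ) (u v w : List (Passage ℕ)) :
      GaussMove
        (u ++ [⟨x, k, a⟩, ⟨y, k, -a⟩] ++ v ++ [⟨x, k.opp, a⟩, ⟨y, k.opp, -a⟩] ++ w)
        (u ++ v ++ w)
  | r2_antiparallel (x y : ℕ) (k : PassageKind) (a : ℤˣ) (u v w : List (Passage ℕ)) :
      GaussMove
        (u ++ [⟨x, k, a⟩, ⟨y, k, -a⟩] ++ v ++ [⟨y, k.opp, -a⟩, ⟨x, k.opp, a⟩] ++ w)
        (u ++ v ++ w)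
  | r3_tmb (x y z : ℕ) (a b c : ℤˣ) (t u v w : List (Passage ℕ)) :
      GaussMove
        (t ++ r3Top 1 a b c x y ++ u ++ r3Middle 1 a c x z ++ v ++ r3Bottom 1 b c y z ++ w)
        (t ++ r3Top (-1) a b c x y ++ u ++ r3Middle (-1) a c x z ++ v ++
          r3Bottom (-1) b c y z ++ w)
  | r3_tbm (x y z : ℕ) (a b c : ℤˣ) (t u v w : List (Passage ℕ)) :
      GaussMove
        (t ++ r3Top 1 a b c x y ++ u ++ r3Bottom 1 b c y z ++ v ++ r3Middle 1 a c x z ++ w)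
        (t ++ r3Top (-1) a b c x y ++ u ++ r3Bottom (-1) b c y z ++ v ++
          r3Middle (-1) a c x z ++ w)

/-- Oriented virtual knots: Gauss codes modulo the equivalence relation generated by the
Reidemeister moves, renaming of crossings and change of base point. -/
def VirtualKnot : Type := Quot (fun G H : GaussCode => GaussMove G.1 H.1)

/-! ### Planar virtual knot diagrams -/

/-- The determinant of two vectors of the plane. -/
def planeDet (v w : ℂ) : ℝ := v.re * w.im - v.im * w.re

/-- The points of the circle `ℝ / ℤ` with parameters `x` and `y` are distinct and have the same
image under the `1`-periodic curve `γ`. -/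
def Meets (γ : ℝ → ℂ) (x y : ℝ) : Prop := γ x = γ y ∧ ∀ n : ℤ, y ≠ x + n

/-- An oriented virtual knot diagram: a smooth immersion of the circle `ℝ / ℤ` into the plane with
only finitely many multiple points, all of them transverse double points, each of which is either
classical (one of the two passages is over, the other under) or virtual. -/
structure VirtualKnotDiagram where
  curve : ℝ → ℂ
  smooth : ContDiff ℝ ∞ curve
  periodic : Function.Periodic curve 1
  immersed : ∀ x, deriv curve x ≠ 0
  transverse : ∀ x y, Meets curve x y → planeDet (deriv curve x) (deriv curve y) ≠ 0
  no_triple : ∀ x y z, Meets curve x y → Meets curve x z → ∃ n : ℤ, z = y + n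
  finite_crossings : {x : ℝ | x ∈ Set.Ico 0 1 ∧ ∃ y, Meets curve x y}.Finite
  kind : ℝ → PassageKind
  kind_periodic : Function.Periodic kind 1
  kind_meets : ∀ x y, Meets curve x y → kind y = (kind x).opp

namespace VirtualKnotDiagram

/-- The crossings of the diagram, as points of the plane. -/
def crossings (D : VirtualKnotDiagram) : Set ℂ := {z | ∃ x y, Meets D.curve x y ∧ D.curve x = z}

/-- The virtual crossings of the diagram. -/
def virtualCrossings (D : VirtualKnotDiagram) : Set ℂ :=
  {z | ∃ x y, Meets D.curve x y ∧ D.curve x = z ∧ D.kind x = .virt}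

open Classical in
/-- For a parameter `x` of a passage through a crossing, a parameter of the other passage. -/
noncomputable def mate (D : VirtualKnotDiagram) (x : ℝ) : ℝ :=
  if h : ∃ y, Meets D.curve x y then h.choose else x

/-- The sign of the determinant of the tangent vectors at the passage `x` and at the other
passage through the same crossing; it is `1` if the strand of `x` passes from left to right. -/
noncomputable def side (D : VirtualKnotDiagram) (x : ℝ) : ℤˣ :=
  if 0 < planeDet (deriv D.curve x) (deriv D.curve (D.mate x)) then 1 else -1

/-- The sign of a passage.  A classical crossing is positive (right-handed) if the tangent vectors
of the over-crossing and the under-crossing strand, in this order, form a positive basis. -/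
noncomputable def passageSign (D : VirtualKnotDiagram) (x : ℝ) : ℤˣ :=
  match D.kind x with
  | .over => D.side x
  | .under => -D.side x
  | .virt => D.side x

/-- The crossing word of the diagram, read from the base point `0`, with classical and virtual
crossings; each crossing is labelled by its position in the plane. -/
noncomputable def word (D : VirtualKnotDiagram) : List (Passage ℂ) :=
  (D.finite_crossings.toFinset.sort (fun a b => a ≤ b)).map
    fun x => ⟨D.curve x, D.kind x, D.passageSign x⟩

/-- The diagram represents the virtual knot `K`: the Gauss code of the diagram, obtained by
ignoring the virtual crossings and labelling the classical ones by distinct natural numbers,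
belongs to the class `K`. -/
def Represents (D : VirtualKnotDiagram) (K : VirtualKnot) : Prop :=
  ∃ (f : ℂ → ℕ) (G : GaussCode), Set.InjOn f D.crossings ∧
    G.1 = (D.word.filter fun l => l.kind ≠ .virt).map (Passage.relabel f) ∧
    Quot.mk _ G = K

/-- The diagram is periodic with period `q`: it misses the origin and is invariant under the
rotation of the plane by the angle `2π / q` about the origin.  Here `φ` is the (lift to `ℝ` of the)
orientation preserving reparametrization of the circle induced by the rotation. -/
def IsPeriodic (D : VirtualKnotDiagram) (q : ℕ) : Prop :=
  (∀ x, D.curve x ≠ 0) ∧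
  ∃ φ : ℝ → ℝ, Continuous φ ∧ StrictMono φ ∧ (∀ x, φ (x + 1) = φ x + 1) ∧
    (∀ x, D.curve (φ x) = Complex.exp (2 * Real.pi * Complex.I / q) * D.curve x) ∧
    (∀ x y, Meets D.curve x y → D.kind (φ x) = D.kind x)

end VirtualKnotDiagram

/-- A virtual knot is periodic with period `q` if it admits a diagram with period `q`. -/
def VirtualKnot.IsPeriodic (K : VirtualKnot) (q : ℕ) : Prop :=
  ∃ D : VirtualKnotDiagram, D.Represents K ∧ D.IsPeriodic q

/-- The virtual crossing number: the least number of virtual crossings of a diagram of `K`. -/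
noncomputable def VirtualKnot.virtualCrossingNumber (K : VirtualKnot) : ℕ :=
  sInf {n | ∃ D : VirtualKnotDiagram, D.Represents K ∧ D.virtualCrossings.ncard = n}

/-! ### Fox derivatives -/

section Fox

variable {X R : Type} [DecidableEq X] [CommRing R]

/-- The invertible matrix with rows `(u, d)` and `(0, 1)`. -/
def affineUnit (u : Rˣ) (d : R) : (Matrix (Fin 2) (Fin 2) R)ˣ where
  val := !![(u : R), d; 0, 1]
  inv := !![((u⁻¹ : Rˣ) : R), -(((u⁻¹ : Rˣ) : R) * d); 0, 1]
  val_inv := by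
    ext i j; fin_cases i <;> fin_cases j <;> simp
  inv_val := by
    ext i j; fin_cases i <;> fin_cases j <;> simp

/-- The Fox derivative of `w` with respect to the generator `x`, with values in a commutative ring
`R` through the homomorphism from the free group to `Rˣ` given by `ψ` on the generators.  It is
characterized by the three lemmas that follow. -/
def foxDerivative (ψ : X → Rˣ) (x : X) (w : FreeGroup X) : R :=
  (FreeGroup.lift (fun y => affineUnit (ψ y) (if y = x then 1 else 0)) w).val 0 1

theorem foxDerivative_of (ψ : X → Rˣ) (x y : X) :
    foxDerivative ψ x (FreeGroup.of y) = if y = x then 1 else 0 := by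
  simp [foxDerivative, affineUnit]

theorem lift_affineUnit (ψ : X → Rˣ) (x : X) (w : FreeGroup X) :
    FreeGroup.lift (fun y => affineUnit (ψ y) (if y = x then 1 else 0)) w =
      affineUnit (FreeGroup.lift ψ w) (foxDerivative ψ x w) := by
  have key : ∀ w : FreeGroup X,
      (FreeGroup.lift (fun y => affineUnit (ψ y) (if y = x then 1 else 0)) w).val 0 0 =
        (FreeGroup.lift ψ w : Rˣ) ∧
      (FreeGroup.lift (fun y => affineUnit (ψ y) (if y = x then 1 else 0)) w).val 1 0 = 0 ∧
      (FreeGroup.lift (fun y => affineUnit (ψ y) (if y = x then 1 else 0)) w).val 1 1 = 1 := by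
    intro w
    induction w using FreeGroup.induction_on with
    | C1 => simp
    | of y => simp [affineUnit]
    | inv_of y _ => simp [affineUnit, Units.inv_mk]
    | mul u v hu hv =>
      obtain ⟨h1, h2, h3⟩ := hu
      obtain ⟨k1, k2, k3⟩ := hv
      simp only [map_mul, Units.val_mul, Matrix.mul_apply, Fin.sum_univ_two]
      refine ⟨?_, ?_, ?_⟩
      · rw [h1, k1, k2]; simp
      · rw [h2, k2]; simp
      · rw [h2, h3, k3]; simp
  obtain ⟨h1, h2, h3⟩ := key w
  apply Units.ext
  ext i j
  fin_cases i <;> fin_cases j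
  · simpa [affineUnit] using h1
  · simp [affineUnit, foxDerivative]
  · simpa [affineUnit] using h2
  · simpa [affineUnit] using h3

theorem foxDerivative_one (ψ : X → Rˣ) (x : X) : foxDerivative ψ x 1 = 0 := by
  simp [foxDerivative]

theorem foxDerivative_mul (ψ : X → Rˣ) (x : X) (u v : FreeGroup X) :
    foxDerivative ψ x (u * v) =
      foxDerivative ψ x u + (FreeGroup.lift ψ u : Rˣ) * foxDerivative ψ x v := by
  have h : foxDerivative ψ x (u * v) =
      (FreeGroup.lift (fun y => affineUnit (ψ y) (if y = x then 1 else 0)) (u * v)).val 0 1 := rfl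
  rw [h, map_mul, lift_affineUnit, lift_affineUnit]
  simp [affineUnit, Matrix.mul_apply, Fin.sum_univ_two, add_comm]

end Fox

/-! ### The virtual knot group and the virtual Alexander polynomial -/

/-- Generators of the virtual knot group of a diagram with `n` passages: the short arcs, i.e. the
arcs `0, …, n` into which the base point and the passages through the (classical and virtual)
crossings divide the knot, and two auxiliary generators `s` and `q`.  The arcs `0` and `n` on the
two sides of the base point are identified by a relation. -/
inductive VGGenerator (n : ℕ)
  | arc (i : Fin (n + 1))
  | s
  | q
  deriving DecidableEq

open Classical in
/-- For a passage `k` through a classical crossing, the over-passage through that crossing. -/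
noncomputable def overPassage {α : Type} (w : List (Passage α)) (k : Fin w.length) :
    Fin w.length :=
  if h : ∃ j : Fin w.length, (w.get j).label = (w.get k).label ∧ (w.get j).kind = .over
  then h.choose else k

/-- The relator of the passage `k`, which expresses the arc after the passage.  With `x`, `x'` the
arcs of the over-crossing strand before and after a classical crossing, `y`, `y'` those of the
under-crossing strand, and `z`, `z'` the arcs before and after a virtual passage, the relations are
`x' = s x s⁻¹` and `y' = x y x'⁻¹` at a positive crossing,
`x' = s⁻¹ x s` and `y' = x'⁻¹ y x` at a negative crossing,
`z' = q z q⁻¹` or `z' = q⁻¹ z q` for a virtual passage from left to right or from right to left. -/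
noncomputable def passageRelator {α : Type} (w : List (Passage α)) (k : Fin w.length) :
    FreeGroup (VGGenerator w.length) :=
  let s := FreeGroup.of (VGGenerator.s (n := w.length))
  let q := FreeGroup.of (VGGenerator.q (n := w.length))
  let before := fun i : Fin w.length => FreeGroup.of (VGGenerator.arc i.castSucc)
  let after := fun i : Fin w.length => FreeGroup.of (VGGenerator.arc i.succ)
  let j := overPassage w k
  match (w.get k).kind with
  | .over =>
      if (w.get k).sign = 1 then s * before k * s⁻¹ * (after k)⁻¹
      else s⁻¹ * before k * s * (after k)⁻¹
  | .under =>
      if (w.get k).sign = 1 then before j * before k * (after j)⁻¹ * (after k)⁻¹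
      else (after j)⁻¹ * before k * before j * (after k)⁻¹
  | .virt =>
      if (w.get k).sign = 1 then q * before k * q⁻¹ * (after k)⁻¹
      else q⁻¹ * before k * q * (after k)⁻¹

/-- The relators of the passages, followed by the relator that identifies the last arc with the
arc `0`. -/
noncomputable def vgRelator {α : Type} (w : List (Passage α)) :
    Fin (w.length + 1) → FreeGroup (VGGenerator w.length) :=
  Fin.lastCases
    (FreeGroup.of (VGGenerator.arc (Fin.last w.length)) * (FreeGroup.of (VGGenerator.arc 0))⁻¹)
    (passageRelator w)

/-- The virtual knot group: besides the relators above, `s` and `q` commute. -/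
abbrev VirtualKnotGroup {α : Type} (w : List (Passage α)) : Type :=
  PresentedGroup (insert
    (FreeGroup.of (VGGenerator.s (n := w.length)) * FreeGroup.of VGGenerator.q *
      (FreeGroup.of VGGenerator.s)⁻¹ * (FreeGroup.of VGGenerator.q)⁻¹)
    (Set.range (vgRelator w)))

/-- The ring `ℤ[s^{±1}, t^{±1}, q^{±1}]`, the variables being adjoined in this order. -/
abbrev LaurentSTQ : Type := ℤ[T;T⁻¹][T;T⁻¹][T;T⁻¹]

/-- The variable of a Laurent polynomial ring as a unit. -/
noncomputable def laurentVar (R : Type) [CommRing R] : R[T;T⁻¹]ˣ where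
  val := LaurentPolynomial.T 1
  inv := LaurentPolynomial.T (-1)
  val_inv := by rw [← LaurentPolynomial.T_add]; simp
  inv_val := by rw [← LaurentPolynomial.T_add]; simp

/-- The variable `s`. -/
noncomputable def varS : LaurentSTQˣ :=
  Units.map ((LaurentPolynomial.C (R := ℤ[T;T⁻¹][T;T⁻¹])).comp
    (LaurentPolynomial.C (R := ℤ[T;T⁻¹]))).toMonoidHom (laurentVar ℤ)

/-- The variable `t`. -/
noncomputable def varT : LaurentSTQˣ :=
  Units.map (LaurentPolynomial.C (R := ℤ[T;T⁻¹][T;T⁻¹])).toMonoidHom (laurentVar ℤ[T;T⁻¹])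

/-- The variable `q`. -/
noncomputable def varQ : LaurentSTQˣ := laurentVar ℤ[T;T⁻¹][T;T⁻¹]

/-- The abelianization of the virtual knot group (free abelian of rank three) on the generators:
every arc is sent to `t`, and the auxiliary generators to `s` and `q`. -/
noncomputable def vgAbelianization (n : ℕ) : VGGenerator n → LaurentSTQˣ
  | .arc _ => varT
  | .s => varS
  | .q => varQ

/-- The presentation matrix of the virtual Alexander module: the Fox derivatives of the relators of
the virtual knot group with respect to the arcs. -/
noncomputable def virtualAlexanderMatrix {α : Type} (w : List (Passage α)) :
    Matrix (Fin (w.length + 1)) (Fin (w.length + 1)) LaurentSTQ :=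
  fun i j => foxDerivative (vgAbelianization w.length) (VGGenerator.arc j) (vgRelator w i)

/-- `h` is a virtual Alexander polynomial `H_K(s,t,q)` of `K`, which is well defined up to units:
a generator of the zeroth elementary ideal of the virtual Alexander module.  As the presentation
matrix is square, this ideal is generated by its determinant. -/
def VirtualKnot.IsVirtualAlexanderPolynomial (K : VirtualKnot) (h : LaurentSTQ) : Prop :=
  ∃ D : VirtualKnotDiagram, D.Represents K ∧ Associated h (virtualAlexanderMatrix D.word).det

set_option linter.unusedSectionVars false

/-! ### Families of solution sets and determinants -/


section SolutionFamilies

variable {R : Type} [CommRing R]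

/-! Over a field of characteristic `p` the period forces a high power of two linear factors in the
variable `q` into the determinant, while the virtual crossings bound its degree in `q`.

Number all passages of a diagram by the integers, so that the Alexander system becomes a periodic
linear recurrence in which each arc is determined by the previous one and by an incoming
over-crossing arc. For a `p ^ r`-periodic diagram, rotation acts on these numbers as a translation,
and the system is a free cover, with group cyclic of order `n = p ^ r`, of a quotient system. In
characteristic `p` one has `X ^ n - 1 = (X - 1) ^ n`, so the determinant of the cover is the `n`-th
power of the determinant of the quotient (`det_shiftMatrix_prod`).

A planar diagram has an Alexander numbering: an integer for each arc that changes by one at every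
passage and is compatible at all crossings, virtual ones included. The vector with entries `q ^
(-index)` is killed by the quotient matrix modulo `q - s`, and a row vector with entries `q ^ index`
modulo `1 - t * q`. Hence both `(q - s) ^ n` and `(1 - t * q) ^ n` divide the determinant modulo `p`
(`sub_dvd_det`, `one_sub_dvd_det`). These factors are coprime because `s * t ≠ 1`, so a nonzero
determinant has width at least `2 * n` in `q`. For any diagram, only virtual passages involve `q`,
each contributes at most one to the width, and each virtual crossing has two of them
(`exists_toLaurent_det`, `card_virtual_le`). Comparing the two bounds on a diagram with the fewest
virtual crossings gives the result.

The comparison needs the determinant, up to units, to be an invariant of the knot. Instead of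
matrices, the functor of their solutions in arbitrary modules is compared: a natural bijection of
solutions gives associated determinants (`SolEquiv.associated_det`). Solutions are colorings of the
word. Multiplying each color by `q` to the index of its arc turns the weights into `s * q⁻¹`, `t *
q`, `1`, so virtual passages disappear and only the Gauss code remains; each move on Gauss codes is
then an explicit bijection of colorings.

The existence of the numbering is a statement about plane curves: the two loops at a double point
cross each other algebraically zero times. It is proved with winding integrals, which jump by the
sign at every transverse crossing and agree at both ends of a loop (`sum_side_eq_zero`). -/

/-- A family of subsets of `J → V`, for all modules `V`. -/
abbrev SolFamily (R : Type) [CommRing R] (J : Type) : Type 1 :=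
  ∀ (V : Type) [AddCommGroup V] [Module R V], Set (J → V)

/-- A natural bijection between two families of solution sets. -/
structure SolEquiv {J J' : Type} (F : SolFamily R J) (F' : SolFamily R J') where
  toFun : ∀ (V : Type) [AddCommGroup V] [Module R V], (J → V) → (J' → V)
  invFun : ∀ (V : Type) [AddCommGroup V] [Module R V], (J' → V) → (J → V)
  toFun_natural : ∀ (V W : Type) [AddCommGroup V] [Module R V] [AddCommGroup W] [Module R W]
    (φ : V →ₗ[R] W) (x : J → V), toFun W (φ ∘ x) = φ ∘ toFun V x
  invFun_natural : ∀ (V W : Type) [AddCommGroup V] [Module R V] [AddCommGroup W] [Module R W]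
    (φ : V →ₗ[R] W) (x : J' → V), invFun W (φ ∘ x) = φ ∘ invFun V x
  toFun_mem : ∀ (V : Type) [AddCommGroup V] [Module R V] (x : J → V), x ∈ F V → toFun V x ∈ F' V
  invFun_mem : ∀ (V : Type) [AddCommGroup V] [Module R V] (x : J' → V),
    x ∈ F' V → invFun V x ∈ F V
  -- The maps are defined on all tuples, which makes naturality easy to state, but they need to be
  -- inverse to each other only on solutions. Linearity is not required.
  left_inv : ∀ (V : Type) [AddCommGroup V] [Module R V] (x : J → V), x ∈ F V →
    invFun V (toFun V x) = x
  right_inv : ∀ (V : Type) [AddCommGroup V] [Module R V] (x : J' → V), x ∈ F' V →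
    toFun V (invFun V x) = x

namespace SolEquiv

variable {J J' J'' : Type} {F : SolFamily R J} {F' : SolFamily R J'} {F'' : SolFamily R J''}

/-- The identity. -/
def refl (F : SolFamily R J) : SolEquiv F F where
  toFun _ _ _ x := x
  invFun _ _ _ x := x
  toFun_natural _ _ _ _ _ _ _ _ := rfl
  invFun_natural _ _ _ _ _ _ _ _ := rfl
  toFun_mem _ _ _ _ h := h
  invFun_mem _ _ _ _ h := h
  left_inv _ _ _ _ _ := rfl
  right_inv _ _ _ _ _ := rfl

/-- Families with the same members. -/
def ofEq {F F₁ : SolFamily R J}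
    (h : ∀ (V : Type) [AddCommGroup V] [Module R V] (x : J → V), x ∈ F V ↔ x ∈ F₁ V) :
    SolEquiv F F₁ where
  toFun _ _ _ x := x
  invFun _ _ _ x := x
  toFun_natural _ _ _ _ _ _ _ _ := rfl
  invFun_natural _ _ _ _ _ _ _ _ := rfl
  toFun_mem V _ _ x hx := (h V x).1 hx
  invFun_mem V _ _ x hx := (h V x).2 hx
  left_inv _ _ _ _ _ := rfl
  right_inv _ _ _ _ _ := rfl

/-- The inverse. -/
def symm (e : SolEquiv F F') : SolEquiv F' F where
  toFun V _ _ := e.invFun V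
  invFun V _ _ := e.toFun V
  toFun_natural V W _ _ _ _ := e.invFun_natural V W
  invFun_natural V W _ _ _ _ := e.toFun_natural V W
  toFun_mem V _ _ := e.invFun_mem V
  invFun_mem V _ _ := e.toFun_mem V
  left_inv V _ _ := e.right_inv V
  right_inv V _ _ := e.left_inv V

/-- The composition. -/
def trans (e : SolEquiv F F') (e' : SolEquiv F' F'') : SolEquiv F F'' where
  toFun V _ _ x := e'.toFun V (e.toFun V x)
  invFun V _ _ x := e.invFun V (e'.invFun V x)
  toFun_natural V W _ _ _ _ φ x := by rw [e.toFun_natural, e'.toFun_natural]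
  invFun_natural V W _ _ _ _ φ x := by rw [e'.invFun_natural, e.invFun_natural]
  toFun_mem V _ _ x hx := e'.toFun_mem V _ (e.toFun_mem V x hx)
  invFun_mem V _ _ x hx := e.invFun_mem V _ (e'.invFun_mem V x hx)
  left_inv V _ _ x hx := by rw [e'.left_inv V _ (e.toFun_mem V x hx), e.left_inv V x hx]
  right_inv V _ _ x hx := by rw [e.right_inv V _ (e'.invFun_mem V x hx), e'.right_inv V x hx]

end SolEquiv

variable {ι κ : Type} [Fintype ι] [Fintype κ] [DecidableEq ι] [DecidableEq κ]

/-- The vectors killed by a matrix, with entries in an arbitrary module. -/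
def Matrix.solutions (A : Matrix κ ι R) : SolFamily R ι :=
  fun V _ _ => {x : ι → V | ∀ i, ∑ j, A i j • x j = 0}

/-- The hypotheses say exactly that a block triangular matrix with determinant `B.det` factors
through one with determinant `A.det`. The matrices `A` and `B` may have different sizes, so the
number of generators is allowed to change. -/
theorem Matrix.det_dvd_det_of_mul_eq {A E : Matrix ι ι R} {B : Matrix κ κ R} {P C : Matrix κ ι R}
    {Q : Matrix ι κ R} (h₁ : B * P = C * A) (h₂ : Q * P = 1 + E * A) :
    A.det ∣ B.det := by
  have h : Matrix.fromBlocks 1 (-Q) 0 B =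
      Matrix.fromBlocks (-E) (-Q) C B * Matrix.fromBlocks A 0 (-P) 1 := by
    rw [Matrix.fromBlocks_multiply]
    congr 1
    · simp [h₂]
    · simp
    · simp [h₁]
    · simp
  have h' := congrArg Matrix.det h
  rw [Matrix.det_fromBlocks_zero₂₁, Matrix.det_mul, Matrix.det_fromBlocks_zero₁₂] at h'
  simp only [Matrix.det_one, one_mul, mul_one] at h'
  exact ⟨_, h'.trans (mul_comm _ _)⟩

/-- The module with generators indexed by the columns and relations given by the rows of `A`. -/
abbrev Matrix.RowQuotient (A : Matrix κ ι R) : Type :=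
  (ι → R) ⧸ Submodule.span R (Set.range A.row)

/-- The generators of the module presented by a matrix. -/
def Matrix.generator (A : Matrix κ ι R) (i : ι) : A.RowQuotient :=
  Submodule.Quotient.mk (Pi.single i 1)

theorem Matrix.mk_eq_sum_generator (A : Matrix κ ι R) (v : ι → R) :
    (Submodule.Quotient.mk v : A.RowQuotient) = ∑ i, v i • A.generator i := by
  have : v = ∑ i, v i • (Pi.single i 1 : ι → R) := by
    simpa using pi_eq_sum_univ' v
  conv_lhs => rw [this]
  rw [← Submodule.mkQ_apply, map_sum]
  simp [Matrix.generator]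

theorem Matrix.generator_mem (A : Matrix κ ι R) : A.generator ∈ A.solutions A.RowQuotient := by
  intro i
  rw [← Matrix.mk_eq_sum_generator A (A i), Submodule.Quotient.mk_eq_zero]
  exact Submodule.subset_span ⟨i, rfl⟩

theorem Matrix.exists_linearMap_generator (A : Matrix κ ι R) {V : Type} [AddCommGroup V]
    [Module R V] {x : ι → V} (hx : x ∈ A.solutions V) :
    ∃ φ : A.RowQuotient →ₗ[R] V, φ ∘ A.generator = x := by
  refine ⟨Submodule.liftQ _ (Fintype.linearCombination R x) ?_, ?_⟩
  · rw [Submodule.span_le]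
    rintro _ ⟨i, rfl⟩
    simpa [Fintype.linearCombination_apply] using hx i
  · ext i
    simp [Matrix.generator, Fintype.linearCombination_apply, Pi.single_apply]

theorem Matrix.exists_mul_eq_of_mk_eq_zero (A : Matrix ι ι R) {X : Matrix κ ι R}
    (h : ∀ k, (Submodule.Quotient.mk (X k) : A.RowQuotient) = 0) :
    ∃ C : Matrix κ ι R, X = C * A := by
  have : ∀ k, ∃ c : ι → R, ∑ i, c i • A i = X k := fun k => by
    have := (Submodule.Quotient.mk_eq_zero _).1 (h k)
    exact (Submodule.mem_span_range_iff_exists_fun R).1 this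
  choose c hc using this
  refine ⟨Matrix.of c, ?_⟩
  ext k j
  rw [← hc k]
  simp [Matrix.mul_apply]

/-- A Yoneda argument: the generators of the module presented by `A` form the universal solution,
and naturality applied to it yields matrices between the two presentations satisfying the hypotheses
of `Matrix.det_dvd_det_of_mul_eq`. -/
theorem SolEquiv.det_dvd_det {A : Matrix ι ι R} {B : Matrix κ κ R}
    (e : SolEquiv A.solutions B.solutions) : A.det ∣ B.det := by
  have hy := e.toFun_mem _ _ A.generator_mem
  have hP : ∀ k, ∃ v : ι → R, (Submodule.Quotient.mk v : A.RowQuotient) =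
      e.toFun _ A.generator k := fun k => Submodule.Quotient.mk_surjective _ _
  have hQ : ∀ k, ∃ v : κ → R, (Submodule.Quotient.mk v : B.RowQuotient) =
      e.invFun _ B.generator k := fun k => Submodule.Quotient.mk_surjective _ _
  choose P hP using hP
  choose Q hQ using hQ
  obtain ⟨φ, hφ⟩ := B.exists_linearMap_generator hy
  -- The image of the universal solution of `A` comes from that of `B` through `φ`; going back by
  -- `invFun` returns the generators of `A`, which says that `Q * P` is the identity modulo the rows
  -- of `A`.
  have hφ' := e.invFun_natural _ _ φ B.generator
  rw [hφ, e.left_inv _ _ A.generator_mem] at hφ'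
  have mk_mul : ∀ {μ : Type} [Fintype μ] (X : Matrix μ κ R) (k : μ),
      (Submodule.Quotient.mk ((X * Matrix.of P) k) : A.RowQuotient) =
        ∑ j, X k j • e.toFun _ A.generator j := by
    intro μ _ X k
    have : (X * Matrix.of P) k = ∑ j, X k j • P j := by
      ext i; simp [Matrix.mul_apply]
    rw [this, ← Submodule.mkQ_apply, map_sum]
    simp [hP]
  obtain ⟨C, hC⟩ := A.exists_mul_eq_of_mk_eq_zero (X := B * Matrix.of P) fun k => by
    rw [mk_mul]; exact hy k
  obtain ⟨E, hE⟩ := A.exists_mul_eq_of_mk_eq_zero (X := (Matrix.of Q * Matrix.of P - 1 : Matrix ι ι R))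
    fun k => by
      have h1 : (Submodule.Quotient.mk ((Matrix.of Q * Matrix.of P) k) : A.RowQuotient) =
          A.generator k := by
        rw [mk_mul, congrFun hφ' k, Function.comp_apply, ← hQ k, B.mk_eq_sum_generator, map_sum]
        refine Finset.sum_congr rfl fun j _ => ?_
        rw [map_smul, ← congrFun hφ j]; rfl
      have h2 : (Matrix.of Q * Matrix.of P - 1 : Matrix ι ι R) k =
          (Matrix.of Q * Matrix.of P) k - Pi.single k 1 := by
        ext j; simp [Matrix.one_apply, Pi.single_apply, eq_comm]
      rw [h2, Submodule.Quotient.mk_sub, h1, Matrix.generator, sub_self]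
  exact Matrix.det_dvd_det_of_mul_eq hC (sub_eq_iff_eq_add'.1 hE)

theorem SolEquiv.associated_det [IsDomain R] {A : Matrix ι ι R} {B : Matrix κ κ R}
    (e : SolEquiv A.solutions B.solutions) : Associated A.det B.det :=
  associated_of_dvd_dvd e.det_dvd_det e.symm.det_dvd_det

end SolutionFamilies

/-! ### Colorings of words -/

/-- The weights of the three kinds of passages. -/
structure Weights (R : Type) [CommRing R] where
  s : Rˣ
  t : Rˣ
  q : Rˣ

section Colorings

variable {R : Type} [CommRing R] {α β : Type} {V W : Type} [AddCommGroup V] [Module R V]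
  [AddCommGroup W] [Module R W]

namespace Weights

/-- The coefficient of the incoming arc in the relation of a passage. -/
def coeff (a : Weights R) (k : PassageKind) (e : ℤˣ) : R :=
  match k with
  | .over => ((a.s ^ (e : ℤ) : Rˣ) : R)
  | .under => ((a.t ^ (e : ℤ) : Rˣ) : R)
  | .virt => ((a.q ^ (e : ℤ) : Rˣ) : R)

/-- The coefficient of the incoming over-crossing arc in the relation of a passage. -/
def overCoeff (a : Weights R) (k : PassageKind) (e : ℤˣ) : R :=
  match k with
  | .over => 0
  | .under => 1 - (((a.s * a.t) ^ (e : ℤ) : Rˣ) : R)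
  | .virt => 0

variable (a : Weights R)

/-- The color of the arc after a passage, in terms of the color of the arc before it and of the
colors of the incoming over-crossing arcs. -/
def step (o : α → V) (l : Passage α) (c : V) : V :=
  a.coeff l.kind l.sign • c + a.overCoeff l.kind l.sign • o l.label

/-- The color of the arc after the passages of a word. -/
def run (o : α → V) : List (Passage α) → V → V
  | [], c => c
  | l :: w, c => run o w (a.step o l c)

/-- The colors of the arcs before over-crossings are the prescribed ones. -/
def Valid (o : α → V) : List (Passage α) → V → Prop
  | [], _ => True
  | l :: w, c => (l.kind = .over → o l.label = c) ∧ Valid o w (a.step o l c)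

@[simp] theorem run_nil (o : α → V) (c : V) : a.run o [] c = c := rfl

@[simp] theorem run_cons (o : α → V) (l : Passage α) (w : List (Passage α)) (c : V) :
    a.run o (l :: w) c = a.run o w (a.step o l c) := rfl

@[simp] theorem valid_nil (o : α → V) (c : V) : a.Valid o [] c := trivial

@[simp] theorem valid_cons (o : α → V) (l : Passage α) (w : List (Passage α)) (c : V) :
    a.Valid o (l :: w) c ↔ (l.kind = .over → o l.label = c) ∧ a.Valid o w (a.step o l c) :=
  Iff.rfl

theorem run_append (o : α → V) (u w : List (Passage α)) (c : V) :
    a.run o (u ++ w) c = a.run o w (a.run o u c) := by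
  induction u generalizing c with
  | nil => rfl
  | cons l u ih => exact ih _

theorem valid_append (o : α → V) (u w : List (Passage α)) (c : V) :
    a.Valid o (u ++ w) c ↔ a.Valid o u c ∧ a.Valid o w (a.run o u c) := by
  induction u generalizing c with
  | nil => simp
  | cons l u ih => simp [ih, and_assoc]

theorem step_map (φ : V →ₗ[R] W) (o : α → V) (l : Passage α) (c : V) :
    a.step (φ ∘ o) l (φ c) = φ (a.step o l c) := by
  simp [step]

theorem run_map (φ : V →ₗ[R] W) (o : α → V) (w : List (Passage α)) (c : V) :
    a.run (φ ∘ o) w (φ c) = φ (a.run o w c) := by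
  induction w generalizing c with
  | nil => rfl
  | cons l w ih => rw [run_cons, run_cons, step_map, ih]

theorem run_congr {o o' : α → V} {w : List (Passage α)} (h : ∀ l ∈ w, o l.label = o' l.label)
    (c : V) : a.run o w c = a.run o' w c := by
  induction w generalizing c with
  | nil => rfl
  | cons l w ih =>
    rw [run_cons, run_cons, ih fun l' hl' => h l' (List.mem_cons_of_mem _ hl'), step, step,
      h l List.mem_cons_self]

theorem valid_congr {o o' : α → V} {w : List (Passage α)} (h : ∀ l ∈ w, o l.label = o' l.label)
    (c : V) : a.Valid o w c ↔ a.Valid o' w c := by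
  induction w generalizing c with
  | nil => rfl
  | cons l w ih =>
    rw [valid_cons, valid_cons, ih fun l' hl' => h l' (List.mem_cons_of_mem _ hl'), step, step,
      h l List.mem_cons_self]

theorem run_relabel (f : α → β) (o : β → V) (w : List (Passage α)) (c : V) :
    a.run o (w.map (Passage.relabel f)) c = a.run (o ∘ f) w c := by
  induction w generalizing c with
  | nil => rfl
  | cons l w ih => exact ih _

theorem valid_relabel (f : α → β) (o : β → V) (w : List (Passage α)) (c : V) :
    a.Valid o (w.map (Passage.relabel f)) c ↔ a.Valid (o ∘ f) w c := by
  induction w generalizing c with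
  | nil => rfl
  | cons l w ih => exact and_congr Iff.rfl (ih _)

/-- The colorings of a word: the color of the arc at the base point, and the colors of the
incoming over-crossing arcs (extended by zero to all labels), subject to the relations. -/
def colorings (w : List (Passage α)) : SolFamily R (Option α) :=
  fun V _ _ => {x : Option α → V | a.run (x ∘ some) w (x none) = x none ∧
    a.Valid (x ∘ some) w (x none) ∧
    ∀ b, (∀ l ∈ w, l.kind = .over → l.label ≠ b) → x (some b) = 0}

theorem mem_colorings {w : List (Passage α)} {x : Option α → V} :
    x ∈ a.colorings w V ↔ a.run (x ∘ some) w (x none) = x none ∧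
      a.Valid (x ∘ some) w (x none) ∧
      ∀ b, (∀ l ∈ w, l.kind = .over → l.label ≠ b) → x (some b) = 0 := Iff.rfl

/-- The coloring with given values at the base point and at the labels. -/
def cons (c : V) (o : α → V) : Option α → V
  | none => c
  | some b => o b

@[simp] theorem cons_none (c : V) (o : α → V) : cons c o none = c := rfl
@[simp] theorem cons_some (c : V) (o : α → V) (b : α) : cons c o (some b) = o b := rfl
@[simp] theorem cons_comp_some (c : V) (o : α → V) : cons c o ∘ some = o := rfl
theorem comp_cons (φ : V → W) (c : V) (o : α → V) : φ ∘ cons c o = cons (φ c) (φ ∘ o) := by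
  ext b; cases b <;> rfl
theorem cons_eta (x : Option α → V) : cons (x none) (x ∘ some) = x := by
  ext b; cases b <;> rfl

/-- Changing the base point. -/
def coloringsRotate (u v : List (Passage α)) :
    SolEquiv (a.colorings (u ++ v)) (a.colorings (v ++ u)) where
  toFun V _ _ x := cons (a.run (x ∘ some) u (x none)) (x ∘ some)
  invFun V _ _ x := cons (a.run (x ∘ some) v (x none)) (x ∘ some)
  toFun_natural V W _ _ _ _ φ x := by
    rw [comp_cons, ← run_map]; rfl
  invFun_natural V W _ _ _ _ φ x := by
    rw [comp_cons, ← run_map]; rfl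
  toFun_mem V _ _ x hx := by
    simp only [mem_colorings, run_append, valid_append, cons_none, cons_comp_some, cons_some] at hx ⊢
    obtain ⟨h1, ⟨h2, h3⟩, h4⟩ := hx
    refine ⟨by rw [h1], ⟨h3, by rw [h1]; exact h2⟩, fun b hb => h4 b fun l hl => hb l ?_⟩
    simp only [List.mem_append] at hl ⊢; tauto
  invFun_mem V _ _ x hx := by
    simp only [mem_colorings, run_append, valid_append, cons_none, cons_comp_some, cons_some] at hx ⊢
    obtain ⟨h1, ⟨h2, h3⟩, h4⟩ := hx
    refine ⟨by rw [h1], ⟨h3, by rw [h1]; exact h2⟩, fun b hb => h4 b fun l hl => hb l ?_⟩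
    simp only [List.mem_append] at hl ⊢; tauto
  left_inv V _ _ x hx := by
    simp only [mem_colorings, run_append] at hx
    simp only [cons_none, cons_comp_some, hx.1, cons_eta]
  right_inv V _ _ x hx := by
    simp only [mem_colorings, run_append] at hx
    simp only [cons_none, cons_comp_some, hx.1, cons_eta]

open Classical in
/-- The transport of `o` along a map `f` which is injective on the labels of `w`, extended by
zero. -/
noncomputable def pushforward (w : List (Passage α)) (f : α → β) (o : α → V) (b : β) : V :=
  if h : ∃ l ∈ w, l.kind = .over ∧ f l.label = b then o h.choose.label else 0

open Classical in
/-- The composition of `o` with `f` on the labels of over-crossings of `w`, extended by zero. -/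
noncomputable def pullback (w : List (Passage α)) (f : α → β) (o : β → V) (b : α) : V :=
  if ∃ l ∈ w, l.kind = .over ∧ l.label = b then o (f b) else 0

theorem pushforward_map (φ : V →ₗ[R] W) (w : List (Passage α)) (f : α → β) (o : α → V) :
    pushforward w f (φ ∘ o) = φ ∘ pushforward w f o := by
  ext b
  by_cases h : ∃ l ∈ w, l.kind = .over ∧ f l.label = b <;> simp [pushforward, h]

theorem pullback_map (φ : V →ₗ[R] W) (w : List (Passage α)) (f : α → β) (o : β → V) :
    pullback w f (φ ∘ o) = φ ∘ pullback w f o := by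
  ext b
  by_cases h : ∃ l ∈ w, l.kind = .over ∧ l.label = b <;> simp [pullback, h]

theorem pushforward_apply {w : List (Passage α)} {f : α → β}
    (hf : ∀ l ∈ w, ∀ l' ∈ w, f l.label = f l'.label → l.label = l'.label) {o : α → V}
    (ho : ∀ b, (∀ l ∈ w, l.kind = .over → l.label ≠ b) → o b = 0)
    {l : Passage α} (hl : l ∈ w) : pushforward w f o (f l.label) = o l.label := by
  by_cases h : ∃ l' ∈ w, l'.kind = .over ∧ f l'.label = f l.label
  · rw [pushforward, dif_pos h, hf _ h.choose_spec.1 _ hl h.choose_spec.2.2]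
  · rw [pushforward, dif_neg h, ho]
    exact fun l' hl' hk he => h ⟨l', hl', hk, by rw [he]⟩

/-- Renaming the labels. -/
noncomputable def coloringsRelabel (w : List (Passage α)) (f : α → β)
    (hf : ∀ l ∈ w, ∀ l' ∈ w, f l.label = f l'.label → l.label = l'.label) :
    SolEquiv (a.colorings w) (a.colorings (w.map (Passage.relabel f))) where
  toFun V _ _ x := cons (x none) (pushforward w f (x ∘ some))
  invFun V _ _ x := cons (x none) (pullback w f (x ∘ some))
  toFun_natural V W _ _ _ _ φ x := by rw [comp_cons, ← pushforward_map]; rfl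
  invFun_natural V W _ _ _ _ φ x := by rw [comp_cons, ← pullback_map]; rfl
  toFun_mem V _ _ x hx := by
    obtain ⟨h1, h2, h3⟩ := hx
    have key : ∀ l ∈ w, (pushforward w f (x ∘ some) ∘ f) l.label = (x ∘ some) l.label :=
      fun l hl => pushforward_apply hf h3 hl
    refine ⟨?_, ?_, ?_⟩
    · rw [run_relabel, cons_comp_some, cons_none, run_congr a key, h1]
    · rw [valid_relabel, cons_comp_some, cons_none, valid_congr a key]; exact h2
    · intro b hb
      refine dif_neg ?_
      rintro ⟨l, hl, hk, rfl⟩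
      exact hb (l.relabel f) (List.mem_map_of_mem hl) hk rfl
  invFun_mem V _ _ x hx := by
    obtain ⟨h1, h2, h3⟩ := hx
    have key : ∀ l ∈ w, pullback w f (x ∘ some) l.label = ((x ∘ some) ∘ f) l.label := by
      intro l hl
      by_cases h : ∃ l' ∈ w, l'.kind = .over ∧ l'.label = l.label
      · exact if_pos h
      · rw [pullback, if_neg h]
        refine (h3 _ ?_).symm
        intro l' hl' hk he
        obtain ⟨l'', hl'', rfl⟩ := List.mem_map.1 hl'
        exact h ⟨l'', hl'', hk, hf _ hl'' _ hl he⟩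
    rw [run_relabel] at h1
    rw [valid_relabel] at h2
    refine ⟨?_, ?_, ?_⟩
    · rw [cons_comp_some, cons_none, run_congr a key, h1]
    · rw [cons_comp_some, cons_none, valid_congr a key]; exact h2
    · intro b hb
      refine if_neg ?_
      rintro ⟨l, hl, hk, rfl⟩
      exact hb l hl hk rfl
  left_inv V _ _ x hx := by
    obtain ⟨h1, h2, h3⟩ := hx
    conv_rhs => rw [← cons_eta x]
    rw [cons_none, cons_comp_some]
    congr 1
    ext b
    by_cases h : ∃ l' ∈ w, l'.kind = .over ∧ l'.label = b
    · rw [pullback, if_pos h]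
      obtain ⟨l, hl, -, rfl⟩ := h
      exact pushforward_apply hf h3 hl
    · rw [pullback, if_neg h]
      exact (h3 b fun l hl hk he => h ⟨l, hl, hk, he⟩).symm
  right_inv V _ _ x hx := by
    obtain ⟨h1, h2, h3⟩ := hx
    conv_rhs => rw [← cons_eta x]
    rw [cons_none, cons_comp_some]
    congr 1
    ext b
    by_cases h : ∃ l' ∈ w, l'.kind = .over ∧ f l'.label = b
    · rw [pushforward, dif_pos h, pullback, if_pos ⟨_, h.choose_spec.1, h.choose_spec.2.1, rfl⟩]
      simp only [h.choose_spec.2.2]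
    · rw [pushforward, dif_neg h]
      refine (h3 b fun l hl hk he => ?_).symm
      obtain ⟨l', hl', rfl⟩ := List.mem_map.1 hl
      exact h ⟨l', hl', hk, he⟩

end Weights
end Colorings

/-! ### Reidemeister moves -/

theorem PassageKind.eq_or_eq_opp {k k' : PassageKind} (hk : k ≠ .virt) (hk' : k' ≠ .virt) :
    k' = k ∨ k' = k.opp := by
  cases k <;> cases k' <;> simp_all [PassageKind.opp]

/-- A third passage with the label `x` would have the same kind as one of the two listed ones, hence
be equal to it, and the word has no repetitions. -/
theorem IsGaussCode.label_ne {w : List (Passage ℕ)} (h : IsGaussCode w) {x : ℕ} {k : PassageKind}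
    {a : ℤˣ} {v : List (Passage ℕ)} (hp : w.Perm (⟨x, k, a⟩ :: ⟨x, k.opp, a⟩ :: v)) :
    ∀ l ∈ v, l.label ≠ x := by
  rintro l hl rfl
  obtain ⟨h1, h2, -, h4⟩ := h
  have m1 := hp.mem_iff.2 List.mem_cons_self
  have m2 := hp.mem_iff.2 (List.mem_cons_of_mem _ List.mem_cons_self)
  have m3 := hp.mem_iff.2 (List.mem_cons_of_mem _ (List.mem_cons_of_mem _ hl))
  have hn := hp.nodup h2
  simp only [List.nodup_cons, List.mem_cons, not_or] at hn
  rcases PassageKind.eq_or_eq_opp (h1 _ m1) (h1 _ m3) with hk | hk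
  · have := h4 _ m1 _ m3 rfl hk.symm
    exact hn.1.2 (this ▸ hl)
  · have := h4 _ m2 _ m3 rfl hk.symm
    exact hn.2.1 (this ▸ hl)

theorem IsGaussCode.ne_virt {w : List (Passage ℕ)} (h : IsGaussCode w) {x : ℕ} {k : PassageKind}
    {a : ℤˣ} (hp : (⟨x, k, a⟩ : Passage ℕ) ∈ w) : k = .over ∨ k = .under := by
  have := h.1 _ hp
  cases k <;> simp_all

namespace Weights

variable {R : Type} [CommRing R] (a : Weights R)

@[simp] theorem coeff_over_one : a.coeff .over 1 = a.s := by simp [coeff]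
@[simp] theorem coeff_over_neg_one : a.coeff .over (-1) = ((a.s⁻¹ : Rˣ) : R) := by simp [coeff]
@[simp] theorem coeff_under_one : a.coeff .under 1 = a.t := by simp [coeff]
@[simp] theorem coeff_under_neg_one : a.coeff .under (-1) = ((a.t⁻¹ : Rˣ) : R) := by simp [coeff]
@[simp] theorem coeff_virt_one : a.coeff .virt 1 = a.q := by simp [coeff]
@[simp] theorem coeff_virt_neg_one : a.coeff .virt (-1) = ((a.q⁻¹ : Rˣ) : R) := by simp [coeff]
@[simp] theorem overCoeff_over (e : ℤˣ) : a.overCoeff .over e = 0 := rfl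
@[simp] theorem overCoeff_virt (e : ℤˣ) : a.overCoeff .virt e = 0 := rfl
@[simp] theorem overCoeff_under_one : a.overCoeff .under 1 = 1 - a.s * a.t := by simp [overCoeff]
@[simp] theorem overCoeff_under_neg_one :
    a.overCoeff .under (-1) = 1 - ((a.s⁻¹ : Rˣ) : R) * ((a.t⁻¹ : Rˣ) : R) := by
  simp [overCoeff, mul_comm]

theorem coeff_over_mul_neg (e : ℤˣ) : a.coeff .over e * a.coeff .over (-e) = 1 := by
  rcases Int.units_eq_one_or e with rfl | rfl <;> simp

theorem coeff_under_mul_neg (e : ℤˣ) : a.coeff .under e * a.coeff .under (-e) = 1 := by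
  rcases Int.units_eq_one_or e with rfl | rfl <;> simp

theorem overCoeff_under (e : ℤˣ) :
    a.overCoeff .under e = 1 - a.coeff .over e * a.coeff .under e := by
  rcases Int.units_eq_one_or e with rfl | rfl <;> simp

/-- Removing crossings whose colors are determined by the rest of the coloring. -/
def coloringsErase {L L' : List (Passage ℕ)} (Z : Finset ℕ)
    (val : ∀ (V : Type) [AddCommGroup V] [Module R V], V → (ℕ → V) → ℕ → V)
    (val_map : ∀ (V W : Type) [AddCommGroup V] [Module R V] [AddCommGroup W] [Module R W]
      (φ : V →ₗ[R] W) (c : V) (o : ℕ → V), val W (φ c) (φ ∘ o) = φ ∘ val V c o)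
    -- The prescribed values must not depend on the erased colors themselves; otherwise they could
    -- not be restored from a coloring of the shorter word.
    (val_congr : ∀ (V : Type) [AddCommGroup V] [Module R V] (c : V) (o o' : ℕ → V),
      (∀ b ∉ Z, o b = o' b) → val V c o = val V c o')
    (hL' : ∀ l ∈ L', l.label ∉ Z)
    (hL : ∀ b, (∃ l ∈ L, l.kind = .over ∧ l.label = b) ↔
      b ∈ Z ∨ ∃ l ∈ L', l.kind = .over ∧ l.label = b)
    (key : ∀ (V : Type) [AddCommGroup V] [Module R V] (c : V) (o : ℕ → V),
      (a.run o L c = c ∧ a.Valid o L c) ↔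
        (a.run o L' c = c ∧ a.Valid o L' c ∧ ∀ b ∈ Z, o b = val V c o b)) :
    SolEquiv (a.colorings L) (a.colorings L') where
  toFun V _ _ x := cons (x none) fun b => if b ∈ Z then 0 else x (some b)
  invFun V _ _ x := cons (x none) fun b =>
    if b ∈ Z then val V (x none) (x ∘ some) b else x (some b)
  toFun_natural V W _ _ _ _ φ x := by
    rw [comp_cons]
    congr 1
    ext b
    by_cases hb : b ∈ Z <;> simp [hb]
  invFun_natural V W _ _ _ _ φ x := by
    rw [comp_cons]
    congr 1
    ext b
    by_cases hb : b ∈ Z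
    · simp only [if_pos hb, Function.comp_apply]
      exact congrFun (val_map V W φ (x none) (x ∘ some)) b
    · simp [hb]
  toFun_mem V _ _ x hx := by
    obtain ⟨h1, h2, h3⟩ := hx
    obtain ⟨k1, k2, -⟩ := (key V _ _).1 ⟨h1, h2⟩
    have hc : ∀ l ∈ L', (fun b => if b ∈ Z then 0 else x (some b)) l.label =
        (x ∘ some) l.label := fun l hl => if_neg (hL' l hl)
    refine ⟨?_, ?_, ?_⟩
    · rw [cons_comp_some, cons_none, a.run_congr hc, k1]
    · rw [cons_comp_some, cons_none, a.valid_congr hc]; exact k2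
    · intro b hb
      by_cases hZ : b ∈ Z
      · simp [hZ]
      · simp only [cons_some, if_neg hZ]
        refine h3 b fun l hl hk he => ?_
        rcases (hL b).1 ⟨l, hl, hk, he⟩ with h | ⟨l', hl', hk', he'⟩
        · exact hZ h
        · exact hb l' hl' hk' he'
  invFun_mem V _ _ x hx := by
    obtain ⟨h1, h2, h3⟩ := hx
    have hc : ∀ l ∈ L', (fun b => if b ∈ Z then val V (x none) (x ∘ some) b else x (some b))
        l.label = (x ∘ some) l.label := fun l hl => if_neg (hL' l hl)
    have h := (key V (x none) (fun b => if b ∈ Z then val V (x none) (x ∘ some) b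
      else x (some b))).2 ⟨by rw [a.run_congr hc, h1], (a.valid_congr hc _).2 h2, fun b hb => by
        rw [if_pos hb]
        exact congrFun (val_congr V _ _ _ fun b' hb' => (if_neg hb').symm) b⟩
    refine ⟨h.1, h.2, fun b hb => ?_⟩
    have hZ : b ∉ Z := fun hZ => by
      obtain ⟨l, hl, hk, he⟩ := (hL b).2 (Or.inl hZ)
      exact hb l hl hk he
    simp only [cons_some, if_neg hZ]
    refine h3 b fun l hl hk he => ?_
    obtain ⟨l', hl', hk', he'⟩ := (hL b).2 (Or.inr ⟨l, hl, hk, he⟩)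
    exact hb l' hl' hk' he'
  left_inv V _ _ x hx := by
    obtain ⟨h1, h2, h3⟩ := hx
    obtain ⟨-, -, k3⟩ := (key V _ _).1 ⟨h1, h2⟩
    conv_rhs => rw [← cons_eta x]
    rw [cons_none, cons_comp_some]
    congr 1
    ext b
    by_cases hb : b ∈ Z
    · rw [if_pos hb, k3 b hb]
      exact congrFun (val_congr V _ _ _ fun b' hb' => if_neg hb') b
    · simp [hb]
  right_inv V _ _ x hx := by
    obtain ⟨h1, h2, h3⟩ := hx
    conv_rhs => rw [← cons_eta x]
    rw [cons_none]
    congr 1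
    ext b
    by_cases hb : b ∈ Z
    · rw [if_pos hb]
      exact (h3 b fun l hl hk he => hL' l hl (he ▸ hb)).symm
    · simp [hb]

variable {V : Type} [AddCommGroup V] [Module R V]

/-- Passing over and under the same crossing multiplies the color by `(s * t) ^ e` and adds `1 - (s
* t) ^ e` times the over-color, so the loop has no effect when the over-color is the incoming one.
If the under-passage comes first, the over-color satisfies a linear equation that can be solved
because `s` and `t` are units. -/
theorem r1_pair (x : ℕ) {k : PassageKind} (hk : k = .over ∨ k = .under) (e : ℤˣ) (o : ℕ → V)
    (c : V) :
    (a.Valid o [⟨x, k, e⟩, ⟨x, k.opp, e⟩] c ↔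
      o x = (if k = .over then 1 else a.coeff .over (-e)) • c) ∧
    (a.Valid o [⟨x, k, e⟩, ⟨x, k.opp, e⟩] c → a.run o [⟨x, k, e⟩, ⟨x, k.opp, e⟩] c = c) := by
  have hs := a.coeff_over_mul_neg e
  have ht := a.coeff_under_mul_neg e
  rcases hk with rfl | rfl
  · have : a.Valid o [⟨x, .over, e⟩, ⟨x, PassageKind.opp .over, e⟩] c ↔ o x = c := by
      simp [PassageKind.opp]
    refine ⟨by simpa using this, fun h => ?_⟩
    rw [this] at h
    simp only [run_cons, run_nil, step, PassageKind.opp, h, overCoeff_over, overCoeff_under]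
    match_scalars
    ring
  · have : a.Valid o [⟨x, .under, e⟩, ⟨x, PassageKind.opp .under, e⟩] c ↔
        o x = a.coeff .over (-e) • c := by
      simp only [valid_cons, PassageKind.opp, valid_nil, and_true, step, overCoeff_under]
      simp only [reduceCtorEq, false_implies, true_and, forall_const]
      constructor
      · intro h
        have h' : (a.coeff .over e * a.coeff .under e) • o x = a.coeff .under e • c := by
          rw [← sub_eq_zero] at h ⊢
          refine Eq.trans ?_ h
          module
        have h'' := congrArg (fun y => (a.coeff .over (-e) * a.coeff .under (-e)) • y) h'
        simp only [smul_smul] at h''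
        -- Cancellation of the unit `(s * t) ^ e`: the coefficient of `o x` becomes one and only `s
        -- ^ (-e)` remains in front of `c`.
        rw [show a.coeff .over (-e) * a.coeff .under (-e) *
          (a.coeff .over e * a.coeff .under e) = 1 by grind, one_smul,
          show a.coeff .over (-e) * a.coeff .under (-e) * a.coeff .under e =
            a.coeff .over (-e) by grind] at h''
        exact h''
      · intro h
        rw [h]
        match_scalars
        grind
    refine ⟨by simpa using this, fun h => ?_⟩
    have h1 := this.1 h
    simp only [run_cons, run_nil, step, PassageKind.opp, h1, overCoeff_over, overCoeff_under]
    match_scalars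
    grind

/-- Invariance of the colorings under the first Reidemeister move. -/
noncomputable def coloringsR1 {x : ℕ} {k : PassageKind} {e : ℤˣ} {u v : List (Passage ℕ)}
    (h : IsGaussCode (u ++ [⟨x, k, e⟩, ⟨x, k.opp, e⟩] ++ v)) :
    SolEquiv (a.colorings (u ++ [⟨x, k, e⟩, ⟨x, k.opp, e⟩] ++ v)) (a.colorings (u ++ v)) := by
  have hk : k = .over ∨ k = .under := h.ne_virt (x := x) (a := e) (by simp)
  have hx : ∀ l ∈ u ++ v, l.label ≠ x := h.label_ne (x := x) (k := k) (a := e) (by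
    classical
    rw [List.perm_iff_count]; intro l; simp only [List.count_append, List.count_cons, List.count_nil]; omega)
  refine a.coloringsErase {x}
    (fun V _ _ c o _ => (if k = .over then (1 : R) else a.coeff .over (-e)) • a.run o u c)
    ?_ ?_ ?_ ?_ ?_
  · intro V W _ _ _ _ φ c o
    ext b
    by_cases hk' : k = .over <;> simp [hk', run_map]
  · intro V _ _ c o o' ho
    ext b
    rw [a.run_congr fun l hl => ho l.label (by
      simpa using hx l (List.mem_append_left _ hl))]
  · simpa using hx
  · intro b
    simp only [List.mem_append, List.mem_cons, List.not_mem_nil, or_false, Finset.mem_singleton]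
    rcases hk with rfl | rfl
    · constructor
      · rintro ⟨l, ((hl | rfl | rfl) | hl), h1, rfl⟩
        · exact Or.inr ⟨l, Or.inl hl, h1, rfl⟩
        · exact Or.inl rfl
        · exact Or.inl rfl
        · exact Or.inr ⟨l, Or.inr hl, h1, rfl⟩
      · rintro (rfl | ⟨l, hl, h1, h2⟩)
        · exact ⟨_, Or.inl (Or.inr (Or.inl rfl)), rfl, rfl⟩
        · exact ⟨l, by tauto, h1, h2⟩
    · constructor
      · rintro ⟨l, ((hl | rfl | rfl) | hl), h1, rfl⟩
        · exact Or.inr ⟨l, Or.inl hl, h1, rfl⟩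
        · exact Or.inl rfl
        · exact Or.inl rfl
        · exact Or.inr ⟨l, Or.inr hl, h1, rfl⟩
      · rintro (rfl | ⟨l, hl, h1, h2⟩)
        · exact ⟨_, Or.inl (Or.inr (Or.inr rfl)), rfl, rfl⟩
        · exact ⟨l, by tauto, h1, h2⟩
  · intro V _ _ c o
    simp only [Finset.mem_singleton, forall_eq]
    obtain ⟨h1, h2⟩ := a.r1_pair x hk e o (a.run o u c)
    rw [← h1, valid_append, valid_append, run_append, run_append, valid_append, run_append]
    constructor
    · rintro ⟨p1, ⟨p2, p3⟩, p4⟩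
      rw [h2 p3] at p1 p4
      exact ⟨p1, ⟨p2, p4⟩, p3⟩
    · rintro ⟨p1, ⟨p2, p3⟩, p4⟩
      rw [h2 p4]
      exact ⟨p1, ⟨p2, p4⟩, p3⟩

/-- A pair of passages under the over-crossing pair of a second Reidemeister move. -/
def r2Under (o : Bool) (x y : ℕ) (e : ℤˣ) : List (Passage ℕ) :=
  bif o then [⟨x, .under, e⟩, ⟨y, .under, -e⟩] else [⟨y, .under, -e⟩, ⟨x, .under, e⟩]

theorem r2_over (x y : ℕ) (e : ℤˣ) (o : ℕ → V) (c : V) :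
    (a.Valid o [⟨x, .over, e⟩, ⟨y, .over, -e⟩] c ↔ o x = c ∧ o y = a.coeff .over e • c) ∧
    a.run o [⟨x, .over, e⟩, ⟨y, .over, -e⟩] c = c := by
  have hs := a.coeff_over_mul_neg e
  constructor
  · simp [step]
  · simp only [run_cons, run_nil, step, overCoeff_over]
    match_scalars <;> grind

/-- An under-strand has no over-color to match, so validity is automatic. Its two steps are inverse
affine maps as soon as the two over-colors differ by the factor that the over-strand produces. -/
theorem r2_under (i : Bool) (x y : ℕ) (e : ℤˣ) (o : ℕ → V) (c : V) :
    a.Valid o (r2Under i x y e) c ∧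
    (o y = a.coeff .over e • o x → a.run o (r2Under i x y e) c = c) := by
  have hs := a.coeff_over_mul_neg e
  have ht := a.coeff_under_mul_neg e
  refine ⟨by cases i <;> simp [r2Under], fun h => ?_⟩
  cases i
  all_goals
    simp only [r2Under, cond_true, cond_false, run_cons, run_nil, step, h, overCoeff_under]
    match_scalars <;> grind

theorem r2_labels {x y : ℕ} {e : ℤˣ} {i : Bool} {v w : List (Passage ℕ)}
    (hp : w.Perm ([⟨x, .over, e⟩, ⟨y, .over, -e⟩] ++ r2Under i x y e ++ v))
    (h : IsGaussCode w) : (∀ l ∈ v, l.label ≠ x) ∧ (∀ l ∈ v, l.label ≠ y) := by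
  classical
  constructor
  · intro l hl
    refine h.label_ne (x := x) (k := .over) (a := e)
      (v := ⟨y, .over, -e⟩ :: ⟨y, .under, -e⟩ :: v) (hp.trans ?_) l (by simp [hl])
    rw [List.perm_iff_count]; intro l
    cases i <;> simp only [r2Under, cond_true, cond_false, PassageKind.opp, List.count_append,
      List.count_cons, List.count_nil] <;> omega
  · intro l hl
    refine h.label_ne (x := y) (k := .over) (a := -e)
      (v := ⟨x, .over, e⟩ :: ⟨x, .under, e⟩ :: v) (hp.trans ?_) l (by simp [hl])
    rw [List.perm_iff_count]; intro l
    cases i <;> simp only [r2Under, cond_true, cond_false, PassageKind.opp, List.count_append,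
      List.count_cons, List.count_nil] <;> omega

/-- Equal labels would give two over-passages with the same label, hence the same sign, whereas the
signs of the pair are opposite. -/
theorem r2_ne {x y : ℕ} {e : ℤˣ} {w : List (Passage ℕ)}
    (h1 : (⟨x, .over, e⟩ : Passage ℕ) ∈ w) (h2 : (⟨y, .over, -e⟩ : Passage ℕ) ∈ w)
    (h : IsGaussCode w) : y ≠ x := by
  rintro rfl
  have := h.2.2.2 _ h1 _ h2 rfl rfl
  simp only [Passage.mk.injEq, true_and] at this
  rcases Int.units_eq_one_or e with rfl | rfl <;> exact absurd this (by decide)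

theorem r2_over_labels {x y : ℕ} {e : ℤˣ} {i : Bool} {L v : List (Passage ℕ)}
    (hp : L.Perm ([⟨x, .over, e⟩, ⟨y, .over, -e⟩] ++ r2Under i x y e ++ v)) (b : ℕ) :
    (∃ l ∈ L, l.kind = .over ∧ l.label = b) ↔
      b ∈ ({x, y} : Finset ℕ) ∨ ∃ l ∈ v, l.kind = .over ∧ l.label = b := by
  simp only [hp.mem_iff, Finset.mem_insert, Finset.mem_singleton]
  constructor
  · rintro ⟨l, hl, h1, rfl⟩
    simp only [List.mem_append, List.mem_cons, List.not_mem_nil, or_false] at hl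
    rcases hl with ((rfl | rfl) | hl) | hl
    · exact Or.inl (Or.inl rfl)
    · exact Or.inl (Or.inr rfl)
    · cases i <;> simp [r2Under] at hl <;> rcases hl with rfl | rfl <;> simp at h1
    · exact Or.inr ⟨l, hl, h1, rfl⟩
  · rintro ((rfl | rfl) | ⟨l, hl, h1, h2⟩)
    · exact ⟨⟨b, .over, e⟩, by simp, rfl, rfl⟩
    · exact ⟨⟨b, .over, -e⟩, by simp, rfl, rfl⟩
    · exact ⟨l, by simp [hl], h1, h2⟩

/-- Invariance of the colorings under second Reidemeister moves, starting from a passage over. -/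
noncomputable def coloringsR2Over {x y : ℕ} {e : ℤˣ} {i : Bool} {u v w : List (Passage ℕ)}
    (h : IsGaussCode (u ++ [⟨x, .over, e⟩, ⟨y, .over, -e⟩] ++ v ++ r2Under i x y e ++ w)) :
    SolEquiv
      (a.colorings (u ++ [⟨x, .over, e⟩, ⟨y, .over, -e⟩] ++ v ++ r2Under i x y e ++ w))
      (a.colorings (u ++ v ++ w)) := by
  have hp : List.Perm (α := Passage ℕ)
      (u ++ [⟨x, .over, e⟩, ⟨y, .over, -e⟩] ++ v ++ r2Under i x y e ++ w)
      ([⟨x, .over, e⟩, ⟨y, .over, -e⟩] ++ r2Under i x y e ++ (u ++ v ++ w)) := by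
    classical
    rw [List.perm_iff_count]; intro l; simp only [List.count_append]; omega
  obtain ⟨hx, hy⟩ := r2_labels hp h
  have hyx : y ≠ x := r2_ne (e := e) (by simp) (by simp) h
  refine a.coloringsErase {x, y}
    (fun V _ _ c o b => if b = x then a.run o u c else a.coeff .over e • a.run o u c)
    ?_ ?_ ?_ (r2_over_labels hp) ?_
  · intro V W _ _ _ _ φ c o
    ext b
    by_cases hb : b = x <;> simp [hb, run_map]
  · intro V _ _ c o o' ho
    ext b
    rw [a.run_congr fun l hl => ho l.label (by
      simp [hx l (by simp [hl]), hy l (by simp [hl])])]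
  · intro l hl
    simp [hx l hl, hy l hl]
  · intro V _ _ c o
    simp only [Finset.mem_insert, Finset.mem_singleton, forall_eq_or_imp, forall_eq, if_true,
      if_neg hyx]
    simp only [valid_append, run_append]
    obtain ⟨h1, h2⟩ := a.r2_over x y e o (a.run o u c)
    rw [h1, h2]
    have h3 := a.r2_under i x y e o (a.run o v (a.run o u c))
    constructor
    · rintro ⟨p1, ⟨⟨⟨p2, p3⟩, p4⟩, p5⟩, p6⟩
      rw [h3.2 (by rw [p3.1, p3.2])] at p1 p6
      exact ⟨p1, ⟨⟨p2, p4⟩, p6⟩, p3⟩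
    · rintro ⟨p1, ⟨⟨p2, p4⟩, p6⟩, p3⟩
      rw [h3.2 (by rw [p3.1, p3.2])]
      exact ⟨p1, ⟨⟨⟨⟨p2, p3⟩, p4⟩, h3.1⟩, p6⟩⟩

/-- Invariance of the colorings under second Reidemeister moves, starting from a passage under. -/
noncomputable def coloringsR2Under {x y : ℕ} {e : ℤˣ} {i : Bool} {u v w : List (Passage ℕ)}
    (h : IsGaussCode (u ++ r2Under i x y e ++ v ++ [⟨x, .over, e⟩, ⟨y, .over, -e⟩] ++ w)) :
    SolEquiv
      (a.colorings (u ++ r2Under i x y e ++ v ++ [⟨x, .over, e⟩, ⟨y, .over, -e⟩] ++ w))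
      (a.colorings (u ++ v ++ w)) := by
  have hp : List.Perm (α := Passage ℕ)
      (u ++ r2Under i x y e ++ v ++ [⟨x, .over, e⟩, ⟨y, .over, -e⟩] ++ w)
      ([⟨x, .over, e⟩, ⟨y, .over, -e⟩] ++ r2Under i x y e ++ (u ++ v ++ w)) := by
    classical
    rw [List.perm_iff_count]; intro l; simp only [List.count_append]; omega
  obtain ⟨hx, hy⟩ := r2_labels hp h
  have hyx : y ≠ x := r2_ne (e := e) (by simp) (by simp) h
  refine a.coloringsErase {x, y}
    (fun V _ _ c o b => if b = x then a.run o (u ++ v) c else a.coeff .over e • a.run o (u ++ v) c)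
    ?_ ?_ ?_ (r2_over_labels hp) ?_
  · intro V W _ _ _ _ φ c o
    ext b
    by_cases hb : b = x <;> simp [hb, run_map]
  · intro V _ _ c o o' ho
    ext b
    rw [a.run_congr fun l hl => ho l.label (by
      simp [hx l (List.mem_append_left _ hl), hy l (List.mem_append_left _ hl)])]
  · intro l hl
    simp [hx l hl, hy l hl]
  · intro V _ _ c o
    simp only [Finset.mem_insert, Finset.mem_singleton, forall_eq_or_imp, forall_eq, if_true,
      if_neg hyx]
    simp only [valid_append, run_append]
    have h3 := a.r2_under i x y e o (a.run o u c)
    constructor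
    · rintro ⟨p1, ⟨⟨⟨p2, p3⟩, p4⟩, p5⟩, p6⟩
      obtain ⟨h1, h2⟩ := a.r2_over x y e o
        (a.run o v (a.run o (r2Under i x y e) (a.run o u c)))
      have p7 := h1.1 p5
      rw [h2] at p1 p6
      rw [h3.2 (by rw [p7.1, p7.2])] at p1 p4 p6 p7
      exact ⟨p1, ⟨⟨p2, p4⟩, p6⟩, p7⟩
    · rintro ⟨p1, ⟨⟨p2, p4⟩, p6⟩, p3⟩
      obtain ⟨h1, h2⟩ := a.r2_over x y e o (a.run o v (a.run o u c))
      rw [h3.2 (by rw [p3.1, p3.2]), h2, h1]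
      exact ⟨p1, ⟨⟨⟨⟨p2, h3.1⟩, p4⟩, p3⟩, p6⟩⟩

end Weights

theorem mem_orderedPair {β : Type} (o : ℤˣ) (x y l : β) :
    l ∈ orderedPair o x y ↔ l = x ∨ l = y := by
  unfold orderedPair
  split_ifs <;> simp [or_comm]

namespace Weights

variable {R : Type} [CommRing R] (a : Weights R) {V W : Type} [AddCommGroup V] [Module R V]
  [AddCommGroup W] [Module R W]

/-- The change of colors under a third Reidemeister move. -/
def r3Modify (σ e₁ e₂ e₃ : ℤˣ) (x y z : ℕ) (o : ℕ → V) (b : ℕ) : V :=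
  -- The colors are dictated by the reversed order on each strand. The product `σ * e₁ * e₂ * e₃`
  -- tells whether the top strand meets `x` first, and `σ * e₁` whether the middle strand does. At
  -- `z`, the step under the top strand is undone in the first case and performed, with the new
  -- color at `x`, in the second.
  if b = x then (if σ * e₁ * e₂ * e₃ = 1 then a.coeff .over e₂ • o x else o y)
  else if b = y then (if σ * e₁ * e₂ * e₃ = 1 then o x else a.coeff .over e₁ • o y)
  else if b = z then (if σ * e₁ = 1 then
      a.coeff .under (-e₁) • o z - (a.coeff .under (-e₁) * a.overCoeff .under e₁) • o x
    else a.coeff .under e₁ • o z + a.overCoeff .under e₁ •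
      (if σ * e₁ * e₂ * e₃ = 1 then a.coeff .over e₂ • o x else o y))
  else o b

/-- The relation between the colors of the over-crossing arcs of the top strand. -/
def R3TopRel (σ e₁ e₂ e₃ : ℤˣ) (x y : ℕ) (o : ℕ → V) : Prop :=
  if σ * e₁ * e₂ * e₃ = 1 then o y = a.coeff .over e₁ • o x else o x = a.coeff .over e₂ • o y

theorem r3Modify_map (φ : V →ₗ[R] W) (σ e₁ e₂ e₃ : ℤˣ) (x y z : ℕ) (o : ℕ → V) :
    a.r3Modify σ e₁ e₂ e₃ x y z (φ ∘ o) = φ ∘ a.r3Modify σ e₁ e₂ e₃ x y z o := by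
  ext b
  simp only [r3Modify, Function.comp_apply]
  split_ifs <;> simp

variable {σ e₁ e₂ e₃ : ℤˣ} {x y z : ℕ} {o : ℕ → V} {c : V}

theorem r3_top (hxy : x ≠ y) (h : a.Valid o (r3Top σ e₁ e₂ e₃ x y) c) :
    a.R3TopRel σ e₁ e₂ e₃ x y o ∧
    a.Valid (a.r3Modify σ e₁ e₂ e₃ x y z o) (r3Top (-σ) e₁ e₂ e₃ x y) c ∧
    a.run (a.r3Modify σ e₁ e₂ e₃ x y z o) (r3Top (-σ) e₁ e₂ e₃ x y) c =
      a.run o (r3Top σ e₁ e₂ e₃ x y) c := by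
  have hs₁ := a.coeff_over_mul_neg e₁
  have hs₂ := a.coeff_over_mul_neg e₂
  have hx : a.r3Modify σ e₁ e₂ e₃ x y z o x =
      if σ * e₁ * e₂ * e₃ = 1 then a.coeff .over e₂ • o x else o y := by simp [r3Modify]
  have hy : a.r3Modify σ e₁ e₂ e₃ x y z o y =
      if σ * e₁ * e₂ * e₃ = 1 then o x else a.coeff .over e₁ • o y := by
    simp [r3Modify, hxy.symm]
  unfold r3Top orderedPair R3TopRel at *
  simp only [neg_mul]
  rcases Int.units_eq_one_or (σ * e₁ * e₂ * e₃) with hσ | hσ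
  · simp only [hσ, if_true, valid_cons, step, forall_const, overCoeff_over, zero_smul, add_zero,
      valid_nil, and_true] at h hx hy
    simp only [hσ, if_true, show ¬ ((-1 : ℤˣ) = 1) by decide, if_false, run_cons, run_nil,
      valid_cons, step, overCoeff_over, zero_smul, add_zero, forall_const, hx, hy, valid_nil,
      and_true, h.1, h.2]
    refine ⟨trivial, trivial, ?_⟩
    module
  · simp only [hσ, show ¬ ((-1 : ℤˣ) = 1) by decide, if_false, valid_cons, step, forall_const,
      overCoeff_over, zero_smul, add_zero, valid_nil, and_true] at h hx hy
    simp only [hσ, neg_neg, if_true, show ¬ ((-1 : ℤˣ) = 1) by decide, if_false, run_cons, run_nil,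
      valid_cons, step, overCoeff_over, zero_smul, add_zero, forall_const, hx, hy, valid_nil,
      and_true, h.1, h.2]
    refine ⟨trivial, trivial, ?_⟩
    module

theorem r3_modify_x : a.r3Modify σ e₁ e₂ e₃ x y z o x =
    if σ * e₁ * e₂ * e₃ = 1 then a.coeff .over e₂ • o x else o y := by simp [r3Modify]

theorem r3_modify_y (hxy : x ≠ y) : a.r3Modify σ e₁ e₂ e₃ x y z o y =
    if σ * e₁ * e₂ * e₃ = 1 then o x else a.coeff .over e₁ • o y := by
  simp [r3Modify, hxy.symm]

theorem r3_modify_z (hxz : x ≠ z) (hyz : y ≠ z) : a.r3Modify σ e₁ e₂ e₃ x y z o z =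
    if σ * e₁ = 1 then
      a.coeff .under (-e₁) • o z - (a.coeff .under (-e₁) * a.overCoeff .under e₁) • o x
    else a.coeff .under e₁ • o z + a.overCoeff .under e₁ •
      (if σ * e₁ * e₂ * e₃ = 1 then a.coeff .over e₂ • o x else o y) := by
  simp [r3Modify, hxz.symm, hyz.symm]

theorem r3_modify_of_ne {b : ℕ} (hx : b ≠ x) (hy : b ≠ y) (hz : b ≠ z) :
    a.r3Modify σ e₁ e₂ e₃ x y z o b = o b := by
  simp [r3Modify, hx, hy, hz]

/-- Only the order of one under-step and one over-step changes, with a different top color at `x`.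
After the choice of the new color at `z`, this is an identity in the units `s` and `t`, verified for
each choice of signs. -/
theorem r3_middle (hxz : x ≠ z) (hyz : y ≠ z) (hr : a.R3TopRel σ e₁ e₂ e₃ x y o)
    (h : a.Valid o (r3Middle σ e₁ e₃ x z) c) :
    a.Valid (a.r3Modify σ e₁ e₂ e₃ x y z o) (r3Middle (-σ) e₁ e₃ x z) c ∧
    a.run (a.r3Modify σ e₁ e₂ e₃ x y z o) (r3Middle (-σ) e₁ e₃ x z) c =
      a.run o (r3Middle σ e₁ e₃ x z) c := by
  have hs : (a.s : R) * ((a.s⁻¹ : Rˣ) : R) = 1 := by simp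
  have ht : (a.t : R) * ((a.t⁻¹ : Rˣ) : R) = 1 := by simp
  unfold r3Middle orderedPair R3TopRel at *
  rcases Int.units_eq_one_or σ with rfl | rfl <;> rcases Int.units_eq_one_or e₁ with rfl | rfl <;>
  rcases Int.units_eq_one_or e₂ with rfl | rfl <;> rcases Int.units_eq_one_or e₃ with rfl | rfl
  all_goals
    simp [step, r3_modify_x, a.r3_modify_z hxz hyz] at h hr ⊢
    simp only [h, hr]
    try constructor
  all_goals first
    | trivial
    | match_scalars <;> grind

/-- This is the linear form of the self-distributivity of the Wirtinger relations. The bottom strand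
prescribes no over-colors, so only the outgoing color has to be compared. -/
theorem r3_bottom (hxy : x ≠ y) (hxz : x ≠ z) (hyz : y ≠ z) (hr : a.R3TopRel σ e₁ e₂ e₃ x y o) :
    a.run (a.r3Modify σ e₁ e₂ e₃ x y z o) (r3Bottom (-σ) e₂ e₃ y z) c =
      a.run o (r3Bottom σ e₂ e₃ y z) c := by
  have hs : (a.s : R) * ((a.s⁻¹ : Rˣ) : R) = 1 := by simp
  have ht : (a.t : R) * ((a.t⁻¹ : Rˣ) : R) = 1 := by simp
  unfold r3Bottom orderedPair R3TopRel at *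
  rcases Int.units_eq_one_or σ with rfl | rfl <;> rcases Int.units_eq_one_or e₁ with rfl | rfl <;>
  rcases Int.units_eq_one_or e₂ with rfl | rfl <;> rcases Int.units_eq_one_or e₃ with rfl | rfl
  all_goals
    simp [step, a.r3_modify_y hxy, a.r3_modify_z hxz hyz] at hr ⊢
    try simp only [hr]
    match_scalars <;> grind

/-- The modification uses only one of the colors at `x` and `y` and discards the other; the relation
between them along the top strand is what allows the discarded color to be recovered. -/
theorem r3_modify_modify (hxy : x ≠ y) (hxz : x ≠ z) (hyz : y ≠ z)
    (hr : a.R3TopRel σ e₁ e₂ e₃ x y o) :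
    a.r3Modify (-σ) e₁ e₂ e₃ x y z (a.r3Modify σ e₁ e₂ e₃ x y z o) = o := by
  have hs : (a.s : R) * ((a.s⁻¹ : Rˣ) : R) = 1 := by simp
  have ht : (a.t : R) * ((a.t⁻¹ : Rˣ) : R) = 1 := by simp
  ext b
  by_cases hx : b = x
  · subst hx
    rw [r3_modify_x, r3_modify_x, a.r3_modify_y hxy]
    unfold R3TopRel at hr
    rcases Int.units_eq_one_or (σ * e₁ * e₂ * e₃) with h | h
    · simp [h]
    · simp only [h, show ¬ ((-1 : ℤˣ) = 1) by decide, if_false] at hr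
      simp [h, hr]
  by_cases hy : b = y
  · subst hy
    rw [a.r3_modify_y hxy, r3_modify_x, a.r3_modify_y hxy]
    unfold R3TopRel at hr
    rcases Int.units_eq_one_or (σ * e₁ * e₂ * e₃) with h | h
    · simp only [h, if_true] at hr
      simp [h, hr]
    · simp [h]
  by_cases hz : b = z
  · subst hz
    rw [a.r3_modify_z hxz hyz, r3_modify_x, a.r3_modify_y hxy, a.r3_modify_z hxz hyz]
    unfold R3TopRel at hr
    have ht' := a.coeff_under_mul_neg e₁
    rcases Int.units_eq_one_or (σ * e₁ * e₂ * e₃) with h | h <;>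
    rcases Int.units_eq_one_or (σ * e₁) with h' | h' <;>
    simp only [neg_mul, h, show ¬ ((-1 : ℤˣ) = 1) by decide, if_true, if_false, neg_neg]
      at hr ⊢ <;>
    simp only [h', hr, show ¬ ((-1 : ℤˣ) = 1) by decide, if_true, if_false, neg_neg]
    all_goals match_scalars <;> grind
  · rw [a.r3_modify_of_ne hx hy hz, a.r3_modify_of_ne hx hy hz]

end Weights

theorem orderedPair_perm {β : Type} (o : ℤˣ) (x y : β) : (orderedPair o x y).Perm [x, y] := by
  unfold orderedPair
  split_ifs
  · exact List.Perm.refl _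
  · exact List.Perm.swap _ _ _

theorem r3_labels {σ e₁ e₂ e₃ : ℤˣ} {x y z : ℕ} {L v : List (Passage ℕ)} (h : IsGaussCode L)
    (hp : L.Perm (r3Top σ e₁ e₂ e₃ x y ++ r3Middle σ e₁ e₃ x z ++ r3Bottom σ e₂ e₃ y z ++ v)) :
    x ≠ y ∧ x ≠ z ∧ y ≠ z ∧ ∀ l ∈ v, l.label ≠ x ∧ l.label ≠ y ∧ l.label ≠ z := by
  classical
  have hp' : L.Perm ([⟨x, .over, e₁⟩, ⟨y, .over, e₂⟩] ++ [⟨x, .under, e₁⟩, ⟨z, .over, e₃⟩] ++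
      [⟨y, .under, e₂⟩, ⟨z, .under, e₃⟩] ++ v) :=
    hp.trans ((((orderedPair_perm _ _ _).append (orderedPair_perm _ _ _)).append
      (orderedPair_perm _ _ _)).append (List.Perm.refl _))
  have hx := h.label_ne (x := x) (k := .over) (a := e₁)
    (v := [⟨y, .over, e₂⟩, ⟨z, .over, e₃⟩, ⟨y, .under, e₂⟩, ⟨z, .under, e₃⟩] ++ v) (hp'.trans (by
      rw [List.perm_iff_count]; intro l
      simp only [PassageKind.opp, List.count_append, List.count_cons, List.count_nil]; omega))
  have hy := h.label_ne (x := y) (k := .over) (a := e₂)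
    (v := [⟨x, .over, e₁⟩, ⟨z, .over, e₃⟩, ⟨x, .under, e₁⟩, ⟨z, .under, e₃⟩] ++ v) (hp'.trans (by
      rw [List.perm_iff_count]; intro l
      simp only [PassageKind.opp, List.count_append, List.count_cons, List.count_nil]; omega))
  have hz := h.label_ne (x := z) (k := .over) (a := e₃)
    (v := [⟨x, .over, e₁⟩, ⟨y, .over, e₂⟩, ⟨x, .under, e₁⟩, ⟨y, .under, e₂⟩] ++ v) (hp'.trans (by
      rw [List.perm_iff_count]; intro l
      simp only [PassageKind.opp, List.count_append, List.count_cons, List.count_nil]; omega))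
  refine ⟨(hx ⟨y, .over, e₂⟩ (by simp)).symm, (hx ⟨z, .over, e₃⟩ (by simp)).symm,
    (hy ⟨z, .over, e₃⟩ (by simp)).symm, fun l hl => ⟨hx l ?_, hy l ?_, hz l ?_⟩⟩ <;>
  exact List.mem_append_right _ hl

namespace Weights

variable {R : Type} [CommRing R] (a : Weights R)

/-- The change of colors by `r3Modify` maps colorings to colorings. -/
theorem r3_mem_colorings {L L' : List (Passage ℕ)} {σ e₁ e₂ e₃ : ℤˣ} {x y z : ℕ}
    (hlab : ∀ b, (∃ l ∈ L, l.kind = .over ∧ l.label = b) →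
      ∃ l ∈ L', l.kind = .over ∧ l.label = b)
    (hx : ∃ l ∈ L', l.kind = .over ∧ l.label = x) (hy : ∃ l ∈ L', l.kind = .over ∧ l.label = y)
    (hz : ∃ l ∈ L', l.kind = .over ∧ l.label = z)
    {V : Type} [AddCommGroup V] [Module R V] {c : Option ℕ → V} (hc : c ∈ a.colorings L V)
    (key : a.Valid (a.r3Modify σ e₁ e₂ e₃ x y z (c ∘ some)) L' (c none) ∧
      a.run (a.r3Modify σ e₁ e₂ e₃ x y z (c ∘ some)) L' (c none) =
        a.run (c ∘ some) L (c none)) :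
    cons (c none) (a.r3Modify σ e₁ e₂ e₃ x y z (c ∘ some)) ∈ a.colorings L' V := by
  refine ⟨?_, ?_, fun b hb => ?_⟩
  · simpa using key.2.trans hc.1
  · simpa using key.1
  · have hbx : b ≠ x := by rintro rfl; obtain ⟨l, h1, h2, h3⟩ := hx; exact hb l h1 h2 h3
    have hby : b ≠ y := by rintro rfl; obtain ⟨l, h1, h2, h3⟩ := hy; exact hb l h1 h2 h3
    have hbz : b ≠ z := by rintro rfl; obtain ⟨l, h1, h2, h3⟩ := hz; exact hb l h1 h2 h3
    rw [cons_some, a.r3_modify_of_ne hbx hby hbz]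
    refine hc.2.2 b fun l hl hk he => ?_
    obtain ⟨l', h1, h2, h3⟩ := hlab b ⟨l, hl, hk, he⟩
    exact hb l' h1 h2 h3

/-- Words that differ by a third Reidemeister move, with the local properties of the change of
colors. -/
structure R3Pair (L L' : List (Passage ℕ)) (σ e₁ e₂ e₃ : ℤˣ) (x y z : ℕ) : Prop where
  labels : ∀ b, (∃ l ∈ L, l.kind = .over ∧ l.label = b) → ∃ l ∈ L', l.kind = .over ∧ l.label = b
  over_x : ∃ l ∈ L, l.kind = .over ∧ l.label = x
  over_y : ∃ l ∈ L, l.kind = .over ∧ l.label = y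
  over_z : ∃ l ∈ L, l.kind = .over ∧ l.label = z
  modify : ∀ (V : Type) [AddCommGroup V] [Module R V] (c : V) (o : ℕ → V), a.Valid o L c →
    a.R3TopRel σ e₁ e₂ e₃ x y o ∧ a.Valid (a.r3Modify σ e₁ e₂ e₃ x y z o) L' c ∧
      a.run (a.r3Modify σ e₁ e₂ e₃ x y z o) L' c = a.run o L c

/-- The bijection of colorings given by a third Reidemeister move. -/
def coloringsR3 {L L' : List (Passage ℕ)} {e₁ e₂ e₃ : ℤˣ} {x y z : ℕ} (hxy : x ≠ y)
    (hxz : x ≠ z) (hyz : y ≠ z) (h : a.R3Pair L L' 1 e₁ e₂ e₃ x y z)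
    (h' : a.R3Pair L' L (-1) e₁ e₂ e₃ x y z) : SolEquiv (a.colorings L) (a.colorings L') where
  toFun V _ _ c := cons (c none) (a.r3Modify 1 e₁ e₂ e₃ x y z (c ∘ some))
  invFun V _ _ c := cons (c none) (a.r3Modify (-1) e₁ e₂ e₃ x y z (c ∘ some))
  toFun_natural V W _ _ _ _ φ c := by rw [comp_cons, ← r3Modify_map]; rfl
  invFun_natural V W _ _ _ _ φ c := by rw [comp_cons, ← r3Modify_map]; rfl
  toFun_mem V _ _ c hc := a.r3_mem_colorings h.labels h'.over_x h'.over_y h'.over_z hc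
    (h.modify V _ _ hc.2.1).2
  invFun_mem V _ _ c hc := a.r3_mem_colorings h'.labels h.over_x h.over_y h.over_z hc
    (h'.modify V _ _ hc.2.1).2
  left_inv V _ _ c hc := by
    rw [cons_none, cons_comp_some,
      a.r3_modify_modify hxy hxz hyz (h.modify V _ _ hc.2.1).1, cons_eta]
  right_inv V _ _ c hc := by
    have := a.r3_modify_modify hxy hxz hyz (h'.modify V _ _ hc.2.1).1
    rw [neg_neg] at this
    rw [cons_none, cons_comp_some, this, cons_eta]

theorem r3Pair_tmb {σ e₁ e₂ e₃ : ℤˣ} {x y z : ℕ} {t u v w : List (Passage ℕ)}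
    (h : IsGaussCode (t ++ r3Top σ e₁ e₂ e₃ x y ++ u ++ r3Middle σ e₁ e₃ x z ++ v ++
      r3Bottom σ e₂ e₃ y z ++ w)) :
    (x ≠ y ∧ x ≠ z ∧ y ≠ z) ∧
    a.R3Pair (t ++ r3Top σ e₁ e₂ e₃ x y ++ u ++ r3Middle σ e₁ e₃ x z ++ v ++
        r3Bottom σ e₂ e₃ y z ++ w)
      (t ++ r3Top (-σ) e₁ e₂ e₃ x y ++ u ++ r3Middle (-σ) e₁ e₃ x z ++ v ++
        r3Bottom (-σ) e₂ e₃ y z ++ w) σ e₁ e₂ e₃ x y z := by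
  obtain ⟨hxy, hxz, hyz, hl⟩ := r3_labels (σ := σ) (e₁ := e₁) (e₂ := e₂) (e₃ := e₃) (x := x) (y := y)
    (z := z) (v := t ++ u ++ v ++ w) h (by
    classical
    rw [List.perm_iff_count]; intro l; simp only [List.count_append]; omega)
  refine ⟨⟨hxy, hxz, hyz⟩, ?_, ?_, ?_, ?_, ?_⟩
  · simp only [List.mem_append, r3Top, r3Middle, r3Bottom, mem_orderedPair]
    exact fun b h => h
  · exact ⟨⟨x, .over, e₁⟩, by simp [r3Top, mem_orderedPair], rfl, rfl⟩
  · exact ⟨⟨y, .over, e₂⟩, by simp [r3Top, mem_orderedPair], rfl, rfl⟩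
  · exact ⟨⟨z, .over, e₃⟩, by simp [r3Middle, mem_orderedPair], rfl, rfl⟩
  · intro V _ _ c o ho
    simp only [valid_append, run_append] at ho ⊢
    obtain ⟨⟨⟨⟨⟨⟨p1, p2⟩, p3⟩, p4⟩, p5⟩, p6⟩, p7⟩ := ho
    have hc : ∀ l ∈ t ++ u ++ v ++ w, a.r3Modify σ e₁ e₂ e₃ x y z o l.label = o l.label :=
      fun l hl' => a.r3_modify_of_ne (hl l hl').1 (hl l hl').2.1 (hl l hl').2.2
    have ht : ∀ l ∈ t, a.r3Modify σ e₁ e₂ e₃ x y z o l.label = o l.label :=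
      fun l hl => hc l (by simp [hl])
    have hu : ∀ l ∈ u, a.r3Modify σ e₁ e₂ e₃ x y z o l.label = o l.label :=
      fun l hl => hc l (by simp [hl])
    have hv : ∀ l ∈ v, a.r3Modify σ e₁ e₂ e₃ x y z o l.label = o l.label :=
      fun l hl => hc l (by simp [hl])
    have hw : ∀ l ∈ w, a.r3Modify σ e₁ e₂ e₃ x y z o l.label = o l.label :=
      fun l hl => hc l (by simp [hl])
    obtain ⟨q1, q2, q3⟩ := a.r3_top (z := z) hxy p2
    obtain ⟨q4, q5⟩ := a.r3_middle (e₂ := e₂) hxz hyz q1 p4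
    have q6 := a.r3_bottom (c := a.run o v (a.run o (r3Middle σ e₁ e₃ x z)
      (a.run o u (a.run o (r3Top σ e₁ e₂ e₃ x y) (a.run o t c))))) hxy hxz hyz q1
    have q7 : ∀ c' : V, a.Valid (a.r3Modify σ e₁ e₂ e₃ x y z o) (r3Bottom (-σ) e₂ e₃ y z) c' := by
      intro c'
      unfold r3Bottom orderedPair
      split_ifs <;> simp
    rw [a.run_congr ht, a.valid_congr ht, q3, a.run_congr hu, a.valid_congr hu, q5,
      a.run_congr hv, a.valid_congr hv, q6, a.run_congr hw, a.valid_congr hw]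
    exact ⟨q1, ⟨⟨⟨⟨⟨⟨p1, q2⟩, p3⟩, q4⟩, p5⟩, q7 _⟩, p7⟩, rfl⟩

theorem r3Pair_tbm {σ e₁ e₂ e₃ : ℤˣ} {x y z : ℕ} {t u v w : List (Passage ℕ)}
    (h : IsGaussCode (t ++ r3Top σ e₁ e₂ e₃ x y ++ u ++ r3Bottom σ e₂ e₃ y z ++ v ++
      r3Middle σ e₁ e₃ x z ++ w)) :
    (x ≠ y ∧ x ≠ z ∧ y ≠ z) ∧
    a.R3Pair (t ++ r3Top σ e₁ e₂ e₃ x y ++ u ++ r3Bottom σ e₂ e₃ y z ++ v ++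
        r3Middle σ e₁ e₃ x z ++ w)
      (t ++ r3Top (-σ) e₁ e₂ e₃ x y ++ u ++ r3Bottom (-σ) e₂ e₃ y z ++ v ++
        r3Middle (-σ) e₁ e₃ x z ++ w) σ e₁ e₂ e₃ x y z := by
  obtain ⟨hxy, hxz, hyz, hl⟩ := r3_labels (σ := σ) (e₁ := e₁) (e₂ := e₂) (e₃ := e₃) (x := x) (y := y)
    (z := z) (v := t ++ u ++ v ++ w) h (by
    classical
    rw [List.perm_iff_count]; intro l; simp only [List.count_append]; omega)
  refine ⟨⟨hxy, hxz, hyz⟩, ?_, ?_, ?_, ?_, ?_⟩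
  · simp only [List.mem_append, r3Top, r3Middle, r3Bottom, mem_orderedPair]
    exact fun b h => h
  · exact ⟨⟨x, .over, e₁⟩, by simp [r3Top, mem_orderedPair], rfl, rfl⟩
  · exact ⟨⟨y, .over, e₂⟩, by simp [r3Top, mem_orderedPair], rfl, rfl⟩
  · exact ⟨⟨z, .over, e₃⟩, by simp [r3Middle, mem_orderedPair], rfl, rfl⟩
  · intro V _ _ c o ho
    simp only [valid_append, run_append] at ho ⊢
    obtain ⟨⟨⟨⟨⟨⟨p1, p2⟩, p3⟩, p4⟩, p5⟩, p6⟩, p7⟩ := ho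
    have hc : ∀ l ∈ t ++ u ++ v ++ w, a.r3Modify σ e₁ e₂ e₃ x y z o l.label = o l.label :=
      fun l hl' => a.r3_modify_of_ne (hl l hl').1 (hl l hl').2.1 (hl l hl').2.2
    have ht : ∀ l ∈ t, a.r3Modify σ e₁ e₂ e₃ x y z o l.label = o l.label :=
      fun l hl => hc l (by simp [hl])
    have hu : ∀ l ∈ u, a.r3Modify σ e₁ e₂ e₃ x y z o l.label = o l.label :=
      fun l hl => hc l (by simp [hl])
    have hv : ∀ l ∈ v, a.r3Modify σ e₁ e₂ e₃ x y z o l.label = o l.label :=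
      fun l hl => hc l (by simp [hl])
    have hw : ∀ l ∈ w, a.r3Modify σ e₁ e₂ e₃ x y z o l.label = o l.label :=
      fun l hl => hc l (by simp [hl])
    obtain ⟨q1, q2, q3⟩ := a.r3_top (z := z) hxy p2
    have q6 := a.r3_bottom (c := a.run o u (a.run o (r3Top σ e₁ e₂ e₃ x y) (a.run o t c)))
      hxy hxz hyz q1
    obtain ⟨q4, q5⟩ := a.r3_middle (e₂ := e₂) hxz hyz q1 p6
    have q7 : ∀ c' : V, a.Valid (a.r3Modify σ e₁ e₂ e₃ x y z o) (r3Bottom (-σ) e₂ e₃ y z) c' := by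
      intro c'
      unfold r3Bottom orderedPair
      split_ifs <;> simp
    rw [a.run_congr ht, a.valid_congr ht, q3, a.run_congr hu, a.valid_congr hu, q6,
      a.run_congr hv, a.valid_congr hv, q5, a.run_congr hw, a.valid_congr hw]
    exact ⟨q1, ⟨⟨⟨⟨⟨⟨p1, q2⟩, p3⟩, q7 _⟩, p5⟩, q4⟩, p7⟩, rfl⟩

theorem nonempty_solEquiv_of_gaussMove {w w' : List (Passage ℕ)} (hw : IsGaussCode w)
    (hw' : IsGaussCode w') (h : GaussMove w w') :
    Nonempty (SolEquiv (a.colorings w) (a.colorings w')) := by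
  cases h with
  | relabel f w => exact ⟨a.coloringsRelabel w f fun _ _ _ _ h => f.injective h⟩
  | rotate u v => exact ⟨a.coloringsRotate u v⟩
  | r1 x k e u v => exact ⟨a.coloringsR1 hw⟩
  | r2_parallel x y k e u v w =>
    rcases hw.ne_virt (x := x) (k := k) (a := e) (by simp) with rfl | rfl
    · exact ⟨a.coloringsR2Over (i := true) hw⟩
    · exact ⟨a.coloringsR2Under (i := true) hw⟩
  | r2_antiparallel x y k e u v w =>
    rcases hw.ne_virt (x := x) (k := k) (a := e) (by simp) with rfl | rfl
    · exact ⟨a.coloringsR2Over (i := false) hw⟩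
    -- In the antiparallel case the over-pair comes second and in reversed order. Exchanging `x`
    -- with `y` and negating the sign brings it to the form treated by `coloringsR2Under`.
    · have hU : r2Under false y x (-e) = [⟨x, .under, e⟩, ⟨y, .under, -e⟩] := by
        simp [r2Under]
      have hO : ([⟨y, PassageKind.under.opp, -e⟩, ⟨x, PassageKind.under.opp, e⟩] :
          List (Passage ℕ)) = [⟨y, .over, -e⟩, ⟨x, .over, - -e⟩] := by
        simp [PassageKind.opp]
      rw [hO, ← hU] at hw ⊢
      exact ⟨a.coloringsR2Under hw⟩
  | r3_tmb x y z e₁ e₂ e₃ t u v w =>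
    have h1 := a.r3Pair_tmb hw
    have h2 := a.r3Pair_tmb hw'
    rw [neg_neg] at h2
    exact ⟨a.coloringsR3 h1.1.1 h1.1.2.1 h1.1.2.2 h1.2 h2.2⟩
  | r3_tbm x y z e₁ e₂ e₃ t u v w =>
    have h1 := a.r3Pair_tbm hw
    have h2 := a.r3Pair_tbm hw'
    rw [neg_neg] at h2
    exact ⟨a.coloringsR3 h1.1.1 h1.1.2.1 h1.1.2.2 h1.2 h2.2⟩

theorem nonempty_solEquiv_of_quot_eq {G H : GaussCode}
    (h : (Quot.mk _ G : VirtualKnot) = Quot.mk _ H) :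
    Nonempty (SolEquiv (a.colorings G.1) (a.colorings H.1)) := by
  have h' := Quot.eqvGen_exact h
  clear h
  induction h' with
  | rel G H h => exact a.nonempty_solEquiv_of_gaussMove G.2 H.2 h
  | refl G => exact ⟨SolEquiv.refl _⟩
  | symm G H _ ih => exact ih.map SolEquiv.symm
  | trans G H K _ _ ih₁ ih₂ =>
    obtain ⟨e⟩ := ih₁
    obtain ⟨e'⟩ := ih₂
    exact ⟨e.trans e'⟩

end Weights

/-! ### The virtual Alexander matrix and colorings -/

section FoxLinear

variable {X R : Type} [DecidableEq X] [CommRing R]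

theorem foxDerivative_inv (ψ : X → Rˣ) (x : X) (w : FreeGroup X) :
    foxDerivative ψ x w⁻¹ = -(((FreeGroup.lift ψ w)⁻¹ : Rˣ) : R) * foxDerivative ψ x w := by
  have h := foxDerivative_mul ψ x w⁻¹ w
  rw [inv_mul_cancel, foxDerivative_one, map_inv] at h
  linear_combination -h

variable {V ι : Type} [AddCommGroup V] [Module R V] [Fintype ι]

/-- The linear combination of given vectors whose coefficients are the Fox derivatives. -/
def foxSum (ψ : X → Rˣ) (f : ι → X) (c : ι → V) (w : FreeGroup X) : V :=
  ∑ j, foxDerivative ψ (f j) w • c j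

variable (ψ : X → Rˣ) (f : ι → X) (c : ι → V)

theorem foxSum_mul (u w : FreeGroup X) :
    foxSum ψ f c (u * w) = foxSum ψ f c u + ((FreeGroup.lift ψ u : Rˣ) : R) • foxSum ψ f c w := by
  simp [foxSum, foxDerivative_mul, add_smul, Finset.sum_add_distrib, Finset.smul_sum, mul_smul]

theorem foxSum_inv (w : FreeGroup X) :
    foxSum ψ f c w⁻¹ = -(((FreeGroup.lift ψ w)⁻¹ : Rˣ) : R) • foxSum ψ f c w := by
  simp [foxSum, foxDerivative_inv, Finset.smul_sum, mul_smul]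

theorem foxSum_of_apply [DecidableEq ι] (hf : Function.Injective f) (i : ι) :
    foxSum ψ f c (FreeGroup.of (f i)) = c i := by
  simp [foxSum, foxDerivative_of, hf.eq_iff, ite_smul]

theorem foxSum_of_ne {x : X} (hx : ∀ j, f j ≠ x) : foxSum ψ f c (FreeGroup.of x) = 0 := by
  refine Finset.sum_eq_zero fun j _ => ?_
  rw [foxDerivative_of, if_neg (Ne.symm (hx j)), zero_smul]

end FoxLinear

/-- Every under-passage has a matching over-passage, and over-passages are determined by their
labels. -/
structure IsMatched {α : Type} (w : List (Passage α)) : Prop where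
  over_unique : ∀ i j : Fin w.length, (w.get i).kind = .over → (w.get j).kind = .over →
    (w.get i).label = (w.get j).label → i = j
  exists_over : ∀ i : Fin w.length, (w.get i).kind = .under →
    ∃ j : Fin w.length, (w.get j).label = (w.get i).label ∧ (w.get j).kind = .over ∧
      (w.get j).sign = (w.get i).sign

/-- The values of the generators of the virtual knot group. -/
def Weights.generatorUnit {R : Type} [CommRing R] (a : Weights R) (n : ℕ) : VGGenerator n → Rˣ
  | .arc _ => a.t
  | .s => a.s
  | .q => a.q

/-- The matrix of Fox derivatives with the given values of the generators. -/
noncomputable def alexanderMatrix {α R : Type} [CommRing R] (a : Weights R)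
    (w : List (Passage α)) : Matrix (Fin (w.length + 1)) (Fin (w.length + 1)) R :=
  fun i j => foxDerivative (a.generatorUnit w.length) (VGGenerator.arc j) (vgRelator w i)

section AlexanderMatrix

variable {α R V : Type} [CommRing R] {w : List (Passage α)} [AddCommGroup V] [Module R V]
  (a : Weights R)

theorem IsMatched.overPassage_spec (hw : IsMatched w) {k : Fin w.length}
    (hk : (w.get k).kind = .under) :
    (w.get (overPassage w k)).label = (w.get k).label ∧ (w.get (overPassage w k)).kind = .over ∧
      (w.get (overPassage w k)).sign = (w.get k).sign := by
  obtain ⟨j, h1, h2, h3⟩ := hw.exists_over k hk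
  have h : ∃ j : Fin w.length, (w.get j).label = (w.get k).label ∧ (w.get j).kind = .over :=
    ⟨j, h1, h2⟩
  have e : overPassage w k = h.choose := dif_pos h
  have : overPassage w k = j := by
    rw [e]
    exact hw.over_unique _ _ h.choose_spec.2 h2 (h.choose_spec.1.trans h1.symm)
  rw [this]
  exact ⟨h1, h2, h3⟩

theorem vgGenerator_arc_injective {n : ℕ} : Function.Injective (VGGenerator.arc (n := n)) :=
  fun _ _ h => VGGenerator.arc.inj h

theorem sum_alexanderMatrix_castSucc (c : Fin (w.length + 1) → V) (k : Fin w.length) :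
    ∑ j, alexanderMatrix a w k.castSucc j • c j =
      foxSum (a.generatorUnit w.length) VGGenerator.arc c (passageRelator w k) := by
  simp [alexanderMatrix, foxSum, vgRelator]

theorem sum_alexanderMatrix_last (c : Fin (w.length + 1) → V) :
    ∑ j, alexanderMatrix a w (Fin.last _) j • c j = c (Fin.last _) - c 0 := by
  have : ∑ j, alexanderMatrix a w (Fin.last _) j • c j =
      foxSum (a.generatorUnit w.length) VGGenerator.arc c
        (FreeGroup.of (VGGenerator.arc (Fin.last w.length)) *
          (FreeGroup.of (VGGenerator.arc 0))⁻¹) := by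
    simp [alexanderMatrix, foxSum, vgRelator]
  rw [this, foxSum_mul, foxSum_inv, foxSum_of_apply _ _ _ vgGenerator_arc_injective,
    foxSum_of_apply _ _ _ vgGenerator_arc_injective]
  simp [Weights.generatorUnit, smul_smul, sub_eq_add_neg]

/-- The generators `s` and `q` contribute nothing, since derivatives are taken only with respect to
arcs. At an under-passage both the incoming and the outgoing over-arc still appear. -/
theorem foxSum_passageRelator (c : Fin (w.length + 1) → V) (k : Fin w.length) :
    foxSum (a.generatorUnit w.length) VGGenerator.arc c (passageRelator w k) =
      a.coeff (w.get k).kind (w.get k).sign • c k.castSucc - c k.succ +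
      match (w.get k).kind with
      | .over => 0
      | .under => if (w.get k).sign = 1 then
            c (overPassage w k).castSucc - (a.t : R) • c (overPassage w k).succ
          else c (overPassage w k).castSucc - ((a.t⁻¹ : Rˣ) : R) •
            c (overPassage w k).succ
      | .virt => 0 := by
  have hs : foxSum (a.generatorUnit w.length) VGGenerator.arc c
      (FreeGroup.of (VGGenerator.s (n := w.length))) = 0 := foxSum_of_ne _ _ _ fun j h => by cases h
  have hq : foxSum (a.generatorUnit w.length) VGGenerator.arc c
      (FreeGroup.of (VGGenerator.q (n := w.length))) = 0 := foxSum_of_ne _ _ _ fun j h => by cases h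
  have ha : ∀ i, foxSum (a.generatorUnit w.length) VGGenerator.arc c
      (FreeGroup.of (VGGenerator.arc i)) = c i := foxSum_of_apply _ _ _ vgGenerator_arc_injective
  have ht : (a.t : R) * ((a.t⁻¹ : Rˣ) : R) = 1 := by simp
  have hs' : (a.s : R) * ((a.s⁻¹ : Rˣ) : R) = 1 := by simp
  have hq' : (a.q : R) * ((a.q⁻¹ : Rˣ) : R) = 1 := by simp
  unfold passageRelator
  rcases hk : (w.get k).kind <;> rcases Int.units_eq_one_or (w.get k).sign with he | he
  all_goals
    simp only [he, if_true, show ¬ ((-1 : ℤˣ) = 1) by decide, if_false, foxSum_mul, foxSum_inv,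
      hs, hq, ha, map_mul, map_inv, FreeGroup.lift_apply_of, Weights.generatorUnit,
      Weights.coeff_over_one, Weights.coeff_over_neg_one, Weights.coeff_under_one,
      Weights.coeff_under_neg_one, Weights.coeff_virt_one, Weights.coeff_virt_neg_one,
      Units.val_mul]
    match_scalars <;> grind

/-- The relation at the over-passage of a crossing expresses the outgoing over-arc as `s ^ e` times
the incoming one. Substituting this at the under-passage produces the coefficient `1 - (s * t) ^ e`.
The signs agree because the word is matched. -/
theorem mem_solutions_alexanderMatrix (hw : IsMatched w) (c : Fin (w.length + 1) → V) :
    c ∈ (alexanderMatrix a w).solutions V ↔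
      (∀ k : Fin w.length, c k.succ =
        a.coeff (w.get k).kind (w.get k).sign • c k.castSucc +
        a.overCoeff (w.get k).kind (w.get k).sign •
          c (overPassage w k).castSucc) ∧ c (Fin.last _) = c 0 := by
  have ht : (a.t : R) * ((a.t⁻¹ : Rˣ) : R) = 1 := by simp
  have hs' : (a.s : R) * ((a.s⁻¹ : Rˣ) : R) = 1 := by simp
  have h0 : c ∈ (alexanderMatrix a w).solutions V ↔
      (∀ k : Fin w.length, foxSum (a.generatorUnit w.length) VGGenerator.arc c
        (passageRelator w k) = 0) ∧ c (Fin.last _) = c 0 := by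
    constructor
    · intro h
      refine ⟨fun k => ?_, ?_⟩
      · rw [← sum_alexanderMatrix_castSucc a]; exact h _
      · rw [← sub_eq_zero, ← sum_alexanderMatrix_last a]; exact h _
    · rintro ⟨h1, h2⟩ i
      refine Fin.lastCases ?_ (fun k => ?_) i
      · rw [sum_alexanderMatrix_last, h2, sub_self]
      · rw [sum_alexanderMatrix_castSucc, h1]
  have hover : ∀ k : Fin w.length, (w.get k).kind = .over →
      (foxSum (a.generatorUnit w.length) VGGenerator.arc c (passageRelator w k) = 0 ↔
      c k.succ = a.coeff .over (w.get k).sign • c k.castSucc) := by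
    intro k hk
    rw [foxSum_passageRelator, hk]
    simp only [add_zero, sub_eq_zero]
    exact eq_comm
  rw [h0]
  refine and_congr_left fun _ => ?_
  constructor
  · intro h k
    have hk0 := h k
    rcases hk : (w.get k).kind
    · rw [(hover k hk).1 hk0]; simp
    -- The over-passage relation of the same crossing eliminates the outgoing over-arc.
    · obtain ⟨-, h2, h3⟩ := hw.overPassage_spec hk
      have ho := (hover _ h2).1 (h _)
      rw [foxSum_passageRelator, hk] at hk0
      rw [← sub_eq_zero]
      refine Eq.trans ?_ (neg_eq_zero.2 hk0)
      rw [h3] at ho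
      simp only [ho]
      rcases Int.units_eq_one_or (w.get k).sign with he | he <;>
      simp only [he, if_true, show ¬ ((-1 : ℤˣ) = 1) by decide, if_false,
        Weights.coeff_over_one, Weights.coeff_over_neg_one, Weights.coeff_under_one,
        Weights.coeff_under_neg_one, Weights.overCoeff_under_one,
        Weights.overCoeff_under_neg_one]
      all_goals module
    · rw [foxSum_passageRelator, hk] at hk0
      simp only [add_zero, sub_eq_zero] at hk0
      rw [← hk0]; simp
  · intro h k
    rcases hk : (w.get k).kind
    · rw [hover k hk, h k, hk]; simp
    · obtain ⟨-, h2, h3⟩ := hw.overPassage_spec hk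
      have ho := h (overPassage w k)
      rw [foxSum_passageRelator, hk, h k, hk]
      rw [h3, h2] at ho
      simp only [ho]
      rcases Int.units_eq_one_or (w.get k).sign with he | he <;>
      simp only [he, if_true, show ¬ ((-1 : ℤˣ) = 1) by decide, if_false,
        Weights.coeff_over_one, Weights.coeff_over_neg_one, Weights.coeff_under_one,
        Weights.coeff_under_neg_one, Weights.overCoeff_under_one,
        Weights.overCoeff_under_neg_one, Weights.overCoeff_over]
      all_goals module
    · rw [foxSum_passageRelator, hk, h k, hk]; simp

theorem Weights.run_take_succ (o : α → V)
    (k : Fin w.length) (c : V) :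
    a.run o (w.take (k + 1)) c = a.step o (w.get k) (a.run o (w.take k) c) := by
  rw [List.take_add_one, a.run_append]
  simp

theorem Weights.valid_iff_take (o : α → V)
    (c : V) : a.Valid o w c ↔ ∀ k : Fin w.length, (w.get k).kind = .over →
      o (w.get k).label = a.run o (w.take k) c := by
  induction w generalizing c with
  | nil => exact ⟨fun _ k => k.elim0, fun _ => trivial⟩
  | cons l w ih =>
    rw [valid_cons, ih]
    constructor
    · rintro ⟨h1, h2⟩ k
      refine Fin.cases h1 (fun k => ?_) k
      simpa using h2 k
    · intro h
      exact ⟨h ⟨0, by simp⟩, fun k => by simpa using h k.succ⟩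

end AlexanderMatrix

open Classical in
/-- The kernel of the virtual Alexander matrix is given by the colorings of the word. -/
noncomputable def alexanderMatrixSolEquiv {α R : Type} [CommRing R] (a : Weights R)
    {w : List (Passage α)} (hw : IsMatched w) :
    SolEquiv (alexanderMatrix a w).solutions (a.colorings w) := by
  -- The color attached to a label is that of the arc entering the over-passage, and zero if no
  -- over-passage has this label.
  let O : ∀ {V : Type} [AddCommGroup V], (Fin (w.length + 1) → V) → α → V := fun c b =>
    if h : ∃ j : Fin w.length, (w.get j).label = b ∧ (w.get j).kind = .over
    then c h.choose.castSucc else 0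
  have hO : ∀ {V : Type} [AddCommGroup V] (c : Fin (w.length + 1) → V) (j : Fin w.length),
      (w.get j).kind = .over → O c (w.get j).label = c j.castSucc := by
    intro V _ c j hj
    have h : ∃ j' : Fin w.length, (w.get j').label = (w.get j).label ∧ (w.get j').kind = .over :=
      ⟨j, rfl, hj⟩
    have e : O c (w.get j).label = c h.choose.castSucc := dif_pos h
    rw [e, hw.over_unique _ _ h.choose_spec.2 hj h.choose_spec.1]
  -- A solution is reconstructed from the color at the base point and the over-colors by running
  -- through the word.
  have hrun : ∀ {V : Type} [AddCommGroup V] [Module R V] (c : Fin (w.length + 1) → V),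
      c ∈ (alexanderMatrix a w).solutions V → ∀ i : Fin (w.length + 1),
      a.run (O c) (w.take i) (c 0) = c i := by
    intro V _ _ c hc i
    obtain ⟨h1, h2⟩ := (mem_solutions_alexanderMatrix a hw c).1 hc
    induction i using Fin.induction with
    | zero => simp
    | succ k ih =>
      rw [Fin.val_succ, Weights.run_take_succ, h1, Weights.step]
      simp only [Fin.val_castSucc] at ih
      rw [ih]
      rcases hk : (w.get k).kind
      · simp
      · obtain ⟨q1, q2, q3⟩ := hw.overPassage_spec hk
        rw [← q1, hO c _ q2]
      · simp
  exact
  { toFun := fun V _ _ c => Weights.cons (c 0) (O c)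
    invFun := fun V _ _ x i => a.run (x ∘ some) (w.take i) (x none)
    toFun_natural := fun V W _ _ _ _ φ c => by
      rw [Weights.comp_cons]
      congr 1
      ext b
      by_cases h : ∃ j : Fin w.length, (w.get j).label = b ∧ (w.get j).kind = .over
      · simp only [O, Function.comp_apply, dif_pos h]
      · simp only [O, Function.comp_apply, dif_neg h, map_zero]
    invFun_natural := fun V W _ _ _ _ φ x => by
      ext i
      exact Weights.run_map _ φ _ _ _
    toFun_mem := fun V _ _ c hc => by
      refine ⟨?_, ?_, ?_⟩
      · have h := hrun c hc (Fin.last _)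
        rw [Fin.val_last, List.take_length,
          ((mem_solutions_alexanderMatrix a hw c).1 hc).2] at h
        exact h
      · rw [Weights.valid_iff_take]
        intro k hk
        exact (hO c k hk).trans (hrun c hc k.castSucc).symm
      · intro b hb
        refine dif_neg ?_
        rintro ⟨j, h1, h2⟩
        exact hb _ (List.get_mem _ _) h2 h1
    invFun_mem := fun V _ _ x hx => by
      obtain ⟨h1, h2, h3⟩ := hx
      rw [Weights.valid_iff_take] at h2
      rw [mem_solutions_alexanderMatrix a hw]
      refine ⟨fun k => ?_, ?_⟩
      · rw [Fin.val_succ, Weights.run_take_succ, Weights.step, Fin.val_castSucc]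
        rcases hk : (w.get k).kind
        · simp
        · obtain ⟨q1, q2, q3⟩ := hw.overPassage_spec hk
          rw [Fin.val_castSucc, ← h2 _ q2, q1]
        · simp
      · simpa using h1
    left_inv := fun V _ _ c hc => by
      ext i
      exact hrun c hc i
    right_inv := fun V _ _ x hx => by
      obtain ⟨h1, h2, h3⟩ := hx
      rw [Weights.valid_iff_take] at h2
      conv_rhs => rw [← Weights.cons_eta x]
      congr 1
      ext b
      by_cases h : ∃ j : Fin w.length, (w.get j).label = b ∧ (w.get j).kind = .over
      · obtain ⟨j, rfl, hj⟩ := h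
        refine Eq.trans (hO (fun i : Fin (w.length + 1) =>
          a.run (x ∘ some) (w.take i) (x none)) j hj) (h2 j hj).symm
      · have e : O (fun i : Fin (w.length + 1) =>
          a.run (x ∘ some) (w.take i) (x none)) b = 0 := dif_neg h
        rw [e]
        refine (h3 b fun l hl hk he => h ?_).symm
        obtain ⟨j, hj⟩ := List.get_of_mem hl
        exact ⟨j, by rw [hj, he], by rw [hj, hk]⟩ }

/-! ### Change of rings -/

/-- The weights given by the variables. -/
noncomputable def laurentWeights : Weights LaurentSTQ := ⟨varS, varT, varQ⟩

theorem virtualAlexanderMatrix_eq {α : Type} (w : List (Passage α)) :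
    virtualAlexanderMatrix w = alexanderMatrix laurentWeights w := by
  have : vgAbelianization w.length = laurentWeights.generatorUnit w.length := by
    ext g; cases g <;> rfl
  ext1 i j
  unfold virtualAlexanderMatrix alexanderMatrix
  rw [this]

/-- The image of weights under a ring homomorphism. -/
def Weights.map {R R' : Type} [CommRing R] [CommRing R'] (a : Weights R) (φ : R →+* R') :
    Weights R' :=
  ⟨Units.map φ.toMonoidHom a.s, Units.map φ.toMonoidHom a.t, Units.map φ.toMonoidHom a.q⟩

theorem map_foxDerivative {X R R' : Type} [DecidableEq X] [CommRing R] [CommRing R']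
    (φ : R →+* R') (ψ : X → Rˣ) (x : X) (w : FreeGroup X) :
    φ (foxDerivative ψ x w) = foxDerivative (fun y => Units.map φ.toMonoidHom (ψ y)) x w := by
  have hl : ∀ w : FreeGroup X, Units.map φ.toMonoidHom (FreeGroup.lift ψ w) =
      FreeGroup.lift (fun y => Units.map φ.toMonoidHom (ψ y)) w := by
    intro w
    induction w using FreeGroup.induction_on <;> simp_all
  have hl' : ∀ w : FreeGroup X, φ ((FreeGroup.lift ψ w : Rˣ) : R) =
      ((FreeGroup.lift (fun y => Units.map φ.toMonoidHom (ψ y)) w : R'ˣ) : R') := fun w => by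
    rw [← hl]; rfl
  induction w using FreeGroup.induction_on with
  | C1 => simp [foxDerivative_one]
  | of y => simp [foxDerivative_of, apply_ite φ]
  | inv_of y h =>
    rw [foxDerivative_inv, foxDerivative_inv, map_mul, h, ← map_inv, ← map_inv, map_neg, hl']
  | mul u v hu hv => rw [foxDerivative_mul, foxDerivative_mul, map_add, map_mul, hu, hv, hl']

theorem alexanderMatrix_map {α R R' : Type} [CommRing R] [CommRing R'] (φ : R →+* R')
    (a : Weights R) (w : List (Passage α)) :
    (alexanderMatrix a w).map φ = alexanderMatrix (a.map φ) w := by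
  ext i j
  rw [Matrix.map_apply, alexanderMatrix, map_foxDerivative]
  have : (fun y => Units.map φ.toMonoidHom (a.generatorUnit w.length y)) =
      (a.map φ).generatorUnit w.length := by
    ext g; cases g <;> rfl
  rw [this]
  rfl

/-! ### Removing the virtual crossings -/

/-- The change of the index of an arc at a passage: `1` if the strand passes from left to right. -/
def Passage.side {α : Type} (l : Passage α) : ℤˣ :=
  match l.kind with
  | .over => l.sign
  | .under => -l.sign
  | .virt => l.sign

/-- The numbers `i` are the indices of the incoming over-crossing arcs, if the index of the arc at
the base point is `m`, and at each classical crossing the index of the outgoing under-crossing arc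
is that of the incoming over-crossing arc. -/
def IsIndexed {α : Type} (i : α → ℤ) : List (Passage α) → ℤ → Prop
  | [], _ => True
  | l :: w, m => (l.kind = .over → i l.label = m) ∧ (l.kind = .under → i l.label = m - l.side) ∧
      IsIndexed i w (m - l.side)

namespace Weights

variable {R : Type} [CommRing R] (a : Weights R)

/-- The weights for words without virtual crossings. -/
def classical : Weights R := ⟨a.s * a.q⁻¹, a.t * a.q, 1⟩

variable {α V : Type} [AddCommGroup V] [Module R V] {w : List (Passage α)} {i : α → ℤ}

/-- An arc of index `m` is rescaled by `q ^ m`. The index drops by the side of the passage, which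
turns the coefficients `s ^ e`, `t ^ e`, `q ^ e` into `(s * q⁻¹) ^ e`, `(t * q) ^ e`, `1`. The
over-term keeps its coefficient because the incoming over-arc and the outgoing under-arc have the
same index and the product `s * t` is unchanged. -/
theorem zpow_q_mul_step (o : α → V) (l : Passage α) (m : ℤ) (c : V)
    (h1 : l.kind = .under → i l.label = m - l.side) :
    a.classical.step (fun b => ((a.q ^ i b : Rˣ) : R) • o b) l (((a.q ^ m : Rˣ) : R) • c) =
      ((a.q ^ (m - l.side) : Rˣ) : R) • a.step o l c := by
  have hq : (a.q : R) * ((a.q⁻¹ : Rˣ) : R) = 1 := by simp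
  have hu : ∀ n : ℤ, ((a.q ^ (n - 1) : Rˣ) : R) = ((a.q⁻¹ : Rˣ) : R) * ((a.q ^ n : Rˣ) : R) := by
    intro n; rw [zpow_sub_one, Units.val_mul, mul_comm]
  have hd : ∀ n : ℤ, ((a.q ^ (n + 1) : Rˣ) : R) = (a.q : R) * ((a.q ^ n : Rˣ) : R) := by
    intro n; rw [zpow_add_one, Units.val_mul, mul_comm]
  obtain ⟨b, k, e⟩ := l
  unfold step
  rcases k
  · rcases Int.units_eq_one_or e with rfl | rfl <;>
    simp [Passage.side, classical, hu, hd, smul_smul]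
    all_goals congr 1; grind
  · have hi := h1 rfl
    simp only at hi ⊢
    rw [hi]
    rcases Int.units_eq_one_or e with rfl | rfl <;>
    simp [Passage.side, classical, hu, hd, smul_smul]
    all_goals match_scalars <;> grind
  · rcases Int.units_eq_one_or e with rfl | rfl <;>
    simp [Passage.side, classical, hu, hd, smul_smul, coeff]
    all_goals congr 1; grind

theorem zpow_q_mul_run (o : α → V) (m : ℤ) (c : V) (h : IsIndexed i w m) :
    a.classical.run (fun b => ((a.q ^ i b : Rˣ) : R) • o b) w (((a.q ^ m : Rˣ) : R) • c) =
      ((a.q ^ (m - (w.map fun l => (l.side : ℤ)).sum) : Rˣ) : R) • a.run o w c ∧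
    (a.classical.Valid (fun b => ((a.q ^ i b : Rˣ) : R) • o b) w (((a.q ^ m : Rˣ) : R) • c) ↔
      a.Valid o w c) := by
  induction w generalizing c m with
  | nil => simp
  | cons l w ih =>
    obtain ⟨h1, h2, h3⟩ := h
    obtain ⟨k1, k2⟩ := ih (m - l.side) (a.step o l c) h3
    rw [run_cons, run_cons, valid_cons, valid_cons, a.zpow_q_mul_step o l m c h2, k1, k2]
    refine ⟨?_, and_congr_left fun _ => ?_⟩
    · rw [List.map_cons, List.sum_cons, sub_sub]
    · constructor
      · intro h4 hl
        have := h4 hl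
        rw [h1 hl] at this
        simpa [smul_smul] using congrArg (fun x => (((a.q ^ m)⁻¹ : Rˣ) : R) • x) this
      · intro h4 hl
        rw [h1 hl, h4 hl]

/-- Rescaling of colorings by the index. -/
def coloringsClassical (h : IsIndexed i w 0) (h0 : (w.map fun l => (l.side : ℤ)).sum = 0) :
    SolEquiv (a.colorings w) (a.classical.colorings w) where
  toFun V _ _ x := cons (x none) fun b => ((a.q ^ i b : Rˣ) : R) • x (some b)
  invFun V _ _ x := cons (x none) fun b => (((a.q ^ i b)⁻¹ : Rˣ) : R) • x (some b)
  toFun_natural V W _ _ _ _ φ x := by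
    rw [comp_cons]; congr 1; ext b; simp
  invFun_natural V W _ _ _ _ φ x := by
    rw [comp_cons]; congr 1; ext b; simp
  toFun_mem V _ _ x hx := by
    obtain ⟨h1, h2, h3⟩ := hx
    obtain ⟨k1, k2⟩ := a.zpow_q_mul_run (x ∘ some) 0 (x none) h
    simp only [h0, sub_zero, zpow_zero, Units.val_one, one_smul] at k1 k2
    refine ⟨?_, k2.2 h2, fun b hb => ?_⟩
    · rw [cons_comp_some, cons_none]; exact k1.trans h1
    · rw [cons_some, h3 b hb, smul_zero]
  invFun_mem V _ _ x hx := by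
    obtain ⟨h1, h2, h3⟩ := hx
    obtain ⟨k1, k2⟩ := a.zpow_q_mul_run
      (fun b => (((a.q ^ i b)⁻¹ : Rˣ) : R) • x (some b)) 0 (x none) h
    simp only [h0, sub_zero, zpow_zero, Units.val_one, one_smul, smul_smul, Units.mul_inv] at k1 k2
    refine ⟨?_, k2.1 h2, fun b hb => ?_⟩
    · rw [cons_comp_some, cons_none]; exact k1.symm.trans h1
    · rw [cons_some, h3 b hb, smul_zero]
  left_inv V _ _ x hx := by
    conv_rhs => rw [← cons_eta x]
    simp only [cons_none, cons_some, smul_smul, Units.inv_mul, one_smul]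
    rfl
  right_inv V _ _ x hx := by
    conv_rhs => rw [← cons_eta x]
    simp only [cons_none, cons_some, smul_smul, Units.mul_inv, one_smul]
    rfl

theorem run_filter (ha : a.q = 1) (o : α → V) (c : V) :
    a.run o (w.filter fun l => l.kind ≠ .virt) c = a.run o w c ∧
    (a.Valid o (w.filter fun l => l.kind ≠ .virt) c ↔ a.Valid o w c) := by
  induction w generalizing c with
  | nil => exact ⟨rfl, Iff.rfl⟩
  | cons l w ih =>
    by_cases hl : l.kind = .virt
    · have hs : a.step o l c = c := by simp [step, hl, coeff, ha]
      rw [List.filter_cons_of_neg (by simpa using hl), run_cons, valid_cons, hs, (ih c).1, (ih c).2]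
      simp [hl]
    · rw [List.filter_cons_of_pos (by simpa using hl), run_cons, valid_cons, run_cons, valid_cons,
        (ih _).1, (ih _).2]
      exact ⟨rfl, Iff.rfl⟩

/-- Virtual passages of weight `1` do not change the colorings. -/
def coloringsFilter (ha : a.q = 1) (w : List (Passage α)) :
    SolEquiv (a.colorings w) (a.colorings (w.filter fun l => l.kind ≠ .virt)) :=
  SolEquiv.ofEq fun V _ _ x => by
    have hm : ∀ l, (l ∈ w.filter (fun l => l.kind ≠ .virt) ∧ l.kind = .over) ↔
        (l ∈ w ∧ l.kind = .over) := by
      intro l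
      simp only [List.mem_filter, decide_eq_true_eq]
      constructor
      · rintro ⟨⟨h1, -⟩, h2⟩; exact ⟨h1, h2⟩
      · rintro ⟨h1, h2⟩; exact ⟨⟨h1, by simp [h2]⟩, h2⟩
    rw [mem_colorings, mem_colorings, (a.run_filter ha _ _).1, (a.run_filter ha _ _).2]
    refine and_congr_right fun _ => and_congr_right fun _ => forall_congr' fun b => ?_
    have : (∀ l ∈ w, l.kind = .over → l.label ≠ b) ↔
        ∀ l ∈ w.filter (fun l => l.kind ≠ .virt), l.kind = .over → l.label ≠ b :=
      ⟨fun h l h1 h2 => h l ((hm l).1 ⟨h1, h2⟩).1 h2, fun h l h1 h2 => h l ((hm l).2 ⟨h1, h2⟩).1 h2⟩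
    rw [this]

end Weights

/-! ### Winding integrals along arcs of curves -/

section Winding

open Filter Topology Set

/-- The integral of the logarithmic derivative of `γ - z` along an arc. -/
noncomputable def windingIntegral (γ : ℝ → ℂ) (b e : ℝ) (z : ℂ) : ℂ :=
  ∫ y in b..e, deriv γ y / (γ y - z)

variable {γ : ℝ → ℂ} {b e : ℝ}

theorem continuous_clamp (b e : ℝ) : Continuous fun y : ℝ => max b (min y e) := by fun_prop

theorem clamp_mem (hbe : b ≤ e) (y : ℝ) : max b (min y e) ∈ Icc b e :=
  ⟨le_max_left _ _, max_le hbe (min_le_right _ _)⟩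

theorem clamp_eq {y : ℝ} (hy : y ∈ Icc b e) : max b (min y e) = y := by
  rw [min_eq_left hy.2, max_eq_right hy.1]

theorem windingIntegral_eq_clamp (z : ℂ) {y : ℝ} (hy : y ∈ Icc b e) :
    windingIntegral γ b y z = ∫ x in b..y,
      deriv γ (max b (min x e)) / (γ (max b (min x e)) - z) := by
  refine intervalIntegral.integral_congr fun x hx => ?_
  rw [uIcc_of_le hy.1] at hx
  simp only [clamp_eq (e := e) ⟨hx.1, hx.2.trans hy.2⟩]

/-- The product of `γ y - z` with the exponential of minus the integral up to `y` has derivative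
zero. -/
theorem exp_windingIntegral (hγ : ContDiff ℝ 1 γ) (hbe : b ≤ e) {z : ℂ}
    (hz : ∀ y ∈ Icc b e, γ y ≠ z) :
    Complex.exp (windingIntegral γ b e z) = (γ e - z) / (γ b - z) := by
  have hd : ∀ y, HasDerivAt γ (deriv γ y) y := fun y =>
    (hγ.differentiable (by norm_num) y).hasDerivAt
  have hc : Continuous (deriv γ) := hγ.continuous_deriv (by norm_num)
  -- The curve may pass through `z` outside `[b, e]`; clamping the argument makes the integrand
  -- continuous on the whole line without changing it on the arc.
  set f : ℝ → ℂ := fun x => deriv γ (max b (min x e)) / (γ (max b (min x e)) - z) with hf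
  have hfc : Continuous f := by
    refine (hc.comp (continuous_clamp b e)).div
      ((hγ.continuous.comp (continuous_clamp b e)).sub continuous_const) fun x => ?_
    exact sub_ne_zero.2 (hz _ (clamp_mem hbe x))
  set I : ℝ → ℂ := fun y => ∫ x in b..y, f x with hI
  have hId : ∀ y, HasDerivAt I (f y) y := fun y =>
    intervalIntegral.integral_hasDerivAt_right (hfc.intervalIntegrable _ _)
      (hfc.stronglyMeasurableAtFilter _ _) hfc.continuousAt
  have key := constant_of_has_deriv_right_zero
    (f := fun y => (γ y - z) * Complex.exp (-I y)) (a := b) (b := e) ?_ ?_ e ⟨hbe, le_rfl⟩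
  · have h0 : I b = 0 := by simp [hI]
    have h1 : I e = windingIntegral γ b e z := (windingIntegral_eq_clamp z ⟨hbe, le_rfl⟩).symm
    simp only [h0, h1, neg_zero, Complex.exp_zero, mul_one] at key
    rw [← key, Complex.exp_neg]
    have := sub_ne_zero.2 (hz e ⟨hbe, le_rfl⟩)
    have h2 := Complex.exp_ne_zero (windingIntegral γ b e z)
    field_simp
  · refine Continuous.continuousOn ?_
    have : Continuous I := continuous_iff_continuousAt.2 fun y => (hId y).continuousAt
    exact (hγ.continuous.sub continuous_const).mul (Complex.continuous_exp.comp this.neg)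
  · intro y hy
    have h := ((hd y).sub_const z).mul ((hId y).neg.cexp)
    have hfy : f y = deriv γ y / (γ y - z) := by
      simp only [hf, clamp_eq (Ico_subset_Icc_self hy)]
    have hne := sub_ne_zero.2 (hz y (Ico_subset_Icc_self hy))
    rw [hfy] at h
    have h0 : deriv γ y * Complex.exp ((-I) y) +
        (γ y - z) * (Complex.exp ((-I) y) * -(deriv γ y / (γ y - z))) = 0 := by
      field_simp
      ring
    rw [h0] at h
    exact h.hasDerivWithinAt

theorem continuousOn_windingIntegral (hγ : ContDiff ℝ 1 γ) (hbe : b ≤ e) :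
    ContinuousOn (windingIntegral γ b e) {z | ∀ y ∈ Icc b e, γ y ≠ z} := by
  have hc : Continuous (deriv γ) := hγ.continuous_deriv (by norm_num)
  rw [continuousOn_iff_continuous_domRestrict]
  have h : Continuous fun z : {z : ℂ | ∀ y ∈ Icc b e, γ y ≠ z} => ∫ x in b..e,
      deriv γ (max b (min x e)) / (γ (max b (min x e)) - z) := by
    refine intervalIntegral.continuous_parametric_intervalIntegral_of_continuous' ?_ b e
    refine Continuous.div ?_ ?_ ?_
    · exact hc.comp ((continuous_clamp b e).comp continuous_snd)
    · exact (hγ.continuous.comp ((continuous_clamp b e).comp continuous_snd)).sub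
        (continuous_subtype_val.comp continuous_fst)
    · rintro ⟨⟨z, hz⟩, x⟩
      exact sub_ne_zero.2 (hz _ (clamp_mem hbe x))
  refine h.congr fun z => ?_
  exact (windingIntegral_eq_clamp z ⟨hbe, le_rfl⟩).symm

theorem windingIntegral_mem (hγ : ContDiff ℝ 1 γ) (hbe : b ≤ e) (hcl : γ e = γ b) {z : ℂ}
    (hz : ∀ y ∈ Icc b e, γ y ≠ z) :
    windingIntegral γ b e z ∈ AddSubgroup.zmultiples (2 * Real.pi * Complex.I : ℂ) := by
  have h := exp_windingIntegral hγ hbe hz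
  rw [hcl, div_self (sub_ne_zero.2 (hz b ⟨le_rfl, hbe⟩)), Complex.exp_eq_one_iff] at h
  obtain ⟨n, hn⟩ := h
  exact ⟨n, by simp [hn]⟩

/-- For a closed arc the integral lies in the discrete group generated by `2 * π * I`, and it is
continuous in the point off the arc. -/
theorem windingIntegral_eq_of_isPreconnected (hγ : ContDiff ℝ 1 γ) (hbe : b ≤ e)
    (hcl : γ e = γ b) {U : Set ℂ} (hU : IsPreconnected U)
    (hUγ : ∀ z ∈ U, ∀ y ∈ Icc b e, γ y ≠ z) {z z' : ℂ} (hz : z ∈ U) (hz' : z' ∈ U) :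
    windingIntegral γ b e z = windingIntegral γ b e z' := by
  have : DiscreteTopology (AddSubgroup.zmultiples (2 * Real.pi * Complex.I : ℂ)) :=
    NormedSpace.discreteTopology_zmultiples _
  exact hU.constant_of_mapsTo (T := (AddSubgroup.zmultiples (2 * Real.pi * Complex.I : ℂ) : Set ℂ))
    ⟨this⟩ ((continuousOn_windingIntegral hγ hbe).mono hUγ)
    (fun z hz => windingIntegral_mem hγ hbe hcl (hUγ z hz)) hz hz'

/-- A cyclic subgroup of the plane is closed and discrete, so convergence inside it means being
eventually constant. This turns limits of winding integrals into exact values. -/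
theorem eventually_eq_of_tendsto_zmultiples {ι : Type*} {l : Filter ι} [l.NeBot] {f : ι → ℂ}
    {c L : ℂ} (hf : ∀ᶠ x in l, f x ∈ AddSubgroup.zmultiples c)
    (hL : Tendsto f l (𝓝 L)) : ∀ᶠ x in l, f x = L := by
  have : DiscreteTopology (AddSubgroup.zmultiples c) := NormedSpace.discreteTopology_zmultiples _
  have hcl : IsClosed (AddSubgroup.zmultiples c : Set ℂ) := AddSubgroup.isClosed_of_discrete
  have hmem : L ∈ AddSubgroup.zmultiples c := hcl.mem_of_tendsto hL hf
  have hsub : Tendsto (fun x => f x - L) l (𝓝 0) := by simpa using hL.sub_const L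
  obtain ⟨V, hV, hV'⟩ := (discreteTopology_subtype_iff'.1 this) 0 (zero_mem _)
  filter_upwards [hf, hsub (hV.mem_nhds (by
    have : (0 : ℂ) ∈ V ∩ (AddSubgroup.zmultiples c : Set ℂ) := by rw [hV']; rfl
    exact this.1))] with x hx hx'
  have : f x - L ∈ V ∩ (AddSubgroup.zmultiples c : Set ℂ) := ⟨hx', sub_mem hx hmem⟩
  rw [hV'] at this
  exact sub_eq_zero.1 this

theorem HasDerivAt.eventually_abs_le {f : ℝ → ℂ} {m : ℂ} {x₀ : ℝ} (h : HasDerivAt f m x₀)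
    (h0 : f x₀ = 0) {ε : ℝ} (hε : 0 < ε) :
    ∀ᶠ x in 𝓝 x₀, ‖f x - (x - x₀) * m‖ ≤ ε * |x - x₀| := by
  have := (hasDerivAt_iff_isLittleO.1 h).def hε
  filter_upwards [this] with x hx
  simpa [h0, Complex.real_smul] using hx

theorem HasDerivAt.eventually_pos_right {f : ℝ → ℝ} {m : ℝ} {x₀ : ℝ} (h : HasDerivAt f m x₀)
    (h0 : f x₀ = 0) (hm : 0 < m) : (∀ᶠ x in 𝓝[>] x₀, 0 < f x) ∧ ∀ᶠ x in 𝓝[<] x₀, f x < 0 := by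
  have := (hasDerivAt_iff_isLittleO.1 h).def (half_pos hm)
  simp only [h0, sub_zero, smul_eq_mul, Real.norm_eq_abs] at this
  constructor
  · filter_upwards [self_mem_nhdsWithin, nhdsWithin_le_nhds this] with x hx hx'
    have hx0 : 0 < x - x₀ := sub_pos.2 hx
    rw [abs_of_pos hx0] at hx'
    have := (abs_le.1 hx').1
    nlinarith
  · filter_upwards [self_mem_nhdsWithin, nhdsWithin_le_nhds this] with x hx hx'
    have hx0 : x - x₀ < 0 := sub_neg.2 hx
    rw [abs_of_neg hx0] at hx'
    have := (abs_le.1 hx').2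
    nlinarith

/-- Behaviour at the endpoints of a curve with a double point: the winding number of a loop with
respect to points of the other loop that are close to the double point. -/
theorem windingIntegral_eventually_eq_at_corner (hγ : ContDiff ℝ 1 γ) {a : ℝ} (hbe : b < e)
    (hab : γ a = γ b) (heb : γ e = γ b) (hd : deriv γ e = deriv γ a)
    (hdet : planeDet (deriv γ a) (deriv γ b) ≠ 0) (hne : ∀ y ∈ Ioo b e, γ y ≠ γ b) :
    ∃ w, (∀ᶠ x in 𝓝[>] a, windingIntegral γ b e (γ x) = w) ∧
      ∀ᶠ x in 𝓝[<] b, windingIntegral γ b e (γ x) = w := by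
  set v₁ := deriv γ a with hv₁
  set v₂ := deriv γ b with hv₂
  -- The linear form with value `1` on `v₁` and `-1` on `v₂`. Near the corner the loop on `[b, e]`
  -- leaves along `v₂` and arrives along `v₁`, so it lies where `L` is negative; the other loop
  -- leaves along `v₁` and arrives along `v₂`, so both of its ends lie where `L` is positive.
  set L : ℂ → ℝ := fun z => (planeDet z v₂ + planeDet z v₁) / planeDet v₁ v₂ with hL
  have hLadd : ∀ (z w : ℂ) (r s : ℝ), L (r * z + s * w) = r * L z + s * L w := by
    intro z w r s
    simp only [hL, planeDet]
    simp
    ring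
  have hder : ∀ x, HasDerivAt (fun y => L (γ y - γ b)) (L (deriv γ x)) x := by
    intro x
    have h := ((hγ.differentiable (by norm_num) x).hasDerivAt).sub_const (γ b)
    have hre : HasDerivAt (fun y => (γ y - γ b).re) (deriv γ x).re x :=
      Complex.reCLM.hasFDerivAt.comp_hasDerivAt x h
    have him : HasDerivAt (fun y => (γ y - γ b).im) (deriv γ x).im x :=
      Complex.imCLM.hasFDerivAt.comp_hasDerivAt x h
    simp only [hL, planeDet]
    exact ((((hre.mul_const _).sub (him.mul_const _)).add
      ((hre.mul_const _).sub (him.mul_const _))).div_const _)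
  have hL1 : L v₁ = 1 := by
    have : planeDet v₁ v₁ = 0 := by simp only [planeDet]; ring
    simp only [hL, this, add_zero]
    exact div_self hdet
  have hL2 : L v₂ = -1 := by
    have h1 : planeDet v₂ v₂ = 0 := by simp only [planeDet]; ring
    have h2 : planeDet v₂ v₁ = - planeDet v₁ v₂ := by simp only [planeDet]; ring
    simp only [hL, h1, h2, zero_add]
    rw [neg_div, div_self hdet]
  have hL0 : L 0 = 0 := by simp [hL, planeDet]
  have ha := (hder a).eventually_pos_right (by simp [hab, hL0]) (by rw [← hv₁, hL1]; norm_num)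
  have he := (hder e).eventually_pos_right (by simp [heb, hL0]) (by rw [hd, hL1]; norm_num)
  have hb := (hder b).neg.eventually_pos_right (by simp [hL0]) (by rw [← hv₂, hL2]; norm_num)
  simp only [Pi.neg_apply, neg_pos, neg_lt_zero] at hb
  obtain ⟨b', hb', hb''⟩ := mem_nhdsGT_iff_exists_Ioo_subset.1 hb.1
  obtain ⟨e', he', he''⟩ := mem_nhdsLT_iff_exists_Ioo_subset.1 he.2
  -- Away from its ends the loop stays at a positive distance from the double point, by compactness.
  obtain ⟨ρ, hρ, hρ'⟩ : ∃ ρ > 0, ∀ y ∈ Icc b' e', b < y → y < e → ρ ≤ dist (γ y) (γ b) := by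
    have hK : IsCompact (Icc (max b' b) (min e' e)) := isCompact_Icc
    have hK' : IsClosed (γ '' Icc b' e' ) := (isCompact_Icc.image hγ.continuous).isClosed
    have hnot : γ b ∉ γ '' (Icc b' e' ∩ Ioo b e) := by
      rintro ⟨y, hy, hy'⟩
      exact hne y hy.2 hy'
    have hsub : Icc b' e' ∩ Ioo b e = Icc b' e' :=
      inter_eq_left.2 fun y hy => ⟨lt_of_lt_of_le hb' hy.1, lt_of_le_of_lt hy.2 he'⟩
    rw [hsub] at hnot
    obtain ⟨ρ, hρ, h⟩ := Metric.isOpen_iff.1 hK'.isOpen_compl _ hnot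
    refine ⟨ρ, hρ, fun y hy _ _ => ?_⟩
    by_contra hlt
    exact h (Metric.mem_ball.2 (not_le.1 hlt)) ⟨y, hy, rfl⟩
  -- A half-disc missed by the loop. It is convex and contains both ends of the other loop, so the
  -- winding integral has a single value there.
  set U : Set ℂ := Metric.ball (γ b) ρ ∩ {z | 0 < L (z - γ b)} with hU
  have hUc : Convex ℝ U := by
    refine (convex_ball _ _).inter ?_
    intro z hz w hw r s hr hs hrs
    have : r • z + s • w - γ b = r * (z - γ b) + s * (w - γ b) := by
      have : (r : ℂ) + s = 1 := by exact_mod_cast hrs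
      simp only [Complex.real_smul]
      linear_combination γ b * this
    simp only [mem_ofPred_eq] at hz hw ⊢
    rw [this, hLadd]
    rcases hr.eq_or_lt with rfl | hr
    · have : s = 1 := by linarith
      simp [this, hw]
    · have := mul_pos hr hz
      have := mul_nonneg hs hw.le
      linarith
  have hUγ : ∀ z ∈ U, ∀ y ∈ Icc b e, γ y ≠ z := by
    rintro z ⟨hz1, hz2⟩ y hy rfl
    simp only [mem_ofPred_eq] at hz2
    rcases hy.1.eq_or_lt with rfl | hby
    · simp [hL0] at hz2
    rcases hy.2.eq_or_lt with rfl | hye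
    · simp [heb, hL0] at hz2
    by_cases h1 : y < b'
    · exact lt_asymm hz2 (hb'' ⟨hby, h1⟩)
    by_cases h2 : e' < y
    · exact lt_asymm hz2 (he'' ⟨h2, hye⟩)
    · exact absurd (Metric.mem_ball.1 hz1)
        (not_lt.2 (hρ' y ⟨not_lt.1 h1, not_lt.1 h2⟩ hby hye))
  have hballa : ∀ᶠ x in 𝓝[>] a, γ x ∈ U := by
    filter_upwards [ha.1, nhdsWithin_le_nhds (hγ.continuous.continuousAt.preimage_mem_nhds
      (Metric.ball_mem_nhds (γ a) hρ))] with x h1 h2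
    rw [hab] at h2
    exact ⟨h2, h1⟩
  have hballb : ∀ᶠ x in 𝓝[<] b, γ x ∈ U := by
    filter_upwards [hb.2, nhdsWithin_le_nhds (hγ.continuous.continuousAt.preimage_mem_nhds
      (Metric.ball_mem_nhds (γ b) hρ))] with x h1 h2
    exact ⟨h2, h1⟩
  obtain ⟨x₀, hx₀⟩ := hballa.exists
  refine ⟨windingIntegral γ b e (γ x₀), hballa.mono fun x hx => ?_, hballb.mono fun x hx => ?_⟩ <;>
  exact windingIntegral_eq_of_isPreconnected hγ hbe.le heb hUc.isPreconnected hUγ hx hx₀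

end Winding

/-! ### The jump of the winding integral at a transverse crossing -/

section WindingJump

open Filter Topology Set

variable {γ : ℝ → ℂ} {b e : ℝ}

theorem Complex.log_neg_eq_sub {z : ℂ} (hz : 0 < z.im) :
    Complex.log (-z) = Complex.log z - Real.pi * Complex.I := by
  simp only [Complex.log, norm_neg, Complex.arg_neg_eq_arg_sub_pi_of_im_pos hz]
  push_cast
  ring

theorem Complex.log_neg_eq_add {z : ℂ} (hz : z.im < 0) :
    Complex.log (-z) = Complex.log z + Real.pi * Complex.I := by
  simp only [Complex.log, norm_neg, Complex.arg_neg_eq_arg_add_pi_of_im_neg hz]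
  push_cast
  ring

/-- Invariance under similarities, used to move the crossing to the origin with one tangent vector
equal to `1`. -/
theorem windingIntegral_sub_div (P : ℂ) {ν : ℂ} (hν : ν ≠ 0) (z : ℂ) :
    windingIntegral (fun y => (γ y - P) / ν) b e ((z - P) / ν) = windingIntegral γ b e z := by
  refine intervalIntegral.integral_congr fun y _ => ?_
  simp only [deriv_div_const, deriv_sub_const]
  rw [div_sub_div_same, sub_sub_sub_cancel_right, div_div_div_cancel_right₀ hν]

theorem continuousOn_logDeriv (hγ : ContDiff ℝ 1 γ) {s : Set ℝ} {z : ℂ} (hz : ∀ y ∈ s, γ y ≠ z) :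
    ContinuousOn (fun y => deriv γ y / (γ y - z)) s :=
  (hγ.continuous_deriv (by norm_num)).continuousOn.div
    (hγ.continuous.sub continuous_const).continuousOn fun y hy => sub_ne_zero.2 (hz y hy)

theorem windingIntegral_eq_log (hγ : ContDiff ℝ 1 γ) (hbe : b ≤ e) {z : ℂ}
    (hz : ∀ y ∈ Icc b e, γ y - z ∈ Complex.slitPlane) :
    windingIntegral γ b e z = Complex.log (γ e - z) - Complex.log (γ b - z) := by
  refine intervalIntegral.integral_eq_sub_of_hasDerivAt (f := fun y => Complex.log (γ y - z)) ?_ ?_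
  · intro y hy
    rw [uIcc_of_le hbe] at hy
    exact (((hγ.differentiable (by norm_num) y).hasDerivAt).sub_const z).clog_real (hz y hy)
  · refine ContinuousOn.intervalIntegrable ?_
    rw [uIcc_of_le hbe]
    refine continuousOn_logDeriv hγ fun y hy h => ?_
    have := hz y hy
    rw [h, sub_self] at this
    exact Complex.zero_notMem_slitPlane this

theorem windingIntegral_eq_log_neg (hγ : ContDiff ℝ 1 γ) (hbe : b ≤ e) {z : ℂ}
    (hz : ∀ y ∈ Icc b e, z - γ y ∈ Complex.slitPlane) :
    windingIntegral γ b e z = Complex.log (z - γ e) - Complex.log (z - γ b) := by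
  have h := windingIntegral_eq_log (γ := fun y => -γ y) hγ.neg hbe (z := -z) fun y hy => by
    have := hz y hy
    rwa [neg_sub_neg]
  simp only [neg_sub_neg] at h
  rw [← h]
  refine intervalIntegral.integral_congr fun y _ => ?_
  have h1 : deriv (fun y => -γ y) y = -deriv γ y := deriv.fun_neg
  simp only [h1]
  rw [neg_sub_neg, ← neg_sub (γ y) z, neg_div_neg_eq]

theorem windingIntegral_split (hγ : ContDiff ℝ 1 γ) {c d : ℝ} (hbc : b ≤ c) (hcd : c ≤ d)
    (hde : d ≤ e) {z : ℂ} (hz : ∀ y ∈ Icc b e, γ y ≠ z) :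
    windingIntegral γ b e z =
      windingIntegral γ b c z + windingIntegral γ c d z + windingIntegral γ d e z := by
  have hint : ∀ x y, b ≤ x → x ≤ y → y ≤ e → IntervalIntegrable
      (fun y => deriv γ y / (γ y - z)) MeasureTheory.volume x y := by
    intro x y hx hxy hy
    refine ContinuousOn.intervalIntegrable ?_
    rw [uIcc_of_le hxy]
    exact continuousOn_logDeriv hγ fun y' hy' => hz y' ⟨hx.trans hy'.1, hy'.2.trans hy⟩
  unfold windingIntegral
  rw [intervalIntegral.integral_add_adjacent_intervals (hint b c le_rfl hbc (hcd.trans hde))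
    (hint c d hbc hcd hde), intervalIntegral.integral_add_adjacent_intervals
    (hint b d le_rfl (hbc.trans hcd) hde) (hint d e (hbc.trans hcd) hde le_rfl)]

/-- A curve through the origin with non-horizontal tangent stays in a double cone around the
vertical axis. -/
theorem eventually_re_le_im {u : ℝ → ℂ} {m : ℂ} {y₀ : ℝ} (h : HasDerivAt u m y₀)
    (h0 : u y₀ = 0) (hm : m.im ≠ 0) :
    ∃ C > 0, ∀ᶠ y in 𝓝 y₀, |(u y).re| ≤ C * |(u y).im| := by
  have hm' : 0 < |m.im| := abs_pos.2 hm
  refine ⟨(|m.re| + |m.im|) / (|m.im| / 2), by positivity, ?_⟩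
  filter_upwards [h.eventually_abs_le h0 (half_pos hm')] with y hy
  have h1 := (Complex.abs_re_le_norm _).trans hy
  have h2 := (Complex.abs_im_le_norm _).trans hy
  have e1 : (u y - (y - y₀) * m).re = (u y).re - (y - y₀) * m.re := by simp
  have e2 : (u y - (y - y₀) * m).im = (u y).im - (y - y₀) * m.im := by simp
  rw [e1] at h1
  rw [e2] at h2
  have h3 : |(u y).re| ≤ (|m.re| + |m.im|) * |y - y₀| := by
    have := abs_sub_abs_le_abs_sub (u y).re ((y - y₀) * m.re)
    rw [abs_mul] at this
    nlinarith [abs_nonneg (y - y₀)]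
  have h4 : |m.im| / 2 * |y - y₀| ≤ |(u y).im| := by
    have := abs_sub_abs_le_abs_sub ((y - y₀) * m.im) (u y).im
    rw [abs_mul, abs_sub_comm ((y - y₀) * m.im)] at this
    nlinarith [abs_nonneg (y - y₀)]
  rw [div_mul_eq_mul_div, le_div_iff₀ (by positivity)]
  calc |(u y).re| * (|m.im| / 2) ≤ (|m.re| + |m.im|) * |y - y₀| * (|m.im| / 2) := by gcongr
    _ = (|m.re| + |m.im|) * (|m.im| / 2 * |y - y₀|) := by ring
    _ ≤ _ := by gcongr

/-- A curve with tangent `1` at the origin eventually enters any cone around the horizontal axis.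
With the constant of `eventually_re_le_im` it lies to the right or to the left of the transverse
strand. -/
theorem eventually_im_lt_re {u : ℝ → ℂ} {x₀ : ℝ} (h : HasDerivAt u 1 x₀) (h0 : u x₀ = 0) {C : ℝ}
    (hC : 0 < C) : (∀ᶠ x in 𝓝[>] x₀, C * |(u x).im| < (u x).re) ∧
      ∀ᶠ x in 𝓝[<] x₀, C * |(u x).im| < -(u x).re := by
  have hε : 0 < 1 / (2 * (C + 1)) := by positivity
  have hev := h.eventually_abs_le h0 hε
  have key : ∀ x, x ≠ x₀ → ‖u x - (x - x₀) * 1‖ ≤ 1 / (2 * (C + 1)) * |x - x₀| →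
      C * |(u x).im| + |(u x).re - (x - x₀)| < |x - x₀| := by
    intro x hx hy
    have h1 := (Complex.abs_re_le_norm _).trans hy
    have h2 := (Complex.abs_im_le_norm _).trans hy
    have e1 : (u x - (x - x₀) * 1).re = (u x).re - (x - x₀) := by simp
    have e2 : (u x - (x - x₀) * 1).im = (u x).im := by simp
    rw [e1] at h1
    rw [e2] at h2
    have hpos : 0 < |x - x₀| := abs_pos.2 (sub_ne_zero.2 hx)
    calc C * |(u x).im| + |(u x).re - (x - x₀)|
        ≤ C * (1 / (2 * (C + 1)) * |x - x₀|) + 1 / (2 * (C + 1)) * |x - x₀| := by gcongr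
      _ = |x - x₀| / 2 := by field_simp
      _ < |x - x₀| := by linarith
  constructor
  · filter_upwards [self_mem_nhdsWithin, nhdsWithin_le_nhds hev] with x hx hx'
    have hx0 : 0 < x - x₀ := sub_pos.2 hx
    have := key x (ne_of_gt hx) hx'
    rw [abs_of_pos hx0] at this
    linarith [neg_abs_le ((u x).re - (x - x₀))]
  · filter_upwards [self_mem_nhdsWithin, nhdsWithin_le_nhds hev] with x hx hx'
    have hx0 : x - x₀ < 0 := sub_neg.2 hx
    have := key x (ne_of_lt hx) hx'
    rw [abs_of_neg hx0] at this
    linarith [le_abs_self ((u x).re - (x - x₀))]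

/-- The loop is cut around `y₀`. The outer arcs contribute continuously at the crossing, while the
middle arc can be integrated by a branch of the logarithm on each side of the strand. The two
branches are those of `p` and `-p` at the endpoints, whose logarithms differ by `π * I` with
opposite signs since the endpoints lie in opposite half-planes. -/
theorem windingIntegral_jump_aux {u : ℝ → ℂ} (hu : ContDiff ℝ 1 u) {x₀ y₀ : ℝ} {m : ℂ}
    (hy₀ : y₀ ∈ Ioo b e) (hcl : u e = u b) (hux : u x₀ = 0) (huy : u y₀ = 0)
    (hdx : HasDerivAt u 1 x₀) (hdy : HasDerivAt u m y₀) (hm : m.im ≠ 0)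
    (huniq : ∀ y ∈ Icc b e, u y = 0 → y = y₀)
    (hne : ∀ᶠ x in 𝓝[≠] x₀, ∀ y ∈ Icc b e, u y ≠ u x) :
    ∃ w, (∀ᶠ x in 𝓝[>] x₀, windingIntegral u b e (u x) = w) ∧
      ∀ᶠ x in 𝓝[<] x₀, windingIntegral u b e (u x) =
        w + 2 * Real.pi * Complex.I * (if 0 < m.im then 1 else -1) := by
  obtain ⟨C, hC, hCy⟩ := eventually_re_le_im hdy huy hm
  have him : HasDerivAt (fun y => m.im * (u y).im) (m.im * m.im) y₀ :=
    (Complex.imCLM.hasFDerivAt.comp_hasDerivAt y₀ hdy).const_mul _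
  obtain ⟨hsr, hsl⟩ := him.eventually_pos_right (by simp [huy]) (mul_self_pos.2 hm)
  obtain ⟨d, hd1, hd2⟩ := mem_nhdsGT_iff_exists_Ioo_subset.1
    (inter_mem hsr (inter_mem (nhdsWithin_le_nhds hCy)
      (nhdsWithin_le_nhds (Iio_mem_nhds hy₀.2))))
  obtain ⟨c, hc1, hc2⟩ := mem_nhdsLT_iff_exists_Ioo_subset.1
    (inter_mem hsl (inter_mem (nhdsWithin_le_nhds hCy)
      (nhdsWithin_le_nhds (Ioi_mem_nhds hy₀.1))))
  obtain ⟨d', hd'1, hd'2⟩ := exists_between (show y₀ < d from hd1)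
  obtain ⟨c', hc'1, hc'2⟩ := exists_between (show c < y₀ from hc1)
  have hd' := hd2 ⟨hd'1, hd'2⟩
  have hc' := hc2 ⟨hc'1, hc'2⟩
  have hbc : b < c' := hc'.2.2
  have hde : d' < e := hd'.2.2
  have hcd : c' < d' := hc'2.trans hd'1
  have hbound : ∀ y ∈ Icc c' d', |(u y).re| ≤ C * |(u y).im| := by
    intro y hy
    rcases lt_trichotomy y y₀ with h | rfl | h
    · exact (hc2 ⟨hc'1.trans_le hy.1, h⟩).2.1
    · simp [huy]
    · exact (hd2 ⟨h, hy.2.trans_lt hd'2⟩).2.1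
  have hd'im : 0 < m.im * (u d').im := hd'.1
  have hc'im : m.im * (u c').im < 0 := hc'.1
  obtain ⟨hxr, hxl⟩ := eventually_im_lt_re hdx hux hC
  -- The contribution of the outer arcs, which avoid the crossing point itself.
  set O : ℂ → ℂ := fun z => windingIntegral u b c' z + windingIntegral u d' e z with hO
  have hne' : ∀ z, (∀ y ∈ Icc b e, u y ≠ z) → z ∈ ({z | ∀ y ∈ Icc b c', u y ≠ z} ∩
      {z | ∀ y ∈ Icc d' e, u y ≠ z} : Set ℂ) := fun z hz =>
    ⟨fun y hy => hz y ⟨hy.1, hy.2.trans (hcd.le.trans hde.le)⟩,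
      fun y hy => hz y ⟨(hbc.le.trans hcd.le).trans hy.1, hy.2⟩⟩
  have hOc : ContinuousWithinAt O ({z | ∀ y ∈ Icc b c', u y ≠ z} ∩
      {z | ∀ y ∈ Icc d' e, u y ≠ z}) 0 := by
    have h1 : ∀ y ∈ Icc b c', u y ≠ 0 := fun y hy h =>
      absurd (huniq y ⟨hy.1, hy.2.trans (hcd.le.trans hde.le)⟩ h) (hy.2.trans_lt hc'2).ne
    have h2 : ∀ y ∈ Icc d' e, u y ≠ 0 := fun y hy h =>
      absurd (huniq y ⟨(hbc.le.trans hcd.le).trans hy.1, hy.2⟩ h) (hd'1.trans_le hy.1).ne'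
    exact ((continuousOn_windingIntegral hu hbc.le 0 h1).mono inter_subset_left).add
      ((continuousOn_windingIntegral hu hde.le 0 h2).mono inter_subset_right)
  have hux0 : Tendsto u (𝓝 x₀) (𝓝 0) := by
    have := hu.continuous.tendsto x₀
    rwa [hux] at this
  have hOt : Tendsto (fun x => O (u x)) (𝓝[≠] x₀) (𝓝 (O 0)) := by
    refine Tendsto.comp (hOc : Tendsto O _ _) ?_
    exact tendsto_nhdsWithin_iff.2 ⟨hux0.mono_left nhdsWithin_le_nhds,
      hne.mono fun x hx => hne' _ hx⟩
  have hlogt : ∀ (p : ℂ), p.im ≠ 0 → Tendsto (fun x => Complex.log (u x - p)) (𝓝 x₀)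
      (𝓝 (Complex.log (-p))) := by
    intro p hp
    have h1 : Tendsto (fun x => u x - p) (𝓝 x₀) (𝓝 (-p)) := by simpa using hux0.sub_const p
    exact h1.clog (Or.inr (by simpa using hp))
  have hlogt' : ∀ (p : ℂ), p.im ≠ 0 → Tendsto (fun x => Complex.log (p - u x)) (𝓝 x₀)
      (𝓝 (Complex.log p)) := by
    intro p hp
    have h1 : Tendsto (fun x => p - u x) (𝓝 x₀) (𝓝 p) := by simpa using hux0.const_sub p
    exact h1.clog (Or.inr hp)
  have hdim : (u d').im ≠ 0 := fun h => by simp [h] at hd'im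
  have hcim : (u c').im ≠ 0 := fun h => by simp [h] at hc'im
  have hleft : 𝓝[<] x₀ ≤ 𝓝[≠] x₀ := nhdsWithin_mono _ fun x hx => ne_of_lt hx
  have hright : 𝓝[>] x₀ ≤ 𝓝[≠] x₀ := nhdsWithin_mono _ fun x hx => ne_of_gt hx
  -- To the right of the strand the differences `u x - u y` avoid the negative real axis: when the
  -- imaginary parts agree, the cone estimates make the real part positive.
  have tr : Tendsto (fun x => windingIntegral u b e (u x)) (𝓝[>] x₀)
      (𝓝 (O 0 + (Complex.log (-(u d')) - Complex.log (-(u c'))))) := by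
    refine Tendsto.congr' ?_ ((hOt.mono_left hright).add
      (((hlogt _ hdim).sub (hlogt _ hcim)).mono_left nhdsWithin_le_nhds))
    filter_upwards [hxr, hright hne] with x hx hx'
    rw [windingIntegral_split hu hbc.le hcd.le hde.le hx',
      windingIntegral_eq_log_neg (b := c') hu hcd.le (fun y hy => ?_)]
    · simp only [hO]; ring
    · rw [Complex.mem_slitPlane_iff]
      by_cases h : (u x - u y).im = 0
      · left
        have h1 : (u y).im = (u x).im := by
          rw [Complex.sub_im] at h; linarith
        have h2 := hbound y hy
        rw [h1] at h2
        rw [Complex.sub_re]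
        linarith [le_abs_self (u y).re]
      · exact Or.inr h
  -- To the left the same holds for `u y - u x`.
  have tl : Tendsto (fun x => windingIntegral u b e (u x)) (𝓝[<] x₀)
      (𝓝 (O 0 + (Complex.log (u d') - Complex.log (u c')))) := by
    refine Tendsto.congr' ?_ ((hOt.mono_left hleft).add
      (((hlogt' _ hdim).sub (hlogt' _ hcim)).mono_left nhdsWithin_le_nhds))
    filter_upwards [hxl, hleft hne] with x hx hx'
    rw [windingIntegral_split hu hbc.le hcd.le hde.le hx',
      windingIntegral_eq_log (b := c') hu hcd.le (fun y hy => ?_)]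
    · simp only [hO]; ring
    · rw [Complex.mem_slitPlane_iff]
      by_cases h : (u y - u x).im = 0
      · left
        have h1 : (u y).im = (u x).im := by
          rw [Complex.sub_im] at h; linarith
        have h2 := hbound y hy
        rw [h1] at h2
        rw [Complex.sub_re]
        linarith [neg_abs_le (u y).re]
      · exact Or.inr h
  have hbe : b ≤ e := (hy₀.1.trans hy₀.2).le
  have er := eventually_eq_of_tendsto_zmultiples
    ((hne.filter_mono hright).mono fun x hx => windingIntegral_mem hu hbe hcl hx) tr
  have el := eventually_eq_of_tendsto_zmultiples
    ((hne.filter_mono hleft).mono fun x hx => windingIntegral_mem hu hbe hcl hx) tl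
  refine ⟨_, er, ?_⟩
  convert el using 3
  -- The sign of `m.im` decides which of the endpoints `u c'`, `u d'` lies in the upper half-plane,
  -- hence the sign of the jump.
  rcases lt_or_gt_of_ne hm with h | h
  · rw [Complex.log_neg_eq_add (show (u d').im < 0 by nlinarith),
      Complex.log_neg_eq_sub (show 0 < (u c').im by nlinarith), if_neg h.not_gt]
    ring
  · rw [Complex.log_neg_eq_sub (show 0 < (u d').im by nlinarith),
      Complex.log_neg_eq_add (show (u c').im < 0 by nlinarith), if_pos h]
    ring

/-- The jump of the winding number of a loop at a transverse crossing with another strand. -/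
theorem windingIntegral_jump (hγ : ContDiff ℝ 1 γ) {x₀ y₀ : ℝ}
    (hy₀ : y₀ ∈ Ioo b e) (hcl : γ e = γ b) (hxy : γ y₀ = γ x₀)
    (hdet : planeDet (deriv γ x₀) (deriv γ y₀) ≠ 0)
    (huniq : ∀ y ∈ Icc b e, γ y = γ x₀ → y = y₀)
    (hne : ∀ᶠ x in 𝓝[≠] x₀, ∀ y ∈ Icc b e, γ y ≠ γ x) :
    ∃ w, (∀ᶠ x in 𝓝[>] x₀, windingIntegral γ b e (γ x) = w) ∧
      ∀ᶠ x in 𝓝[<] x₀, windingIntegral γ b e (γ x) = w + 2 * Real.pi * Complex.I *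
        (if 0 < planeDet (deriv γ x₀) (deriv γ y₀) then 1 else -1) := by
  set ν := deriv γ x₀ with hν
  have hν0 : ν ≠ 0 := by
    rintro h
    simp [h, planeDet] at hdet
  -- Dividing by the tangent vector of the moving strand makes it `1`; the imaginary part of the
  -- other tangent then has the sign of the determinant.
  have him : (deriv γ y₀ / ν).im = planeDet ν (deriv γ y₀) / Complex.normSq ν := by
    rw [Complex.div_im]
    simp only [planeDet]
    ring
  have hpos : 0 < Complex.normSq ν := Complex.normSq_pos.2 hν0
  have hder : ∀ x, HasDerivAt (fun y => (γ y - γ x₀) / ν) (deriv γ x / ν) x := fun x =>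
    (((hγ.differentiable (by norm_num) x).hasDerivAt).sub_const _).div_const _
  have hinj : ∀ z w, (z - γ x₀) / ν = (w - γ x₀) / ν ↔ z = w := by
    intro z w
    rw [div_left_inj' hν0, sub_left_inj]
  have h := windingIntegral_jump_aux (u := fun y => (γ y - γ x₀) / ν) (x₀ := x₀) (y₀ := y₀)
    ((hγ.sub contDiff_const).div_const _) hy₀
    (by simp only [hcl]) (by simp) (by simp [hxy])
    (by have := hder x₀; rwa [← hν, div_self hν0] at this) (hder y₀)
    (by rw [him]; exact div_ne_zero hdet hpos.ne')
    (fun y hy h => huniq y hy (by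
      rw [div_eq_zero_iff] at h
      exact sub_eq_zero.1 (h.resolve_right hν0)))
    (hne.mono fun x hx y hy h => hx y hy ((hinj _ _).1 h))
  simp only [windingIntegral_sub_div (γ x₀) hν0, him] at h
  simpa only [div_pos_iff_of_pos_right hpos] using h

end WindingJump

/-! ### Signed counts of passages on the loops of a plane curve -/

section DiagramIndex

open Filter Topology Set

theorem planeDet_swap (v w : ℂ) : planeDet w v = -planeDet v w := by
  simp only [planeDet]; ring

namespace VirtualKnotDiagram

variable (D : VirtualKnotDiagram)

theorem contDiff_one : ContDiff ℝ 1 D.curve := D.smooth.of_le (by exact_mod_cast le_top)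

theorem curve_add_int (x : ℝ) (n : ℤ) : D.curve (x + n) = D.curve x := by
  simpa using D.periodic.int_mul n x

theorem deriv_add_int (x : ℝ) (n : ℤ) : deriv D.curve (x + n) = deriv D.curve x := by
  rw [← deriv_comp_add_const]
  congr 1
  ext y
  exact D.curve_add_int y n

theorem kind_add_int (x : ℝ) (n : ℤ) : D.kind (x + n) = D.kind x := by
  simpa using D.kind_periodic.int_mul n x

variable {D}

theorem meets_symm {x y : ℝ} (h : Meets D.curve x y) : Meets D.curve y x :=
  ⟨h.1.symm, fun n hn => h.2 (-n) (by push_cast; linarith)⟩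

theorem meets_add_int {x y : ℝ} (m n : ℤ) :
    Meets D.curve (x + m) (y + n) ↔ Meets D.curve x y := by
  unfold Meets
  rw [D.curve_add_int, D.curve_add_int]
  refine and_congr_right fun _ => ⟨fun h k hk => h (k + n - m) ?_, fun h k hk => h (k - n + m) ?_⟩
  · rw [hk]; push_cast; ring
  · push_cast; linarith

theorem meets_add_int_left {x y : ℝ} (m : ℤ) :
    Meets D.curve (x + m) y ↔ Meets D.curve x y := by
  simpa using meets_add_int (x := x) (y := y) m 0

theorem meets_add_int_right {x y : ℝ} (m : ℤ) :
    Meets D.curve x (y + m) ↔ Meets D.curve x y := by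
  simpa using meets_add_int (x := x) (y := y) 0 m

theorem meets_mate {x y : ℝ} (h : Meets D.curve x y) : Meets D.curve x (D.mate x) := by
  have h' : ∃ y, Meets D.curve x y := ⟨y, h⟩
  rw [mate, dif_pos h']
  exact h'.choose_spec

theorem side_eq {x y : ℝ} (h : Meets D.curve x y) :
    D.side x = if 0 < planeDet (deriv D.curve x) (deriv D.curve y) then 1 else -1 := by
  obtain ⟨n, hn⟩ := D.no_triple _ _ _ (meets_mate h) h
  rw [side, hn, D.deriv_add_int]

theorem side_meets {x y : ℝ} (h : Meets D.curve x y) : D.side y = -D.side x := by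
  rw [side_eq h, side_eq (meets_symm h), planeDet_swap]
  have := D.transverse x y h
  by_cases h1 : 0 < planeDet (deriv D.curve x) (deriv D.curve y)
  · rw [if_pos h1, if_neg (by linarith)]
  · rw [if_neg h1, if_pos (by rw [neg_pos]; exact lt_of_le_of_ne (not_lt.1 h1) this), neg_neg]

theorem side_add_int {x y : ℝ} (h : Meets D.curve x y) (n : ℤ) : D.side (x + n) = D.side x := by
  rw [side_eq h, side_eq ((meets_add_int_left n).2 h), D.deriv_add_int]

variable (D)

/-- The parameters of the passages through crossings. -/
def IsCrossing (x : ℝ) : Prop := ∃ y, Meets D.curve x y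

variable {D}

theorem isCrossing_add_int {x : ℝ} (n : ℤ) : D.IsCrossing (x + n) ↔ D.IsCrossing x :=
  exists_congr fun _ => meets_add_int_left n

variable (D)

theorem finite_isCrossing (s t : ℝ) : {x : ℝ | x ∈ Icc s t ∧ D.IsCrossing x}.Finite := by
  refine ((Set.finite_Icc ⌊s⌋ ⌊t⌋).biUnion fun n _ =>
    D.finite_crossings.image fun x => x + (n : ℝ)).subset ?_
  rintro x ⟨hx, hc⟩
  refine mem_biUnion (x := ⌊x⌋) ⟨Int.floor_mono hx.1, Int.floor_mono hx.2⟩ ⟨Int.fract x, ?_, ?_⟩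
  · refine ⟨⟨Int.fract_nonneg x, Int.fract_lt_one x⟩, ?_⟩
    have := (isCrossing_add_int (D := D) (x := x) (-⌊x⌋)).2 hc
    rw [Int.cast_neg, ← sub_eq_add_neg] at this
    exact this
  · exact Int.fract_add_floor x

/-- The finite set of the parameters of passages in an interval. -/
noncomputable def crossingsBetween (s t : ℝ) : Finset ℝ :=
  (show {x | x ∈ Ioo s t ∧ D.IsCrossing x}.Finite from (D.finite_isCrossing s t).subset
    fun _ hx => ⟨Ioo_subset_Icc_self hx.1, hx.2⟩).toFinset

theorem mem_crossingsBetween {s t x : ℝ} :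
    x ∈ D.crossingsBetween s t ↔ x ∈ Ioo s t ∧ D.IsCrossing x := by
  simp [crossingsBetween]

/-- The values that `E` takes on punctured neighbourhoods form a locally constant function, hence a
constant one on the interval. The values of `E` at the exceptional points themselves play no role.
-/
theorem eq_of_eventually_punctured {E : ℝ → ℂ} {a b : ℝ} (hab : a < b) {w w' : ℂ}
    (h : ∀ x ∈ Ioo a b, ∃ c, ∀ᶠ y in 𝓝[≠] x, E y = c) (ha : ∀ᶠ x in 𝓝[>] a, E x = w)
    (hb : ∀ᶠ x in 𝓝[<] b, E x = w') : w = w' := by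
  have h' : ∀ x, ∃ c, x ∈ Ioo a b → ∀ᶠ y in 𝓝[≠] x, E y = c := fun x => by
    by_cases hx : x ∈ Ioo a b
    · obtain ⟨c, hc⟩ := h x hx; exact ⟨c, fun _ => hc⟩
    · exact ⟨0, fun h => absurd h hx⟩
  choose c hc using h'
  have hloc : ∀ x ∈ Ioo a b, ∀ᶠ y in 𝓝 x, c y = c x := by
    intro x hx
    have h1 := eventually_nhdsWithin_iff.1 (hc x hx)
    filter_upwards [h1.eventually_nhds, Ioo_mem_nhds hx.1 hx.2] with y hy hy'
    by_cases hyx : y = x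
    · rw [hyx]
    · have h2 : ∀ᶠ z in 𝓝[≠] y, E z = c x := by
        filter_upwards [nhdsWithin_le_nhds hy,
          nhdsWithin_le_nhds (isOpen_ne.mem_nhds hyx)] with z hz hz'
        exact hz hz'
      obtain ⟨z, hz1, hz2⟩ := ((hc y hy').and h2).exists
      rw [← hz1, hz2]
  have hconst : ∀ x ∈ Ioo a b, ∀ y ∈ Ioo a b, c x = c y := by
    intro x hx y hy
    exact isPreconnected_Ioo.induction₂ (fun x y => c x = c y)
      (fun x hx => nhdsWithin_le_nhds ((hloc x hx).mono fun y hy => hy.symm))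
      (fun x y z _ _ _ h1 h2 => h1.trans h2) (fun x y _ _ h => h.symm) hx hy
  obtain ⟨s, hs1, hs2⟩ := mem_nhdsGT_iff_exists_Ioo_subset.1
    (inter_mem ha (Ioo_mem_nhdsGT hab))
  obtain ⟨t, ht1, ht2⟩ := mem_nhdsLT_iff_exists_Ioo_subset.1
    (inter_mem hb (Ioo_mem_nhdsLT hab))
  obtain ⟨x, hx1, hx2⟩ := exists_between (show a < s from hs1)
  obtain ⟨y, hy1, hy2⟩ := exists_between (show t < b from ht1)
  have hcx : c x = w := by
    have h1 : ∀ᶠ z in 𝓝[≠] x, E z = w := nhdsWithin_le_nhds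
      (mem_of_superset (Ioo_mem_nhds hx1 hx2) fun z hz => (hs2 hz).1)
    obtain ⟨z, hz1, hz2⟩ := ((hc x (hs2 ⟨hx1, hx2⟩).2).and h1).exists
    rw [← hz1, hz2]
  have hcy : c y = w' := by
    have h1 : ∀ᶠ z in 𝓝[≠] y, E z = w' := nhdsWithin_le_nhds
      (mem_of_superset (Ioo_mem_nhds hy1 hy2) fun z hz => (ht2 hz).1)
    obtain ⟨z, hz1, hz2⟩ := ((hc y (ht2 ⟨hy1, hy2⟩).2).and h1).exists
    rw [← hz1, hz2]
  rw [← hcx, ← hcy]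
  exact hconst x (hs2 ⟨hx1, hx2⟩).2 y (ht2 ⟨hy1, hy2⟩).2

theorem eventually_filter_lt (S : Finset ℝ) (x₀ : ℝ) :
    (∀ᶠ x in 𝓝[>] x₀, S.filter (· < x) = S.filter (· ≤ x₀)) ∧
      ∀ᶠ x in 𝓝[<] x₀, S.filter (· < x) = S.filter (· < x₀) := by
  constructor
  · have : ∀ᶠ x in 𝓝[>] x₀, ∀ s ∈ S, (s < x ↔ s ≤ x₀) := by
      rw [Filter.eventually_all_finset]
      intro s _
      by_cases hs : s ≤ x₀
      · filter_upwards [self_mem_nhdsWithin] with x hx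
        exact ⟨fun _ => hs, fun _ => lt_of_le_of_lt hs hx⟩
      · filter_upwards [nhdsWithin_le_nhds (Iio_mem_nhds (not_le.1 hs))] with x hx
        exact ⟨fun h => absurd h (not_lt.2 (le_of_lt hx)), fun h => absurd h hs⟩
    filter_upwards [this] with x hx
    exact Finset.filter_congr hx
  · have : ∀ᶠ x in 𝓝[<] x₀, ∀ s ∈ S, (s < x ↔ s < x₀) := by
      rw [Filter.eventually_all_finset]
      intro s _
      by_cases hs : s < x₀
      · filter_upwards [nhdsWithin_le_nhds (Ioi_mem_nhds hs)] with x hx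
        exact ⟨fun _ => hs, fun _ => hx⟩
      · filter_upwards [self_mem_nhdsWithin] with x hx
        exact ⟨fun h => absurd (h.trans hx) hs, fun h => absurd h hs⟩
    filter_upwards [this] with x hx
    exact Finset.filter_congr hx

variable {D}

theorem meets_unique {x y z : ℝ} (h : Meets D.curve x y) (h' : Meets D.curve x z)
    (hlt : |z - y| < 1) : z = y := by
  obtain ⟨n, hn⟩ := D.no_triple _ _ _ h h'
  have : |(n : ℝ)| < 1 := by rwa [hn, add_sub_cancel_left] at hlt
  have : n = 0 := by
    have h2 : |n| < 1 := by exact_mod_cast this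
    exact Int.abs_lt_one_iff.1 h2
  rw [hn, this]; simp

theorem meets_of_abs_lt {x y : ℝ} (h : D.curve x = D.curve y) (hne : x ≠ y)
    (hlt : |y - x| < 1) : Meets D.curve x y := by
  refine ⟨h, fun n hn => hne ?_⟩
  have : |(n : ℝ)| < 1 := by rwa [hn, add_sub_cancel_left] at hlt
  have : n = 0 := by
    have h2 : |n| < 1 := by exact_mod_cast this
    exact Int.abs_lt_one_iff.1 h2
  rw [hn, this]; simp

open Classical in
/-- The signed number of the crossings of two complementary loops at a crossing is zero. -/
theorem sum_side_outer {a b : ℝ} (hab : a < b) (hb1 : b < a + 1) (h : Meets D.curve a b) :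
    ∑ x ∈ (D.crossingsBetween a b).filter (fun x => ∃ y ∈ Ioo b (a + 1), Meets D.curve x y),
      ((D.side x : ℤ) : ℂ) = 0 := by
  set S := (D.crossingsBetween a b).filter (fun x => ∃ y ∈ Ioo b (a + 1), Meets D.curve x y)
    with hS
  have hmemS : ∀ x, x ∈ S ↔ x ∈ Ioo a b ∧ ∃ y ∈ Ioo b (a + 1), Meets D.curve x y := by
    intro x
    rw [hS, Finset.mem_filter, mem_crossingsBetween]
    constructor
    · rintro ⟨⟨h1, -⟩, h2⟩; exact ⟨h1, h2⟩
    · rintro ⟨h1, y, h2, h3⟩; exact ⟨⟨h1, y, h3⟩, y, h2, h3⟩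
  set W : ℝ → ℂ := fun x => windingIntegral D.curve b (a + 1) (D.curve x) with hW
  -- Adding `2 * π * I` times the signed number of crossings already passed compensates the jumps of
  -- the winding integral, so `E` is constant off the crossings.
  set E : ℝ → ℂ := fun x => W x + 2 * Real.pi * Complex.I *
    ∑ x' ∈ S.filter (· < x), ((D.side x' : ℤ) : ℂ) with hE
  have hγ := D.contDiff_one
  have hcl : D.curve (a + 1) = D.curve b := by
    rw [← h.1]; exact D.periodic a
  -- a point of the first loop lies on the second loop only if it is a crossing in `S`
  have hon : ∀ x ∈ Ioo a b, ∀ y ∈ Icc b (a + 1), D.curve y = D.curve x →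
      y ∈ Ioo b (a + 1) ∧ Meets D.curve x y := by
    intro x hx y hy hxy
    have hm : Meets D.curve x y := meets_of_abs_lt hxy.symm (hx.2.trans_le hy.1).ne (by
      rw [abs_of_pos (by linarith [hx.2, hy.1])]; linarith [hx.1, hy.2])
    have hba := meets_symm h
    refine ⟨⟨lt_of_le_of_ne hy.1 ?_, lt_of_le_of_ne hy.2 ?_⟩, hm⟩
    · rintro rfl
      have := meets_unique (meets_symm hm) hba (by
        rw [abs_sub_comm, abs_of_pos (by linarith [hx.1])]; linarith [hx.2])
      exact hx.1.ne this
    · rintro rfl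
      have hm' : Meets D.curve a x := by
        have := meets_symm hm
        simpa using (meets_add_int_left (D := D) (x := a) (y := x) 1).1 (by simpa using this)
      have := meets_unique hm' h (by
        rw [abs_of_pos (by linarith [hx.2])]; linarith [hx.1])
      exact hx.2.ne this.symm
  have hfar : ∀ x ∈ Ioo a b, x ∉ S → ∀ y ∈ Icc b (a + 1), D.curve y ≠ D.curve x := by
    intro x hx hxS y hy hxy
    obtain ⟨h1, h2⟩ := hon x hx y hy hxy
    exact hxS ((hmemS x).2 ⟨hx, y, h1, h2⟩)
  have hnear : ∀ x ∈ Ioo a b, ∀ᶠ x' in 𝓝[≠] x, ∀ y ∈ Icc b (a + 1), D.curve y ≠ D.curve x' := by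
    intro x hx
    have h1 : ∀ᶠ x' in 𝓝[≠] x, x' ∉ S := by
      have : (↑(S.erase x) : Set ℝ)ᶜ ∈ 𝓝 x :=
        (S.erase x).finite_toSet.isClosed.isOpen_compl.mem_nhds (by simp)
      filter_upwards [nhdsWithin_le_nhds this, self_mem_nhdsWithin] with x' h1 h2 h3
      exact h1 (Finset.mem_coe.2 (Finset.mem_erase.2 ⟨h2, h3⟩))
    filter_upwards [h1, nhdsWithin_le_nhds (Ioo_mem_nhds hx.1 hx.2)] with x' h1 h2
    exact hfar x' h2 h1
  -- The winding integral has the same value `w` at both ends of the first loop; therefore the total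
  -- jump vanishes.
  obtain ⟨w, hw1, hw2⟩ := windingIntegral_eventually_eq_at_corner (a := a) (b := b) (e := a + 1)
    hγ hb1 h.1 hcl (by simpa using D.deriv_add_int a 1) (D.transverse a b h) (by
      intro y hy hyb
      have hby : Meets D.curve b y := meets_of_abs_lt hyb.symm hy.1.ne (by
        rw [abs_of_pos (by linarith [hy.1])]; linarith [hy.2])
      have hba : Meets D.curve b (a + 1) := by
        simpa using (meets_add_int_right (D := D) (x := b) (y := a) 1).2 (meets_symm h)
      have := meets_unique hby hba (by
        rw [abs_of_pos (by linarith [hy.2])]; linarith [hy.1])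
      exact hy.2.ne this.symm)
  have key := eq_of_eventually_punctured (E := E) hab (w := w)
    (w' := w + 2 * Real.pi * Complex.I * ∑ x' ∈ S, ((D.side x' : ℤ) : ℂ)) ?_ ?_ ?_
  · have h2 : (2 * Real.pi * Complex.I : ℂ) * ∑ x' ∈ S, ((D.side x' : ℤ) : ℂ) = 0 := by
      linear_combination -key
    exact (mul_eq_zero.1 h2).resolve_left Complex.two_pi_I_ne_zero
  · intro x hx
    obtain ⟨hr, hl⟩ := eventually_filter_lt S x
    rw [show (𝓝[≠] x) = 𝓝[<] x ⊔ 𝓝[>] x from (nhdsLT_sup_nhdsGT x).symm]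
    simp only [eventually_sup]
    by_cases hxS : x ∈ S
    · obtain ⟨-, y, hy, hm⟩ := (hmemS x).1 hxS
      obtain ⟨w', h1, h2⟩ := windingIntegral_jump hγ hy hcl hm.1.symm (D.transverse x y hm)
        (fun y' hy' hxy' => by
          obtain ⟨h3, h4⟩ := hon x hx y' hy' hxy'
          refine meets_unique hm h4 ?_
          rw [abs_lt]; constructor <;> linarith [h3.1, h3.2, hy.1, hy.2]) (hnear x hx)
      refine ⟨w' + 2 * Real.pi * Complex.I *
        ∑ x' ∈ S.filter (· ≤ x), ((D.side x' : ℤ) : ℂ), ?_, ?_⟩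
      · filter_upwards [hl, h2] with x' h3 h4
        have h5 : S.filter (· ≤ x) = insert x (S.filter (· < x)) := by
          ext z
          simp only [Finset.mem_filter, Finset.mem_insert]
          constructor
          · rintro ⟨h5, h6⟩
            rcases h6.eq_or_lt with h6 | h6
            · exact Or.inl h6
            · exact Or.inr ⟨h5, h6⟩
          · rintro (rfl | ⟨h5, h6⟩)
            · exact ⟨hxS, le_rfl⟩
            · exact ⟨h5, h6.le⟩
        have h6 : W x' = w' + 2 * Real.pi * Complex.I * ((D.side x : ℤ) : ℂ) := by
          rw [hW]; simp only [h4, side_eq hm]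
          split_ifs <;> simp
        simp only [hE]
        rw [h3, h5, Finset.sum_insert (by simp), h6]
        ring
      · filter_upwards [hr, h1] with x' h3 h4
        simp only [hE, hW]
        rw [h3, h4]
    · have hopen : IsOpen (D.curve '' Icc b (a + 1))ᶜ :=
        (isCompact_Icc.image hγ.continuous).isClosed.isOpen_compl
      obtain ⟨ρ, hρ, hball⟩ := Metric.isOpen_iff.1 hopen (D.curve x) (by
        rintro ⟨y, hy, hxy⟩
        exact hfar x hx hxS y hy hxy)
      have hWx : ∀ᶠ x' in 𝓝 x, W x' = W x := by
        filter_upwards [hγ.continuous.continuousAt.preimage_mem_nhds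
          (Metric.ball_mem_nhds _ hρ)] with x' hx'
        exact windingIntegral_eq_of_isPreconnected hγ hb1.le hcl
          (convex_ball (D.curve x) ρ).isPreconnected
          (fun z hz y hy hyz => hball hz ⟨y, hy, hyz⟩) hx' (Metric.mem_ball_self hρ)
      have h5 : S.filter (· ≤ x) = S.filter (· < x) := by
        refine Finset.filter_congr fun z hz => ⟨fun h => lt_of_le_of_ne h ?_, le_of_lt⟩
        rintro rfl
        exact hxS hz
      refine ⟨W x + 2 * Real.pi * Complex.I *
        ∑ x' ∈ S.filter (· < x), ((D.side x' : ℤ) : ℂ), ?_, ?_⟩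
      · filter_upwards [hl, nhdsWithin_le_nhds hWx] with x' h3 h4
        simp only [hE]
        rw [h3, h4]
      · filter_upwards [hr, nhdsWithin_le_nhds hWx] with x' h3 h4
        simp only [hE]
        rw [h3, h4, h5]
  · filter_upwards [(eventually_filter_lt S a).1, hw1] with x h3 h4
    have : S.filter (· ≤ a) = ∅ := by
      refine Finset.filter_eq_empty_iff.2 fun z hz => not_le.2 ((hmemS z).1 hz).1.1
    simp only [hE, hW]
    rw [h3, h4, this]
    simp
  · filter_upwards [(eventually_filter_lt S b).2, hw2] with x h3 h4
    have : S.filter (· < b) = S :=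
      Finset.filter_true_of_mem fun z hz => ((hmemS z).1 hz).1.2
    simp only [hE, hW]
    rw [h3, h4, this]

open Classical in
/-- The sum of the sides of the passages between the two passages through a crossing is zero. -/
theorem sum_side_eq_zero {a b : ℝ} (hab : a < b) (hb1 : b < a + 1) (h : Meets D.curve a b) :
    ∑ x ∈ D.crossingsBetween a b, (D.side x : ℤ) = 0 := by
  rw [← Finset.sum_filter_add_sum_filter_not _
    (fun x => ∃ y ∈ Ioo b (a + 1), Meets D.curve x y)]
  have h1 : ∑ x ∈ (D.crossingsBetween a b).filter
      (fun x => ∃ y ∈ Ioo b (a + 1), Meets D.curve x y), (D.side x : ℤ) = 0 := by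
    have := sum_side_outer hab hb1 h
    exact_mod_cast this
  rw [h1, zero_add]
  -- The remaining passages belong to self-crossings of the first loop. The other passage lies in
  -- the same interval and has the opposite side, so they cancel in pairs.
  set T := (D.crossingsBetween a b).filter
    (fun x => ¬ ∃ y ∈ Ioo b (a + 1), Meets D.curve x y) with hT
  have hTm : ∀ x ∈ T, ∃ y ∈ Ioo a b, Meets D.curve x y := by
    intro x hx
    rw [hT, Finset.mem_filter, mem_crossingsBetween] at hx
    obtain ⟨⟨hx, y, hy⟩, hx'⟩ := hx
    -- The other passage is moved by an integer into the period `[a, a + 1)`. It cannot be `a` or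
    -- `b`, as these form a double point already.
    have hfl := Int.floor_le (y - a)
    have hfl' := Int.lt_floor_add_one (y - a)
    set y' := y + ((-⌊y - a⌋ : ℤ) : ℝ) with hy'
    have hm : Meets D.curve x y' := (meets_add_int_right _).2 hy
    have hy1 : a ≤ y' := by rw [hy']; push_cast; linarith
    have hy2 : y' < a + 1 := by rw [hy']; push_cast; linarith
    have hya : y' ≠ a := by
      intro e
      rw [e] at hm
      have := meets_unique (meets_symm hm) h (by
        rw [abs_of_pos (by linarith [hx.2])]; linarith [hx.1])
      exact hx.2.ne this.symm
    have hyb : y' ≠ b := by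
      intro e
      rw [e] at hm
      have := meets_unique (meets_symm hm) (meets_symm h) (by
        rw [abs_sub_comm, abs_of_pos (by linarith [hx.1])]; linarith [hx.2])
      exact hx.1.ne this
    rcases lt_or_gt_of_ne hyb with h2 | h2
    · exact ⟨y', ⟨lt_of_le_of_ne hy1 hya.symm, h2⟩, hm⟩
    · exact absurd ⟨y', ⟨h2, hy2⟩, hm⟩ hx'
  choose! m hm1 hm2 using hTm
  have hmT : ∀ x ∈ T, m x ∈ T := by
    intro x hx
    have hx0 := hx
    rw [hT, Finset.mem_filter, mem_crossingsBetween] at hx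
    rw [hT, Finset.mem_filter, mem_crossingsBetween]
    refine ⟨⟨hm1 x hx0, x, meets_symm (hm2 x hx0)⟩, ?_⟩
    rintro ⟨y, hy, hmy⟩
    have h2 := hx.1.1
    have := meets_unique (meets_symm (hm2 x hx0)) hmy (by
      rw [abs_of_pos (by linarith [hy.1, h2.2])]; linarith [hy.2, h2.1])
    linarith [hy.1, h2.2]
  refine Finset.sum_involution (fun x _ => m x) ?_ ?_ (fun x hx => hmT x hx) ?_
  · intro x hx
    rw [side_meets (hm2 x hx)]
    simp
  · intro x hx _ he
    have := (hm2 x hx).2 0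
    simp [he] at this
  · intro x hx
    have h2 := hm1 _ (hmT x hx)
    have hx' := hx
    rw [hT, Finset.mem_filter, mem_crossingsBetween] at hx'
    have h3 := hx'.1.1
    refine meets_unique (meets_symm (hm2 x hx)) (hm2 _ (hmT x hx)) ?_
    rw [abs_lt]; constructor <;> linarith [h2.1, h2.2, h3.1, h3.2]

end VirtualKnotDiagram

end DiagramIndex

/-! ### Numbering the passages by the integers and the Alexander index -/

section Enumeration

open Set

namespace VirtualKnotDiagram

variable (D : VirtualKnotDiagram)

/-- The letter of the crossing word contributed by a parameter. -/
noncomputable def passage (x : ℝ) : Passage ℂ := ⟨D.curve x, D.kind x, D.passageSign x⟩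

/-- An increasing enumeration of all parameters of passages, compatible with the crossing word. -/
structure Enumeration where
  param : ℤ → ℝ
  strictMono : StrictMono param
  isCrossing : ∀ k, D.IsCrossing (param k)
  surjective : ∀ x, D.IsCrossing x → ∃ k, param k = x
  add_length : ∀ k, param (k + D.word.length) = param k + 1
  word_get : ∀ i : Fin D.word.length, D.word.get i = D.passage (param i)

theorem nonempty_enumeration (hN : 0 < D.word.length) : Nonempty D.Enumeration := by
  set S := D.finite_crossings.toFinset with hS
  have hcard : S.card = D.word.length := by simp [word, hS]
  set N := D.word.length with hNdef
  set l := S.orderEmbOfFin hcard with hl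
  have hlS : ∀ i, l i ∈ Ico (0 : ℝ) 1 ∧ D.IsCrossing (l i) := fun i => by
    exact (Set.Finite.mem_toFinset D.finite_crossings).1 (S.orderEmbOfFin_mem hcard i)
  have hNz : (0 : ℤ) < N := by exact_mod_cast hN
  have hlt : ∀ k : ℤ, (k % N).toNat < N := fun k => by
    have := Int.emod_lt_of_pos k hNz
    have := Int.emod_nonneg k hNz.ne'
    omega
  -- The remainder modulo `N` selects a passage in `[0, 1)` and the quotient the number of turns.
  refine ⟨⟨fun k => l ⟨(k % N).toNat, hlt k⟩ + ((k / N : ℤ) : ℝ), ?_, ?_, ?_, ?_, ?_⟩⟩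
  · intro a b hab
    have ha := (hlS ⟨(a % N).toNat, hlt a⟩).1
    have hb := (hlS ⟨(b % N).toNat, hlt b⟩).1
    rcases (Int.ediv_le_ediv hNz hab.le).eq_or_lt with h | h
    · have : (a % N).toNat < (b % N).toNat := by
        have h1 := Int.emod_add_mul_ediv a N
        have h2 := Int.emod_add_mul_ediv b N
        have := Int.emod_nonneg a hNz.ne'
        rw [h] at h1
        omega
      have := l.strictMono (show (⟨_, hlt a⟩ : Fin N) < ⟨_, hlt b⟩ from this)
      simp only [h]
      linarith
    · have : ((a / N : ℤ) : ℝ) + 1 ≤ ((b / N : ℤ) : ℝ) := by exact_mod_cast h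
      linarith [ha.2, hb.1]
  · exact fun k => (isCrossing_add_int _).2 (hlS _).2
  · intro x hx
    have hmem : Int.fract x ∈ S := by
      rw [hS, Set.Finite.mem_toFinset]
      refine ⟨⟨Int.fract_nonneg x, Int.fract_lt_one x⟩, ?_⟩
      have := (isCrossing_add_int (D := D) (x := x) (-⌊x⌋)).2 hx
      rw [Int.cast_neg, ← sub_eq_add_neg] at this
      exact this
    obtain ⟨i, hi⟩ : ∃ i, l i = Int.fract x := by
      have := S.range_orderEmbOfFin hcard
      have h2 : Int.fract x ∈ Set.range l := by rw [hl, this]; exact hmem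
      exact h2
    refine ⟨i + N * ⌊x⌋, ?_⟩
    have h1 : ((i : ℤ) + N * ⌊x⌋) % N = i := by
      rw [Int.add_mul_emod_self_left]
      exact Int.emod_eq_of_lt (by positivity) (by exact_mod_cast i.2)
    have h2 : ((i : ℤ) + N * ⌊x⌋) / N = ⌊x⌋ := by
      rw [Int.add_mul_ediv_left _ _ hNz.ne', Int.ediv_eq_zero_of_lt (by positivity)
        (by exact_mod_cast i.2), zero_add]
    simp only [h1, h2, Int.toNat_natCast, Fin.eta, hi, Int.fract_add_floor]
  · intro k
    have h1 : (k + (N : ℤ)) / N = k / N + 1 := Int.add_ediv_of_dvd_right (dvd_refl _) |>.trans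
      (by rw [Int.ediv_self hNz.ne'])
    change l ⟨((k + (N : ℤ)) % N).toNat, hlt _⟩ + (((k + (N : ℤ)) / N : ℤ) : ℝ) =
      l ⟨(k % N).toNat, hlt k⟩ + ((k / N : ℤ) : ℝ) + 1
    simp only [Int.add_emod_right, h1]
    push_cast
    ring
  · intro i
    have h1 : ((i : ℕ) : ℤ) % N = i := Int.emod_eq_of_lt (by positivity) (by exact_mod_cast i.2)
    have h2 : ((i : ℕ) : ℤ) / N = 0 := Int.ediv_eq_zero_of_lt (by positivity)
      (by exact_mod_cast i.2)
    simp only [h1, h2, Int.toNat_natCast, Fin.eta, Int.cast_zero, add_zero]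
    have h3 : D.word.get i = D.passage ((S.sort (fun a b => a ≤ b))[(i : ℕ)]'(by
        rw [Finset.length_sort, hcard]; exact i.2)) := by
      rw [List.get_eq_getElem]
      simp only [word, List.getElem_map]
      rfl
    rw [h3, hl, Finset.orderEmbOfFin_apply]
    rfl

variable {D}

theorem side_passage (x : ℝ) : (D.passage x).side = D.side x := by
  simp only [passage, Passage.side, passageSign]
  cases D.kind x <;> simp

theorem passageSign_of_meets {x y : ℝ} (h : Meets D.curve x y) (hk : D.kind x = .under) :
    D.passageSign y = D.passageSign x := by
  have h1 := D.kind_meets x y h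
  rw [hk] at h1
  simp only [passageSign, hk, h1, PassageKind.opp, side_meets h]

namespace Enumeration

variable (E : D.Enumeration)

theorem add_mul_length (k j : ℤ) : E.param (k + j * D.word.length) = E.param k + j := by
  induction j with
  | zero => simp
  | succ i ih =>
    rw [show k + (i + 1 : ℤ) * D.word.length = k + i * D.word.length + D.word.length by ring,
      E.add_length, ih]
    push_cast; ring
  | pred i ih =>
    have := E.add_length (k + (-i - 1 : ℤ) * D.word.length)
    rw [show k + (-i - 1 : ℤ) * D.word.length + D.word.length = k + -i * D.word.length by ring,
      ih] at this
    push_cast at this ⊢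
    linarith

theorem length_pos (E : D.Enumeration) : 0 < D.word.length := by
  rw [Nat.pos_iff_ne_zero]
  intro h
  have := E.add_length 0
  rw [h] at this
  simp at this

theorem param_eq_add_int_iff {k l n : ℤ} :
    E.param l = E.param k + n ↔ l = k + n * D.word.length := by
  rw [← E.add_mul_length]
  exact E.strictMono.injective.eq_iff

theorem exists_mate (k : ℤ) : ∃ m, Meets D.curve (E.param k) (E.param m) := by
  obtain ⟨y, hy⟩ := E.isCrossing k
  obtain ⟨m, rfl⟩ := E.surjective y ⟨_, meets_symm hy⟩
  exact ⟨m, hy⟩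

/-- The number of the other passage through a crossing. -/
noncomputable def mate (k : ℤ) : ℤ := (E.exists_mate k).choose

theorem meets_mate (k : ℤ) : Meets D.curve (E.param k) (E.param (E.mate k)) :=
  (E.exists_mate k).choose_spec

theorem modEq_of_meets {k l m : ℤ} (h : Meets D.curve (E.param k) (E.param l))
    (h' : Meets D.curve (E.param k) (E.param m)) : l ≡ m [ZMOD D.word.length] := by
  obtain ⟨n, hn⟩ := D.no_triple _ _ _ h h'
  rw [E.param_eq_add_int_iff] at hn
  rw [hn]
  exact (Int.modEq_iff_dvd.2 ⟨n, by ring⟩)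

theorem curve_eq_iff {k l : ℤ} : D.curve (E.param k) = D.curve (E.param l) ↔
    k ≡ l [ZMOD D.word.length] ∨ E.mate k ≡ l [ZMOD D.word.length] := by
  constructor
  · intro h
    by_cases h1 : ∃ n : ℤ, E.param l = E.param k + n
    · obtain ⟨n, hn⟩ := h1
      rw [E.param_eq_add_int_iff] at hn
      exact Or.inl (by rw [hn]; exact (Int.modEq_iff_dvd.2 ⟨n, by ring⟩))
    · exact Or.inr (E.modEq_of_meets (E.meets_mate k) ⟨h, not_exists.1 h1⟩)
  · have key : ∀ {k l : ℤ}, k ≡ l [ZMOD D.word.length] →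
        D.curve (E.param k) = D.curve (E.param l) := by
      intro k l h
      obtain ⟨n, hn⟩ := Int.modEq_iff_dvd.1 h
      have : l = k + n * D.word.length := by linarith
      rw [this, E.add_mul_length, D.curve_add_int]
    rintro (h | h)
    · exact key h
    · exact (E.meets_mate k).1.trans (key h)

theorem kind_mate (k : ℤ) : D.kind (E.param (E.mate k)) = (D.kind (E.param k)).opp :=
  D.kind_meets _ _ (E.meets_mate k)

theorem mate_mate (k : ℤ) : E.mate (E.mate k) ≡ k [ZMOD D.word.length] :=
  E.modEq_of_meets (E.meets_mate _) (meets_symm (E.meets_mate k))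

theorem kind_add_mul (k n : ℤ) :
    D.kind (E.param (k + n * D.word.length)) = D.kind (E.param k) := by
  rw [E.add_mul_length, D.kind_add_int]

theorem side_add_mul (k n : ℤ) :
    D.side (E.param (k + n * D.word.length)) = D.side (E.param k) := by
  rw [E.add_mul_length, side_add_int (E.meets_mate k)]

theorem passage_add_mul (k n : ℤ) :
    D.passage (E.param (k + n * D.word.length)) = D.passage (E.param k) := by
  simp only [passage, passageSign, E.kind_add_mul, E.side_add_mul]
  rw [E.add_mul_length, D.curve_add_int]

/-- The index of the arc before a passage. -/
noncomputable def index (k : ℤ) : ℤ :=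
  ∑ j ∈ Finset.Ico k 0, (D.side (E.param j) : ℤ) - ∑ j ∈ Finset.Ico 0 k, (D.side (E.param j) : ℤ)

theorem index_zero : E.index 0 = 0 := by simp [index]

theorem index_add_one (k : ℤ) : E.index (k + 1) = E.index k - D.side (E.param k) := by
  unfold index
  rcases lt_or_ge k 0 with h | h
  · rw [← Finset.insert_Ico_add_one_left_eq_Ico h, Finset.sum_insert (by simp),
      Finset.Ico_eq_empty (show ¬ (0 : ℤ) < k + 1 by omega),
      Finset.Ico_eq_empty (show ¬ (0 : ℤ) < k by omega)]
    ring
  · rw [← Finset.insert_Ico_right_eq_Ico_add_one h, Finset.sum_insert (by simp),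
      Finset.Ico_eq_empty (show ¬ k + 1 < (0 : ℤ) by omega),
      Finset.Ico_eq_empty (show ¬ k < (0 : ℤ) by omega)]
    ring

theorem index_sub (k : ℤ) (n : ℕ) :
    E.index k - E.index (k + n) = ∑ j ∈ Finset.Ico k (k + n), (D.side (E.param j) : ℤ) := by
  induction n with
  | zero => simp
  | succ n ih =>
    rw [Nat.cast_succ, ← add_assoc, ← Finset.insert_Ico_right_eq_Ico_add_one (by omega),
      Finset.sum_insert (by simp), ← ih, index_add_one]
    ring

/-- The difference of the two indices is the sum of the sides of the passages strictly between `a`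
and `b`, which vanishes by `sum_side_eq_zero`. -/
theorem index_add_one_of_meets_lt {a b : ℤ} (hab : a < b) (hb : b < a + D.word.length)
    (h : Meets D.curve (E.param a) (E.param b)) : E.index (a + 1) = E.index b := by
  have h1 := E.strictMono hab
  have h2 := E.strictMono hb
  rw [E.add_length] at h2
  have h3 := sum_side_eq_zero h1 h2 h
  obtain ⟨n, rfl⟩ : ∃ n : ℕ, b = a + 1 + n := ⟨(b - (a + 1)).toNat, by omega⟩
  have h4 : D.crossingsBetween (E.param a) (E.param (a + 1 + n)) =
      (Finset.Ico (a + 1) (a + 1 + n)).image E.param := by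
    ext x
    rw [mem_crossingsBetween, Finset.mem_image]
    constructor
    · rintro ⟨hx, hc⟩
      obtain ⟨k, rfl⟩ := E.surjective x hc
      have h5 := E.strictMono.lt_iff_lt.1 hx.1
      have h6 := E.strictMono.lt_iff_lt.1 hx.2
      exact ⟨k, Finset.mem_Ico.2 ⟨by omega, h6⟩, rfl⟩
    · rintro ⟨k, hk, rfl⟩
      rw [Finset.mem_Ico] at hk
      exact ⟨⟨E.strictMono (by omega), E.strictMono hk.2⟩, E.isCrossing k⟩
  rw [h4, Finset.sum_image E.strictMono.injective.injOn, ← index_sub] at h3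
  linarith

theorem not_modEq_of_meets {a b : ℤ} (h : Meets D.curve (E.param a) (E.param b)) :
    ¬ a ≡ b [ZMOD D.word.length] := by
  intro h1
  obtain ⟨n, hn⟩ := Int.modEq_iff_dvd.1 h1
  exact h.2 n (E.param_eq_add_int_iff.2 (by linarith))

/-- One full turn consists of the two loops at a crossing, each with total zero, and of the two
passages through that crossing, whose sides are opposite. -/
theorem index_add_length (a : ℤ) : E.index (a + D.word.length) = E.index a := by
  have hN : (0 : ℤ) < D.word.length := by exact_mod_cast E.length_pos
  set N : ℤ := (D.word.length : ℤ) with hNdef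
  have hm := E.meets_mate a
  set n := (E.mate a - a) / N with hn
  -- The other passage shifted by whole turns into the period that starts at `a`.
  set b := E.mate a - n * N with hb
  have hb' : E.mate a = b + n * N := by rw [hb]; ring
  have hmb : Meets D.curve (E.param a) (E.param b) := by
    rw [hb', E.add_mul_length, meets_add_int_right] at hm
    exact hm
  have h1 := Int.emod_add_mul_ediv (E.mate a - a) N
  have h2 := Int.emod_lt_of_pos (E.mate a - a) hN
  have h3 := Int.emod_nonneg (E.mate a - a) hN.ne'
  have h4 : b = a + (E.mate a - a) % N := by rw [hb, hn]; linarith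
  have h5 : a ≠ b := by
    intro e
    exact E.not_modEq_of_meets hmb (by rw [← e])
  have k1 := E.index_add_one_of_meets_lt (by omega) (by omega) hmb
  have hmb' : Meets D.curve (E.param b) (E.param (a + N)) := by
    have := (meets_add_int_right (D := D) (x := E.param b) (y := E.param a) 1).2 (meets_symm hmb)
    rw [hNdef, E.add_length]
    simpa using this
  have k2 := E.index_add_one_of_meets_lt (a := b) (b := a + N) (by omega) (by omega) hmb'
  rw [index_add_one] at k1 k2
  rw [← k2, ← k1, side_meets hmb]
  simp

theorem index_add_mul_length (a n : ℤ) : E.index (a + n * D.word.length) = E.index a := by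
  have : Function.Periodic E.index D.word.length := E.index_add_length
  simpa using this.int_mul n a

/-- The index of the outgoing arc of a passage is that of the incoming arc of the other passage
through the crossing. -/
theorem index_mate (a : ℤ) : E.index (E.mate a) = E.index (a + 1) := by
  have hN : (0 : ℤ) < D.word.length := by exact_mod_cast E.length_pos
  set N : ℤ := (D.word.length : ℤ) with hNdef
  have hm := E.meets_mate a
  set n := (E.mate a - a) / N with hn
  set b := E.mate a - n * N with hb
  have hb' : E.mate a = b + n * N := by rw [hb]; ring
  have hmb : Meets D.curve (E.param a) (E.param b) := by
    rw [hb', E.add_mul_length, meets_add_int_right] at hm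
    exact hm
  have h1 := Int.emod_add_mul_ediv (E.mate a - a) N
  have h2 := Int.emod_lt_of_pos (E.mate a - a) hN
  have h3 := Int.emod_nonneg (E.mate a - a) hN.ne'
  have h4 : b = a + (E.mate a - a) % N := by rw [hb, hn]; linarith
  have h5 : a ≠ b := by
    intro e
    exact E.not_modEq_of_meets hmb (by rw [← e])
  rw [E.index_add_one_of_meets_lt (by omega) (by omega) hmb, hb', E.index_add_mul_length]

end Enumeration

end VirtualKnotDiagram

end Enumeration

/-! ### Invariance of the determinant under the choice of a diagram -/

namespace VirtualKnotDiagram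

variable {D : VirtualKnotDiagram}

theorem exists_of_mem_word {l : Passage ℂ} (hl : l ∈ D.word) :
    ∃ x, D.IsCrossing x ∧ l = D.passage x := by
  obtain ⟨x, hx, rfl⟩ := List.mem_map.1 hl
  rw [Finset.mem_sort, Set.Finite.mem_toFinset] at hx
  exact ⟨x, hx.2, rfl⟩

namespace Enumeration

variable (E : D.Enumeration)

theorem kind_word_get (i : Fin D.word.length) :
    (D.word.get i).kind = D.kind (E.param i) := by rw [E.word_get]; rfl

theorem sign_word_get (i : Fin D.word.length) :
    (D.word.get i).sign = D.passageSign (E.param i) := by rw [E.word_get]; rfl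

theorem label_word_get (i : Fin D.word.length) :
    (D.word.get i).label = D.curve (E.param i) := by rw [E.word_get]; rfl

theorem kind_of_modEq {k l : ℤ} (h : k ≡ l [ZMOD D.word.length]) :
    D.kind (E.param k) = D.kind (E.param l) := by
  obtain ⟨n, hn⟩ := Int.modEq_iff_dvd.1 h
  rw [show l = k + n * D.word.length by linarith, E.kind_add_mul]

theorem index_of_modEq {k l : ℤ} (h : k ≡ l [ZMOD D.word.length]) :
    E.index k = E.index l := by
  obtain ⟨n, hn⟩ := Int.modEq_iff_dvd.1 h
  rw [show l = k + n * D.word.length by linarith, E.index_add_mul_length]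

/-- Every number of a passage is congruent to a position in the word. -/
theorem exists_fin_modEq (E : D.Enumeration) (k : ℤ) :
    ∃ i : Fin D.word.length, (i : ℤ) ≡ k [ZMOD D.word.length] := by
  have hN : (0 : ℤ) < D.word.length := by exact_mod_cast E.length_pos
  have h1 := Int.emod_lt_of_pos k hN
  have h2 := Int.emod_nonneg k hN.ne'
  refine ⟨⟨(k % D.word.length).toNat, by omega⟩, ?_⟩
  simp only [Int.toNat_of_nonneg h2]
  exact Int.mod_modEq _ _

theorem modEq_of_over {k l : ℤ} (hk : D.kind (E.param k) = .over)
    (hl : D.kind (E.param l) = .over) (h : D.curve (E.param k) = D.curve (E.param l)) :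
    k ≡ l [ZMOD D.word.length] := by
  rcases E.curve_eq_iff.1 h with h | h
  · exact h
  · have := E.kind_of_modEq h
    rw [kind_mate, hk, hl] at this
    cases this

theorem isMatched (E : D.Enumeration) : IsMatched D.word where
  over_unique i j hi hj hij := by
    rw [E.kind_word_get] at hi hj
    rw [E.label_word_get, E.label_word_get] at hij
    have := E.modEq_of_over hi hj hij
    exact Fin.ext (Nat.ModEq.eq_of_lt_of_lt (Int.natCast_modEq_iff.1 this) i.2 j.2)
  exists_over i hi := by
    obtain ⟨j, hj⟩ := E.exists_fin_modEq (E.mate i)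
    rw [E.kind_word_get] at hi
    refine ⟨j, ?_⟩
    have h1 : D.word.get j = D.passage (E.param (E.mate i)) := by
      obtain ⟨n, hn⟩ := Int.modEq_iff_dvd.1 hj
      rw [E.word_get, show E.mate i = j + n * D.word.length by linarith, E.passage_add_mul]
    rw [h1, E.label_word_get, E.sign_word_get]
    refine ⟨(E.meets_mate i).1.symm, ?_, passageSign_of_meets (E.meets_mate i) hi⟩
    change D.kind _ = _
    rw [E.kind_mate, hi]; rfl

open Classical in
/-- The index of the arc before the over-passage through a crossing. -/
noncomputable def overIndex (z : ℂ) : ℤ :=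
  if h : ∃ k, D.curve (E.param k) = z ∧ D.kind (E.param k) = .over then E.index h.choose else 0

theorem overIndex_of_over {k : ℤ} (hk : D.kind (E.param k) = .over) :
    E.overIndex (D.curve (E.param k)) = E.index k := by
  have h : ∃ k', D.curve (E.param k') = D.curve (E.param k) ∧ D.kind (E.param k') = .over :=
    ⟨k, rfl, hk⟩
  rw [overIndex, dif_pos h]
  exact E.index_of_modEq (E.modEq_of_over h.choose_spec.2 hk h.choose_spec.1)

/-- This is the compatibility required by `IsIndexed`, supplied by `index_mate`. -/
theorem overIndex_of_under {k : ℤ} (hk : D.kind (E.param k) = .under) :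
    E.overIndex (D.curve (E.param k)) = E.index (k + 1) := by
  rw [(E.meets_mate k).1, E.overIndex_of_over (by rw [kind_mate, hk]; rfl), index_mate]

theorem isIndexed_of_get (w : List (Passage ℂ)) (k : ℤ)
    (h : ∀ i : Fin w.length, w.get i = D.passage (E.param (k + i))) :
    IsIndexed E.overIndex w (E.index k) ∧
      (w.map fun l => (l.side : ℤ)).sum = E.index k - E.index (k + w.length) := by
  induction w generalizing k with
  | nil => simp [IsIndexed]
  | cons l w ih =>
    have h0 : l = D.passage (E.param k) := by
      have := h ⟨0, by simp⟩
      simpa using this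
    have hs : E.index k - l.side = E.index (k + 1) := by
      rw [h0, side_passage, index_add_one]
    obtain ⟨h1, h2⟩ := ih (k + 1) fun i => by
      have := h i.succ
      refine Eq.trans ?_ (this.trans ?_)
      · rfl
      · congr 2; simp; ring
    refine ⟨⟨?_, ?_, ?_⟩, ?_⟩
    · intro hl
      rw [h0] at hl ⊢
      exact E.overIndex_of_over hl
    · intro hl
      rw [hs]
      rw [h0] at hl ⊢
      exact E.overIndex_of_under hl
    · rw [hs]; exact h1
    · rw [List.map_cons, List.sum_cons, h2, List.length_cons, ← hs]
      push_cast
      rw [add_right_comm k 1, add_assoc k]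
      ring

end Enumeration

theorem isMatched_word (D : VirtualKnotDiagram) : IsMatched D.word := by
  rcases Nat.eq_zero_or_pos D.word.length with h | h
  · have : IsEmpty (Fin D.word.length) := by rw [h]; infer_instance
    exact ⟨fun i => isEmptyElim i, fun i => isEmptyElim i⟩
  · exact (D.nonempty_enumeration h).some.isMatched

theorem exists_isIndexed_word (D : VirtualKnotDiagram) :
    ∃ i, IsIndexed i D.word 0 ∧ (D.word.map fun l => (l.side : ℤ)).sum = 0 := by
  rcases Nat.eq_zero_or_pos D.word.length with h | h
  · rw [List.length_eq_zero_iff] at h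
    exact ⟨0, by rw [h]; exact ⟨trivial, rfl⟩⟩
  · obtain ⟨E⟩ := D.nonempty_enumeration h
    obtain ⟨h1, h2⟩ := E.isIndexed_of_get D.word 0 fun i => by rw [E.word_get, zero_add]
    rw [E.index_zero] at h1 h2
    refine ⟨_, h1, h2.trans ?_⟩
    rw [E.index_add_length, E.index_zero, sub_zero]

variable {R : Type} [CommRing R]

/-- Solutions of the matrix are colorings of the full word. Rescaling by the index makes the virtual
passages trivial; they can then be deleted and the remaining crossings renamed, leaving data of the
Gauss code alone. -/
theorem Represents.nonempty_solEquiv {G : GaussCode} {f : ℂ → ℕ} (a : Weights R)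
    (hf : Set.InjOn f D.crossings)
    (hG : G.1 = (D.word.filter fun l => l.kind ≠ .virt).map (Passage.relabel f)) :
    Nonempty (SolEquiv (alexanderMatrix a D.word).solutions (a.classical.colorings G.1)) := by
  obtain ⟨i, hi, h0⟩ := D.exists_isIndexed_word
  have hlab : ∀ l ∈ D.word.filter (fun l => l.kind ≠ .virt), l.label ∈ D.crossings := by
    intro l hl
    obtain ⟨x, ⟨y, hy⟩, rfl⟩ := exists_of_mem_word (List.mem_filter.1 hl).1
    exact ⟨x, y, hy, rfl⟩
  rw [hG]
  exact ⟨(((alexanderMatrixSolEquiv a D.isMatched_word).trans (a.coloringsClassical hi h0)).trans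
    (Weights.coloringsFilter a.classical rfl _)).trans
    (Weights.coloringsRelabel _ _ f fun l hl l' hl' h => hf (hlab l hl) (hlab l' hl') h)⟩

/-- The determinants of the Alexander matrices of diagrams of the same knot are associated. -/
theorem Represents.associated_det [IsDomain R] {D' : VirtualKnotDiagram} {K : VirtualKnot}
    (a : Weights R) (h : D.Represents K) (h' : D'.Represents K) :
    Associated (alexanderMatrix a D.word).det (alexanderMatrix a D'.word).det := by
  obtain ⟨f, G, hf, hG, hK⟩ := h
  obtain ⟨f', G', hf', hG', hK'⟩ := h'
  obtain ⟨e⟩ := Represents.nonempty_solEquiv a hf hG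
  obtain ⟨e'⟩ := Represents.nonempty_solEquiv a hf' hG'
  obtain ⟨e''⟩ := a.classical.nonempty_solEquiv_of_quot_eq (hK.trans hK'.symm)
  exact ((e.trans e'').trans e'.symm).associated_det

end VirtualKnotDiagram

/-! ### Cyclic recurrences and determinants of cyclic covers in characteristic `p` -/

section ShiftMatrix

variable {R : Type} [CommRing R]

/-- The matrix of the linear equations `x (succ i) = α i • x i + β i • x (ovr i)`. -/
def shiftMatrix {ι : Type} [DecidableEq ι] (succ ovr : ι → ι) (α β : ι → R) : Matrix ι ι R :=
  fun i j => (if succ i = j then 1 else 0) - (if i = j then α i else 0) -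
    (if ovr i = j then β i else 0)

theorem sum_shiftMatrix {ι V : Type} [DecidableEq ι] [Fintype ι] [AddCommGroup V] [Module R V]
    (succ ovr : ι → ι) (α β : ι → R) (x : ι → V) (i : ι) :
    ∑ j, shiftMatrix succ ovr α β i j • x j =
      x (succ i) - α i • x i - β i • x (ovr i) := by
  simp [shiftMatrix, sub_smul, Finset.sum_sub_distrib, ite_smul]

/-- The solutions `x` of period `N` of the equations `x (k + 1) = α k • x k + β k • x (m k)`. -/
def recurrentSequences (N : ℕ) (α β : ℤ → R) (m : ℤ → ℤ) : SolFamily R ℤ :=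
  fun V _ _ => {x : ℤ → V | (∀ k, x (k + N) = x k) ∧
    ∀ k, x (k + 1) = α k • x k + β k • x (m k)}

section Periodic

variable {L n : ℕ}

/-- The class of an integer modulo `n * L`. -/
def cyclicClass (L n : ℕ) (k : ℤ) : ZMod L × ZMod n := ((k : ZMod L), ((k / (L : ℤ) : ℤ) : ZMod n))

/-- The standard representatives modulo `n * L`. -/
def cyclicRep {L n : ℕ} (x : ZMod L × ZMod n) : ℤ := (x.1.val : ℤ) + L * x.2.val

/-- Translation by multiples of `L` acts freely on the second coordinate only. This is the form of
the symmetry needed in `det_shiftMatrix_prod`. -/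
theorem cyclicClass_add_mul [NeZero L] (k c : ℤ) :
    cyclicClass L n (k + L * c) = ((cyclicClass L n k).1, (cyclicClass L n k).2 + (c : ZMod n)) := by
  have hL : (L : ℤ) ≠ 0 := by exact_mod_cast NeZero.ne L
  unfold cyclicClass
  rw [Int.add_mul_ediv_left _ _ hL]
  simp

theorem cyclicClass_eq_of_modEq [NeZero L] {k l : ℤ} (h : k ≡ l [ZMOD (n * L : ℕ)]) :
    cyclicClass L n k = cyclicClass L n l := by
  obtain ⟨c, hc⟩ := Int.modEq_iff_dvd.1 h
  have : l = k + L * (n * c) := by push_cast at hc; linear_combination hc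
  rw [this, cyclicClass_add_mul]
  simp

theorem cyclicClass_cyclicRep [NeZero L] [NeZero n] (x : ZMod L × ZMod n) :
    cyclicClass L n (cyclicRep x) = x := by
  have hL : (L : ℤ) ≠ 0 := by exact_mod_cast NeZero.ne L
  unfold cyclicRep
  rw [cyclicClass_add_mul]
  have : ((x.1.val : ℤ) / (L : ℤ)) = 0 :=
    Int.ediv_eq_zero_of_lt (by positivity) (by exact_mod_cast x.1.val_lt)
  simp only [cyclicClass, this]
  simp

theorem cyclicRep_cyclicClass_modEq [NeZero L] [NeZero n] (k : ℤ) :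
    cyclicRep (cyclicClass L n k) ≡ k [ZMOD (n * L : ℕ)] := by
  have h1 := Int.emod_add_mul_ediv k L
  have h2 := Int.emod_add_mul_ediv (k / L) n
  unfold cyclicRep cyclicClass
  rw [ZMod.val_intCast, ZMod.val_intCast]
  refine Int.modEq_iff_dvd.2 ⟨k / L / n, ?_⟩
  push_cast
  linear_combination (-1 : ℤ) * h1 - (L : ℤ) * h2

theorem cyclicRep_mk [NeZero n] (j : ZMod L) (b : ZMod n) :
    cyclicRep (j, b) = cyclicRep (j, (0 : ZMod n)) + L * (b.val : ℤ) := by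
  simp [cyclicRep]

theorem periodic_of_modEq {V : Type} {x : ℤ → V} {N : ℕ} (hx : ∀ k, x (k + N) = x k) {k l : ℤ}
    (h : k ≡ l [ZMOD N]) : x k = x l := by
  obtain ⟨c, hc⟩ := Int.modEq_iff_dvd.1 h
  have : Function.Periodic x (N : ℤ) := hx
  rw [show l = k + c * N by linarith]
  simpa using (this.int_mul c k).symm

/-- Periodic sequences as functions on residue classes. -/
def recurrentSequencesSolEquiv [NeZero L] [NeZero n] {α β : ℤ → R} {m : ℤ → ℤ}
    (hα : ∀ k, α (k + (n * L : ℕ)) = α k) (hβ : ∀ k, β (k + (n * L : ℕ)) = β k)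
    (hm : ∀ k l, k ≡ l [ZMOD (n * L : ℕ)] → m k ≡ m l [ZMOD (n * L : ℕ)]) :
    SolEquiv (recurrentSequences (n * L) α β m)
      (shiftMatrix (fun i : ZMod L × ZMod n => cyclicClass L n (cyclicRep i + 1))
        (fun i => cyclicClass L n (m (cyclicRep i))) (fun i => α (cyclicRep i))
        (fun i => β (cyclicRep i))).solutions where
  toFun _ _ _ x := x ∘ cyclicRep
  invFun _ _ _ y := y ∘ cyclicClass L n
  toFun_natural _ _ _ _ _ _ _ _ := rfl
  invFun_natural _ _ _ _ _ _ _ _ := rfl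
  toFun_mem V _ _ x hx i := by
    rw [sum_shiftMatrix]
    simp only [Function.comp_apply]
    rw [periodic_of_modEq hx.1 (cyclicRep_cyclicClass_modEq _),
      periodic_of_modEq hx.1 (cyclicRep_cyclicClass_modEq _), hx.2]
    abel
  invFun_mem V _ _ y hy := by
    refine ⟨fun k => ?_, fun k => ?_⟩
    · rw [Function.comp_apply, Function.comp_apply,
        cyclicClass_eq_of_modEq (show k + (n * L : ℕ) ≡ k [ZMOD (n * L : ℕ)] by simp)]
    · have h := hy (cyclicClass L n k)
      have h0 := cyclicRep_cyclicClass_modEq (L := L) (n := n) k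
      rw [sum_shiftMatrix, periodic_of_modEq hα h0, periodic_of_modEq hβ h0,
        cyclicClass_eq_of_modEq (h0.add_right 1), cyclicClass_eq_of_modEq (hm _ _ h0),
        sub_sub, sub_eq_zero] at h
      exact h
  left_inv V _ _ x hx := by
    ext k
    exact periodic_of_modEq hx.1 (cyclicRep_cyclicClass_modEq k)
  right_inv V _ _ y _ := by
    ext i
    exact congrArg y (cyclicClass_cyclicRep i)

end Periodic

section CharP

variable {J : Type} [Fintype J] [DecidableEq J]

/-- The permutation matrix of the shift of a cyclic group. -/
def cyclicShift (R : Type) [CommRing R] (n : ℕ) : Matrix (ZMod n) (ZMod n) R :=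
  fun b c => if b + 1 = c then 1 else 0

theorem cyclicShift_pow {n : ℕ} [NeZero n] (e : ℕ) (b c : ZMod n) :
    (cyclicShift R n ^ e) b c = if b + (e : ZMod n) = c then 1 else 0 := by
  induction e generalizing c with
  | zero => simp [Matrix.one_apply]
  | succ e ih =>
    rw [pow_succ, Matrix.mul_apply]
    simp only [ih, cyclicShift, ite_mul, one_mul, zero_mul, Finset.sum_ite_eq, Finset.mem_univ,
      if_true]
    push_cast
    rw [add_assoc]

open Polynomial in
/-- In characteristic `p`, the determinant of a system of equations with a free symmetry of
order `p ^ r` is a power of the determinant of the quotient system. -/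
theorem det_shiftMatrix_prod [IsDomain R] {p r n : ℕ} [hp : Fact p.Prime] [CharP R p]
    [NeZero n] (hn : n = p ^ r) (sc ov : J → J × ZMod n) (α β : J → R) :
    (shiftMatrix (fun i : J × ZMod n => ((sc i.1).1, (sc i.1).2 + i.2))
      (fun i => ((ov i.1).1, (ov i.1).2 + i.2)) (fun i => α i.1) (fun i => β i.1)).det =
    (shiftMatrix (fun j => (sc j).1) (fun j => (ov j).1) α β).det ^ n := by
  -- The quotient matrix with the displacement in the cyclic direction recorded by a power of `X`.
  -- Setting `X` to the cyclic shift gives the covering matrix, and setting it to `1` the quotient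
  -- matrix.
  set M : Matrix J J R[X] := fun i j => (if (sc i).1 = j then X ^ (sc i).2.val else 0) -
    (if i = j then C (α i) else 0) - (if (ov i).1 = j then C (β i) * X ^ (ov i).2.val else 0)
    with hM
  set f : R[X] →+* Matrix (ZMod n) (ZMod n) R := (aeval (cyclicShift R n)).toRingHom with hf
  have hfX : f X = cyclicShift R n := aeval_X _
  have hfC : ∀ c, f (C c) = algebraMap R _ c := fun c => aeval_C _ c
  have h1 : (M.map f).comp J J (ZMod n) (ZMod n) R =
      shiftMatrix (fun i : J × ZMod n => ((sc i.1).1, (sc i.1).2 + i.2))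
      (fun i => ((ov i.1).1, (ov i.1).2 + i.2)) (fun i => α i.1) (fun i => β i.1) := by
    ext ⟨i, b⟩ ⟨j, c⟩
    have e1 : f (if (sc i).1 = j then X ^ (sc i).2.val else 0) b c =
        if ((sc i).1, (sc i).2 + b) = (j, c) then 1 else 0 := by
      by_cases h : (sc i).1 = j
      · rw [if_pos h, map_pow, hfX, cyclicShift_pow, ZMod.natCast_zmod_val, add_comm b]
        simp [h]
      · simp [h]
    have e2 : f (if i = j then C (α i) else 0) b c = if (i, b) = (j, c) then α i else 0 := by
      by_cases h : i = j
      · rw [if_pos h, hfC, Matrix.algebraMap_matrix_apply]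
        simp [h]
      · simp [h]
    have e3 : f (if (ov i).1 = j then C (β i) * X ^ (ov i).2.val else 0) b c =
        if ((ov i).1, (ov i).2 + b) = (j, c) then β i else 0 := by
      by_cases h : (ov i).1 = j
      · rw [if_pos h, map_mul, map_pow, hfX, hfC, ← Algebra.smul_def, Matrix.smul_apply,
          cyclicShift_pow, ZMod.natCast_zmod_val, add_comm b]
        simp [h]
      · simp [h]
    rw [Matrix.comp_apply, Matrix.map_apply, hM]
    simp only [map_sub, Matrix.sub_apply, e1, e2, e3, shiftMatrix]
  have h2 : eval 1 M.det = (shiftMatrix (fun j => (sc j).1) (fun j => (ov j).1) α β).det := by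
    rw [← coe_evalRingHom, RingHom.map_det]
    congr 1
    ext i j
    rw [RingHom.mapMatrix_apply, Matrix.map_apply, hM]
    simp only [coe_evalRingHom, eval_sub, shiftMatrix]
    congr 1
    · congr 1
      · split_ifs <;> simp
      · split_ifs <;> simp
    · split_ifs <;> simp
  -- Modulo `X - 1` the polynomial `M.det` is its value at `1`. Raising to the power `n = p ^ r` is
  -- additive, so modulo `X ^ n - 1`, which kills the cyclic shift, the power is a constant.
  have h3 : f M.det ^ n = algebraMap R _ (eval 1 M.det ^ n) := by
    obtain ⟨g, hg⟩ := X_sub_C_dvd_sub_C_eval (a := 1) (p := M.det)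
    have h4 : M.det = (X - C 1) * g + C (eval 1 M.det) := by rw [← hg]; ring
    have h5 : M.det ^ n = (X ^ n - 1) * g ^ n + C (eval 1 M.det ^ n) := by
      conv_lhs => rw [h4]
      rw [hn, add_pow_char_pow, mul_pow, sub_pow_char_pow, C_1, one_pow, C_pow]
    have h6 : f (X ^ n - 1) = 0 := by
      rw [map_sub, map_pow, hfX, map_one, sub_eq_zero]
      ext b c
      rw [cyclicShift_pow, ZMod.natCast_self, add_zero, Matrix.one_apply]
    rw [← map_pow, h5, map_add, map_mul, h6, zero_mul, zero_add, hfC]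
  -- Determinants of matrices of size `n`: the scalar on the right contributes a further `n`-th
  -- power, so the desired equation holds after raising both sides to the power `n`.
  have h7 := congrArg Matrix.det h3
  rw [Matrix.det_pow, Algebra.algebraMap_eq_smul_one, Matrix.det_smul, Matrix.det_one, mul_one,
    ZMod.card] at h7
  -- The determinant of the block matrix with commuting blocks is the determinant of the block
  -- determinant `f M.det`. Injectivity of the iterated Frobenius in a domain then removes the outer
  -- power.
  rw [← h1, ← Matrix.det_det, ← h2]
  have h8 : ExpChar R p := ExpChar.prime hp.out
  exact iterateFrobenius_inj R p r (by simpa [iterateFrobenius_def, ← hn] using h7)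

end CharP

end ShiftMatrix

/-! ### The Alexander system as a recurrence over the numbered passages -/

namespace VirtualKnotDiagram.Enumeration

variable {D : VirtualKnotDiagram} (E : D.Enumeration) {R : Type} [CommRing R] (a : Weights R)

/-- The coefficient of the incoming arc at a passage. -/
noncomputable def coeff (k : ℤ) : R := a.coeff (D.kind (E.param k)) (D.passageSign (E.param k))

/-- The coefficient of the incoming over-crossing arc at a passage. -/
noncomputable def overCoeff (k : ℤ) : R :=
  a.overCoeff (D.kind (E.param k)) (D.passageSign (E.param k))

theorem passageSign_congr {x y : ℝ} (hk : D.kind x = D.kind y) (hs : D.side x = D.side y) :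
    D.passageSign x = D.passageSign y := by
  simp only [passageSign, hk, hs]

theorem coeff_add_length (k : ℤ) : E.coeff a (k + D.word.length) = E.coeff a k := by
  have h1 := E.kind_add_mul k 1
  have h2 := E.side_add_mul k 1
  rw [one_mul] at h1 h2
  rw [coeff, coeff, h1, passageSign_congr h1 h2]

theorem overCoeff_add_length (k : ℤ) : E.overCoeff a (k + D.word.length) = E.overCoeff a k := by
  have h1 := E.kind_add_mul k 1
  have h2 := E.side_add_mul k 1
  rw [one_mul] at h1 h2
  rw [overCoeff, overCoeff, h1, passageSign_congr h1 h2]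

theorem mate_of_modEq (k l : ℤ) (h : k ≡ l [ZMOD D.word.length]) :
    E.mate k ≡ E.mate l [ZMOD D.word.length] := by
  obtain ⟨n, hn⟩ := Int.modEq_iff_dvd.1 h
  have h1 := E.meets_mate l
  rw [show l = k + n * D.word.length by linarith, E.add_mul_length, meets_add_int_left] at h1
  rw [show l = k + n * D.word.length by linarith]
  exact E.modEq_of_meets (E.meets_mate k) h1

/-- Among the passages through the same point only the mate has a kind different from `.under`. -/
theorem overPassage_modEq {i : Fin D.word.length} (hi : (D.word.get i).kind = .under) :
    (overPassage D.word i : ℤ) ≡ E.mate i [ZMOD D.word.length] := by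
  obtain ⟨h1, h2, -⟩ := E.isMatched.overPassage_spec hi
  rw [E.label_word_get, E.label_word_get] at h1
  rw [E.kind_word_get] at h2 hi
  rcases E.curve_eq_iff.1 h1.symm with h | h
  · have := E.kind_of_modEq h
    rw [hi, h2] at this
    cases this
  · exact h.symm

theorem overCoeff_eq_zero {k : ℤ} (h : D.kind (E.param k) ≠ .under) : E.overCoeff a k = 0 := by
  unfold overCoeff
  cases hk : D.kind (E.param k) <;> simp_all

/-- The position in the word of an integer. -/
noncomputable def position (E : D.Enumeration) (k : ℤ) : Fin D.word.length :=
  ⟨(k % D.word.length).toNat, by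
    have hN : (0 : ℤ) < D.word.length := by exact_mod_cast E.length_pos
    have h1 := Int.emod_lt_of_pos k hN
    have h2 := Int.emod_nonneg k hN.ne'
    omega⟩

theorem position_modEq (k : ℤ) : (E.position k : ℤ) ≡ k [ZMOD D.word.length] := by
  have hN : (0 : ℤ) < D.word.length := by exact_mod_cast E.length_pos
  simp only [position, Int.toNat_of_nonneg (Int.emod_nonneg k hN.ne')]
  exact Int.mod_modEq _ _

theorem position_eq_iff (k : ℤ) (i : Fin D.word.length) :
    E.position k = i ↔ k ≡ i [ZMOD D.word.length] := by
  constructor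
  · rintro rfl
    exact (E.position_modEq k).symm
  · intro h
    have := (E.position_modEq k).trans h
    exact Fin.ext (Nat.ModEq.eq_of_lt_of_lt (Int.natCast_modEq_iff.1 this) (E.position k).2 i.2)

/-- The solutions of the Alexander system are periodic sequences. -/
noncomputable def alexanderSequences :
    SolEquiv (alexanderMatrix a D.word).solutions
      (recurrentSequences D.word.length (E.coeff a) (E.overCoeff a) E.mate) where
  toFun _ _ _ c k := c (E.position k).castSucc
  invFun _ _ _ x i := x i
  toFun_natural _ _ _ _ _ _ _ _ := rfl
  invFun_natural _ _ _ _ _ _ _ _ := rfl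
  toFun_mem V _ _ c hc := by
    obtain ⟨h1, h2⟩ := (mem_solutions_alexanderMatrix a E.isMatched c).1 hc
    have hnext : ∀ k, c (E.position (k + 1)).castSucc = c (E.position k).succ := by
      intro k
      by_cases hk : (E.position k : ℕ) + 1 < D.word.length
      · have : E.position (k + 1) = ⟨E.position k + 1, hk⟩ :=
          (E.position_eq_iff _ _).2 (by
            push_cast
            exact (E.position_modEq k).symm.add_right 1)
        rw [this]
        rfl
      -- At the end of the word the next arc is the last one, which the closing relation identifies
      -- with the arc `0`.
      · have hk' : (E.position k : ℕ) + 1 = D.word.length := by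
          have := (E.position k).2
          omega
        have h3 : E.position (k + 1) = ⟨0, E.length_pos⟩ :=
          (E.position_eq_iff _ _).2 (by
            refine ((E.position_modEq k).symm.add_right 1).trans ?_
            have : ((E.position k : ℕ) : ℤ) + 1 = D.word.length := by exact_mod_cast hk'
            rw [this]
            exact Int.modEq_iff_dvd.2 (by simp))
        have h4 : (E.position k).succ = Fin.last _ := Fin.ext (by simpa using hk')
        rw [h3, h4, h2]
        rfl
    refine ⟨fun k => ?_, fun k => ?_⟩
    · have : E.position (k + D.word.length) = E.position k :=
        (E.position_eq_iff _ _).2 (by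
          refine Int.ModEq.trans ?_ (E.position_modEq k).symm
          simp)
      beta_reduce
      rw [this]
    · have hp := E.position_modEq k
      beta_reduce
      rw [hnext, h1, E.kind_word_get, E.sign_word_get]
      have e1 := periodic_of_modEq (E.coeff_add_length a) hp
      have e2 := periodic_of_modEq (E.overCoeff_add_length a) hp
      rw [← e1, ← e2]
      by_cases hk : D.kind (E.param (E.position k)) = .under
      · have hk' : (D.word.get (E.position k)).kind = .under := by rw [E.kind_word_get, hk]
        have : overPassage D.word (E.position k) = E.position (E.mate k) :=
          ((E.position_eq_iff _ _).2 (Int.ModEq.trans (E.mate_of_modEq _ _ hp.symm)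
            (E.overPassage_modEq hk').symm)).symm
        rw [this]
        rfl
      · have := E.overCoeff_eq_zero a hk
        rw [this, zero_smul]
        unfold overCoeff at this
        rw [this, zero_smul]
        rfl
  invFun_mem V _ _ x hx := by
    rw [mem_solutions_alexanderMatrix a E.isMatched]
    refine ⟨fun k => ?_, ?_⟩
    · rw [E.kind_word_get, E.sign_word_get]
      have h := hx.2 k
      simp only [Fin.val_succ, Fin.val_castSucc]
      push_cast
      rw [h]
      by_cases hk : D.kind (E.param k) = .under
      · have hk' : (D.word.get k).kind = .under := by rw [E.kind_word_get, hk]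
        rw [← periodic_of_modEq hx.1 (E.overPassage_modEq hk')]
        rfl
      · have := E.overCoeff_eq_zero a hk
        rw [this, zero_smul]
        unfold overCoeff at this
        rw [this, zero_smul]
        rfl
    · have := hx.1 0
      simpa using this
  left_inv V _ _ c hc := by
    obtain ⟨h1, h2⟩ := (mem_solutions_alexanderMatrix a E.isMatched c).1 hc
    ext i
    refine Fin.lastCases ?_ (fun i => ?_) i
    · have h3 : E.position ((Fin.last D.word.length : ℕ) : ℤ) = ⟨0, E.length_pos⟩ :=
        (E.position_eq_iff _ _).2 (by simp)
      beta_reduce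
      rw [h3, h2]
      rfl
    · have h3 : E.position ((i.castSucc : ℕ) : ℤ) = i := (E.position_eq_iff _ _).2 (by simp)
      beta_reduce
      rw [h3]
  right_inv V _ _ x hx := by
    ext k
    exact periodic_of_modEq hx.1 (E.position_modEq k)

/-- The matrix of the system of a diagram, divided by a rotation by `L` passages. -/
noncomputable def quotientMatrix (L : ℕ) : Matrix (ZMod L) (ZMod L) R :=
  shiftMatrix (fun j => ((j.val + 1 : ℤ) : ZMod L)) (fun j => ((E.mate j.val : ℤ) : ZMod L))
    (fun j => E.coeff a j.val) (fun j => E.overCoeff a j.val)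

/-- The enumeration is invariant under a shift by `L`. -/
structure IsInvariant (L : ℕ) : Prop where
  kind_add : ∀ k, D.kind (E.param (k + L)) = D.kind (E.param k)
  side_add : ∀ k, D.side (E.param (k + L)) = D.side (E.param k)
  mate_add : ∀ k, E.mate (k + L) ≡ E.mate k + L [ZMOD D.word.length]

variable {E}

theorem IsInvariant.mate_add_mul {L : ℕ} (h : E.IsInvariant L) (k : ℤ) (c : ℕ) :
    E.mate (k + L * c) ≡ E.mate k + L * c [ZMOD D.word.length] := by
  induction c with
  | zero => simp
  | succ c ih =>
    have h1 := h.mate_add (k + L * c)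
    have h2 := ih.add_right (L : ℤ)
    have h3 := h1.trans h2
    have e1 : k + (L : ℤ) * ((c + 1 : ℕ) : ℤ) = k + L * c + L := by push_cast; ring
    have e2 : E.mate k + (L : ℤ) * ((c + 1 : ℕ) : ℤ) = E.mate k + L * c + L := by push_cast; ring
    rw [e1, e2]
    exact h3

theorem IsInvariant.coeff_add {L : ℕ} (h : E.IsInvariant L) (k : ℤ) :
    E.coeff a (k + L) = E.coeff a k := by
  rw [coeff, coeff, h.kind_add, passageSign_congr (h.kind_add k) (h.side_add k)]

theorem IsInvariant.overCoeff_add {L : ℕ} (h : E.IsInvariant L) (k : ℤ) :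
    E.overCoeff a (k + L) = E.overCoeff a k := by
  rw [overCoeff, overCoeff, h.kind_add, passageSign_congr (h.kind_add k) (h.side_add k)]

/-- The coefficients have period `L`, and the successor and the mate commute with translation by
`L`, so the recurrence on residues modulo `n * L` is a cyclic cover of the one modulo `L`. Taking `n
= 1` also yields the identification of the Alexander determinant with that of a plain recurrence. -/
theorem IsInvariant.associated_det [IsDomain R] {p r n L : ℕ} [Fact p.Prime] [CharP R p]
    [NeZero n] [NeZero L] (hn : n = p ^ r) (hL : D.word.length = n * L) (h : E.IsInvariant L) :
    Associated (alexanderMatrix a D.word).det ((E.quotientMatrix a L).det ^ n) := by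
  have e0 : ∀ N, N = D.word.length → SolEquiv (alexanderMatrix a D.word).solutions
      (recurrentSequences N (E.coeff a) (E.overCoeff a) E.mate) := by
    rintro _ rfl
    exact E.alexanderSequences a
  have e1 := e0 _ hL.symm
  have e2 := e1.trans (recurrentSequencesSolEquiv (L := L) (n := n)
    (by rw [← hL]; exact E.coeff_add_length a) (by rw [← hL]; exact E.overCoeff_add_length a)
    (by rw [← hL]; exact E.mate_of_modEq))
  have e3 := e2.associated_det
  -- The entries of the cover are compared with those over the sheet `0`, whose representatives are
  -- `0, …, L - 1`.
  rw [show E.quotientMatrix a L = shiftMatrix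
    (fun j => (cyclicClass L n (cyclicRep (j, (0 : ZMod n)) + 1)).1)
    (fun j => (cyclicClass L n (E.mate (cyclicRep (j, (0 : ZMod n))))).1)
    (fun j => E.coeff a (cyclicRep (j, (0 : ZMod n))))
    (fun j => E.overCoeff a (cyclicRep (j, (0 : ZMod n)))) by
      simp [quotientMatrix, cyclicClass, cyclicRep], ← det_shiftMatrix_prod hn
      (fun j => cyclicClass L n (cyclicRep (j, (0 : ZMod n)) + 1))
      (fun j => cyclicClass L n (E.mate (cyclicRep (j, (0 : ZMod n)))))]
  convert e3 using 3
  · funext ⟨j, b⟩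
    rw [cyclicRep_mk j b, add_right_comm, cyclicClass_add_mul]
    simp
  · funext ⟨j, b⟩
    have : E.mate (cyclicRep (j, b)) ≡ E.mate (cyclicRep (j, (0 : ZMod n))) + L * (b.val : ℤ)
        [ZMOD (n * L : ℕ)] := by
      rw [cyclicRep_mk j b, ← hL]
      exact h.mate_add_mul _ _
    rw [cyclicClass_eq_of_modEq this, cyclicClass_add_mul]
    simp
  · funext ⟨j, b⟩
    refine periodic_of_modEq (N := L) (h.coeff_add a) ?_
    rw [cyclicRep_mk j b]
    exact Int.modEq_iff_dvd.2 ⟨b.val, by ring⟩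
  · funext ⟨j, b⟩
    refine periodic_of_modEq (N := L) (h.overCoeff_add a) ?_
    rw [cyclicRep_mk j b]
    exact Int.modEq_iff_dvd.2 ⟨b.val, by ring⟩

end VirtualKnotDiagram.Enumeration

/-! ### Two linear factors of the quotient determinant -/

section DetDivisibility

variable {R ι : Type} [CommRing R] [Fintype ι] [DecidableEq ι]

/-- Multiplication by the adjugate shows that `d` divides `M.det * v i`; a single unit entry of `v`
suffices. -/
theorem Matrix.dvd_det_of_mulVec {M : Matrix ι ι R} {v : ι → R} {d : R}
    (h : ∀ i, d ∣ ∑ j, M i j * v j) {i : ι} (hv : IsUnit (v i)) : d ∣ M.det := by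
  have h1 : M.det * v i = ∑ k, M.adjugate i k * ∑ j, M k j * v j := by
    have h2 : M.adjugate.mulVec (M.mulVec v) = M.det • v := by
      rw [Matrix.mulVec_mulVec, Matrix.adjugate_mul, Matrix.smul_mulVec, Matrix.one_mulVec]
    exact (congrFun h2 i).symm
  rw [← hv.dvd_mul_right, h1]
  exact Finset.dvd_sum fun k _ => (h k).mul_left _

theorem Matrix.dvd_det_of_vecMul {M : Matrix ι ι R} {v : ι → R} {d : R}
    (h : ∀ j, d ∣ ∑ i, v i * M i j) {i : ι} (hv : IsUnit (v i)) : d ∣ M.det := by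
  rw [← Matrix.det_transpose]
  refine Matrix.dvd_det_of_mulVec (v := v) (fun j => ?_) hv
  simpa [mul_comm] using h j

end DetDivisibility

namespace VirtualKnotDiagram.Enumeration

variable {D : VirtualKnotDiagram} {E : D.Enumeration} {R : Type} [CommRing R] (a : Weights R)
  {L n : ℕ}

/-- The change of the index over `L` passages is the same everywhere, and `n` times this change is
the change over a full turn, which is zero. So the index descends to the quotient. -/
theorem IsInvariant.index_add (h : E.IsInvariant L) (hn : n ≠ 0) (hL : D.word.length = n * L)
    (k : ℤ) : E.index (k + L) = E.index k := by
  have hstep : ∀ k, E.index (k + 1 + L) - E.index (k + 1) = E.index (k + L) - E.index k := by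
    intro k
    rw [add_right_comm, index_add_one, index_add_one, h.side_add]
    ring
  have hconst : ∀ k, E.index (k + L) - E.index k = E.index L := by
    intro k
    induction k with
    | zero => simp [index_zero]
    | succ i ih => rw [hstep, ih]
    | pred i ih => rw [← hstep, sub_add_cancel, ih]
  have hmul : ∀ c : ℕ, E.index (c * L) = c * E.index L := by
    intro c
    induction c with
    | zero => simp [index_zero]
    | succ c ih =>
      have := hconst (c * L)
      push_cast
      rw [add_mul, one_mul, add_mul, one_mul, ← ih]
      linarith
  have h1 := hmul n
  have h2 := E.index_add_length 0
  rw [zero_add, hL, index_zero, Nat.cast_mul, h1] at h2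
  have h3 := (mul_eq_zero.1 h2).resolve_left (by exact_mod_cast hn)
  have := hconst k
  linarith

theorem IsInvariant.mate_of_modEq (h : E.IsInvariant L) (hL : D.word.length = n * L) {k l : ℤ}
    (hkl : k ≡ l [ZMOD L]) : E.mate k ≡ E.mate l [ZMOD L] := by
  have : ((E.mate k : ℤ) : ZMod L) = ((E.mate l : ℤ) : ZMod L) := by
    refine periodic_of_modEq (N := L) (x := fun k => ((E.mate k : ℤ) : ZMod L)) (fun k => ?_) hkl
    have h1 : E.mate (k + L) ≡ E.mate k + L [ZMOD L] :=
      (h.mate_add k).of_dvd (by rw [hL]; exact ⟨n, by push_cast; ring⟩)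
    simpa using (ZMod.intCast_eq_intCast_iff _ _ _).2 h1
  exact (ZMod.intCast_eq_intCast_iff _ _ _).1 this

theorem mate_mate_modEq (E : D.Enumeration) (hL : D.word.length = n * L) (k : ℤ) :
    E.mate (E.mate k) ≡ k [ZMOD L] :=
  (E.mate_mate k).of_dvd (by rw [hL]; exact ⟨n, by push_cast; ring⟩)

/-- The kinds of passages with their sides and signs. -/
theorem kind_cases (E : D.Enumeration) (k : ℤ) :
    (D.kind (E.param k) = .over ∧ D.passageSign (E.param k) = D.side (E.param k) ∧
      D.kind (E.param (E.mate k)) = .under ∧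
      D.passageSign (E.param (E.mate k)) = D.side (E.param k)) ∨
    (D.kind (E.param k) = .under ∧ D.passageSign (E.param k) = -D.side (E.param k) ∧
      D.kind (E.param (E.mate k)) = .over) ∨
    (D.kind (E.param k) = .virt ∧ D.passageSign (E.param k) = D.side (E.param k) ∧
      D.kind (E.param (E.mate k)) = .virt) := by
  have h1 := E.kind_mate k
  have h2 := side_meets (E.meets_mate k)
  rcases hk : D.kind (E.param k) <;> rw [hk] at h1 <;>
    simp [passageSign, hk, h1, PassageKind.opp, h2]

/-- If `s = q`, an over-step changes `q ^ (-index)` exactly as a virtual step does. At an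
under-passage the over-arc has the index of the outgoing arc, and the equation reduces to `(s * t) ^
e = (q * t) ^ e`. -/
theorem dvd_row (E : D.Enumeration) (k : ℤ) : (a.q - a.s : R) ∣
    ((a.q ^ (-E.index (k + 1)) : Rˣ) : R) - E.coeff a k * ((a.q ^ (-E.index k) : Rˣ) : R) -
      E.overCoeff a k * ((a.q ^ (-E.index (E.mate k)) : Rˣ) : R) := by
  rw [index_mate, index_add_one]
  set w : Rˣ := a.q ^ (-E.index k) with hw
  have hq : (a.q : R) * ((a.q⁻¹ : Rˣ) : R) = 1 := by simp
  have hs : (a.s : R) * ((a.s⁻¹ : Rˣ) : R) = 1 := by simp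
  have ht : (a.t : R) * ((a.t⁻¹ : Rˣ) : R) = 1 := by simp
  have h1 : ((a.q ^ (-(E.index k - 1)) : Rˣ) : R) = w * a.q := by
    rw [hw, ← Units.val_mul, ← zpow_add_one]; congr 2; ring
  have h2 : ((a.q ^ (-(E.index k - -1)) : Rˣ) : R) = w * ((a.q⁻¹ : Rˣ) : R) := by
    rw [hw, ← Units.val_mul, ← zpow_sub_one]; congr 2; ring
  unfold coeff overCoeff
  rcases E.kind_cases k with ⟨e1, e2, -⟩ | ⟨e1, e2, -⟩ | ⟨e1, e2, -⟩ <;>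
    rcases Int.units_eq_one_or (D.side (E.param k)) with e3 | e3 <;>
    simp only [e1, e2, e3, Units.val_one, Units.val_neg, neg_neg, Weights.coeff_over_one,
      Weights.coeff_over_neg_one, Weights.coeff_under_one, Weights.coeff_under_neg_one,
      Weights.coeff_virt_one, Weights.coeff_virt_neg_one, Weights.overCoeff_over,
      Weights.overCoeff_virt, Weights.overCoeff_under_one, Weights.overCoeff_under_neg_one, h1, h2]
  · exact ⟨w, by ring⟩
  · exact ⟨-w * ((a.q⁻¹ : Rˣ) : R) * ((a.s⁻¹ : Rˣ) : R), by grind⟩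
  · exact ⟨w * ((a.s⁻¹ : Rˣ) : R) * ((a.t⁻¹ : Rˣ) : R), by grind⟩
  · exact ⟨-w * a.t * ((a.q⁻¹ : Rˣ) : R), by grind⟩
  · exact ⟨0, by ring⟩
  · exact ⟨0, by ring⟩

/-- The transposed statement. The arc `k` occurs in the equations of the previous passage, of the
passage `k`, and, if that is an over-passage, of its mate. With the weights `q ^ index` of the
outgoing arcs these contributions cancel when `t * q = 1`. -/
theorem dvd_column (E : D.Enumeration) (k : ℤ) : (1 - a.t * a.q : R) ∣
    ((a.q ^ E.index k : Rˣ) : R) - ((a.q ^ E.index (k + 1) : Rˣ) : R) * E.coeff a k -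
      ((a.q ^ E.index k : Rˣ) : R) * E.overCoeff a (E.mate k) := by
  rw [index_add_one]
  set w : Rˣ := a.q ^ E.index k with hw
  have hq : (a.q : R) * ((a.q⁻¹ : Rˣ) : R) = 1 := by simp
  have hs : (a.s : R) * ((a.s⁻¹ : Rˣ) : R) = 1 := by simp
  have ht : (a.t : R) * ((a.t⁻¹ : Rˣ) : R) = 1 := by simp
  have h1 : ((a.q ^ (E.index k - -1) : Rˣ) : R) = w * a.q := by
    rw [hw, ← Units.val_mul, ← zpow_add_one]; congr 2
  have h2 : ((a.q ^ (E.index k - 1) : Rˣ) : R) = w * ((a.q⁻¹ : Rˣ) : R) := by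
    rw [hw, ← Units.val_mul, ← zpow_sub_one]
  unfold coeff overCoeff
  rcases E.kind_cases k with ⟨e1, e2, e4, e5⟩ | ⟨e1, e2, e4⟩ | ⟨e1, e2, e4⟩ <;>
    rcases Int.units_eq_one_or (D.side (E.param k)) with e3 | e3 <;>
    simp only [e1, e2, e3, e4, Units.val_one, Units.val_neg, neg_neg, Weights.coeff_over_one,
      Weights.coeff_over_neg_one, Weights.coeff_under_one, Weights.coeff_under_neg_one,
      Weights.coeff_virt_one, Weights.coeff_virt_neg_one, Weights.overCoeff_over,
      Weights.overCoeff_virt, h1, h2]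
  · rw [e5, e3, Weights.overCoeff_under_one]
    exact ⟨-w * a.s * ((a.q⁻¹ : Rˣ) : R), by grind⟩
  · rw [e5, e3, Weights.overCoeff_under_neg_one]
    exact ⟨w * ((a.s⁻¹ : Rˣ) : R) * ((a.t⁻¹ : Rˣ) : R), by grind⟩
  · exact ⟨-w * ((a.t⁻¹ : Rˣ) : R) * ((a.q⁻¹ : Rˣ) : R), by grind⟩
  · exact ⟨w, by ring⟩
  · exact ⟨0, by grind⟩
  · exact ⟨0, by grind⟩

theorem val_intCast_modEq [NeZero L] (k : ℤ) : (((k : ZMod L).val : ℕ) : ℤ) ≡ k [ZMOD L] := by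
  rw [ZMod.val_intCast]
  exact Int.mod_modEq _ _

theorem IsInvariant.sub_dvd_det [NeZero L] (h : E.IsInvariant L) (hn : n ≠ 0)
    (hL : D.word.length = n * L) : (a.q - a.s : R) ∣ (E.quotientMatrix a L).det := by
  have hx : ∀ k l, k ≡ l [ZMOD L] → E.index k = E.index l := fun k l hkl =>
    periodic_of_modEq (h.index_add hn hL) hkl
  refine Matrix.dvd_det_of_mulVec
    (v := fun j : ZMod L => ((a.q ^ (-E.index j.val) : Rˣ) : R)) (fun j => ?_) (i := 0)
    (Units.isUnit _)
  have := sum_shiftMatrix (fun j : ZMod L => ((j.val + 1 : ℤ) : ZMod L))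
    (fun j => ((E.mate j.val : ℤ) : ZMod L)) (fun j => E.coeff a j.val)
    (fun j => E.overCoeff a j.val) (fun j : ZMod L => ((a.q ^ (-E.index j.val) : Rˣ) : R)) j
  simp only [smul_eq_mul] at this
  rw [quotientMatrix, this, hx _ _ (val_intCast_modEq _), hx _ _ (val_intCast_modEq _)]
  exact E.dvd_row a _

theorem IsInvariant.one_sub_dvd_det [NeZero L] (h : E.IsInvariant L) (hn : n ≠ 0)
    (hL : D.word.length = n * L) : (1 - a.t * a.q : R) ∣ (E.quotientMatrix a L).det := by
  have hx : ∀ k l, k ≡ l [ZMOD L] → E.index k = E.index l := fun k l hkl =>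
    periodic_of_modEq (h.index_add hn hL) hkl
  refine Matrix.dvd_det_of_vecMul
    (v := fun j : ZMod L => ((a.q ^ E.index (j.val + 1) : Rˣ) : R)) (fun j => ?_) (i := 0)
    (Units.isUnit _)
  have h1 : ∀ i : ZMod L, ((i.val + 1 : ℤ) : ZMod L) = j ↔ i = j - 1 := by
    intro i
    push_cast
    rw [ZMod.natCast_zmod_val, eq_sub_iff_add_eq]
  -- The mate is an involution modulo `L`, so the only equation that uses the arc `j` as a mate is
  -- that of the mate of `j`.
  have h2 : ∀ i : ZMod L, ((E.mate i.val : ℤ) : ZMod L) = j ↔ i = ((E.mate j.val : ℤ) : ZMod L) := by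
    intro i
    have e1 : ∀ i : ZMod L, (((i.val : ℕ) : ℤ) : ZMod L) = i := fun i => by simp
    constructor
    · intro hi
      have h3 : E.mate i.val ≡ j.val [ZMOD L] :=
        (ZMod.intCast_eq_intCast_iff _ _ _).1 (by rw [hi, e1])
      have h4 := (h.mate_of_modEq hL h3).symm.trans (E.mate_mate_modEq hL _)
      rw [← e1 i]
      exact ((ZMod.intCast_eq_intCast_iff _ _ _).2 h4).symm
    · rintro rfl
      have h4 := (h.mate_of_modEq hL (val_intCast_modEq (E.mate j.val))).trans
        (E.mate_mate_modEq hL _)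
      have := (ZMod.intCast_eq_intCast_iff _ _ _).2 h4
      rw [this, e1]
  have h5 : E.index (((j - 1).val : ℤ) + 1) = E.index j.val := by
    refine hx _ _ ((ZMod.intCast_eq_intCast_iff _ _ _).1 ?_)
    simp
  -- The outgoing arc of the mate has the index of the arc entering `j`, by `index_mate` applied at
  -- the mate.
  have h6 : E.index ((((E.mate j.val : ℤ) : ZMod L).val : ℤ) + 1) = E.index j.val := by
    rw [← hx _ _ (E.mate_mate_modEq hL j.val), index_mate]
    exact hx _ _ ((val_intCast_modEq _).add_right 1)
  have h7 : E.overCoeff a (((E.mate j.val : ℤ) : ZMod L).val : ℤ) =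
      E.overCoeff a (E.mate j.val) :=
    periodic_of_modEq (N := L) (h.overCoeff_add a) (val_intCast_modEq _)
  have h8 : ∑ i : ZMod L, ((a.q ^ E.index (i.val + 1) : Rˣ) : R) * E.quotientMatrix a L i j =
      ((a.q ^ E.index j.val : Rˣ) : R) -
        ((a.q ^ E.index (j.val + 1) : Rˣ) : R) * E.coeff a j.val -
      ((a.q ^ E.index j.val : Rˣ) : R) * E.overCoeff a (E.mate j.val) := by
    unfold quotientMatrix shiftMatrix
    simp only [h1, h2, mul_sub, Finset.sum_sub_distrib, mul_ite, mul_one, mul_zero,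
      Finset.sum_ite_eq', Finset.mem_univ, if_true, h5, h6, h7]
  rw [h8]
  exact E.dvd_column a _

end VirtualKnotDiagram.Enumeration

/-! ### The action of a rotation on the numbered passages -/

section Rotation

open Filter Topology

namespace VirtualKnotDiagram

variable {D : VirtualKnotDiagram} {φ : ℝ → ℝ} {o : ℂ}

/-- A rotation maps the tangent vector at a point to a positive multiple of the tangent vector at
the image. -/
theorem exists_pos_mul_deriv (hφ : Continuous φ) (hm : StrictMono φ) (ho : o ≠ 0)
    (h : ∀ x, D.curve (φ x) = o * D.curve x) (x : ℝ) :
    ∃ c : ℝ, 0 < c ∧ o * deriv D.curve x = c * deriv D.curve (φ x) := by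
  have hd : Differentiable ℝ D.curve := D.contDiff_one.differentiable one_ne_zero
  have h1 : Tendsto (fun y => o * slope D.curve x y) (𝓝[≠] x) (𝓝 (o * deriv D.curve x)) :=
    (hasDerivAt_iff_tendsto_slope.1 (hd x).hasDerivAt).const_mul o
  have hφt : Tendsto φ (𝓝[≠] x) (𝓝[≠] (φ x)) :=
    tendsto_nhdsWithin_of_tendsto_nhds_of_eventually_within _
      (hφ.continuousAt.tendsto.mono_left nhdsWithin_le_nhds)
      (by filter_upwards [self_mem_nhdsWithin] with y hy using hm.injective.ne hy)
  have h2 : Tendsto (fun y => slope D.curve (φ x) (φ y)) (𝓝[≠] x) (𝓝 (deriv D.curve (φ x))) :=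
    (hasDerivAt_iff_tendsto_slope.1 (hd (φ x)).hasDerivAt).comp hφt
  -- The reparametrization `φ` is only continuous, so the chain rule does not apply. Corresponding
  -- difference quotients are positive multiples of each other, and the factor is recovered in the
  -- limit as a quotient of norms.
  set c : ℝ := ‖o * deriv D.curve x‖ / ‖deriv D.curve (φ x)‖ with hc
  have hv := D.immersed (φ x)
  have hrel : ∀ y, y ≠ x → ∃ r : ℝ, 0 < r ∧
      o * slope D.curve x y = r * slope D.curve (φ x) (φ y) := by
    intro y hy
    refine ⟨(φ y - φ x) / (y - x), ?_, ?_⟩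
    · rcases lt_or_gt_of_ne hy with h3 | h3
      · exact div_pos_of_neg_of_neg (sub_neg.2 (hm h3)) (sub_neg.2 h3)
      · exact div_pos (sub_pos.2 (hm h3)) (sub_pos.2 h3)
    · have h3 : ((y - x : ℝ) : ℂ) ≠ 0 := by exact_mod_cast sub_ne_zero.2 hy
      have h4 : ((φ y - φ x : ℝ) : ℂ) ≠ 0 := by exact_mod_cast sub_ne_zero.2 (hm.injective.ne hy)
      rw [slope_def_module, slope_def_module, h, h, Complex.real_smul, Complex.real_smul,
        Complex.ofReal_inv, Complex.ofReal_inv, Complex.ofReal_div]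
      field_simp
  refine ⟨c, div_pos (norm_pos_iff.2 (mul_ne_zero ho (D.immersed x))) (norm_pos_iff.2 hv), ?_⟩
  have h3 : Tendsto (fun y => ((‖o * slope D.curve x y‖ / ‖slope D.curve (φ x) (φ y)‖ : ℝ) : ℂ) *
      slope D.curve (φ x) (φ y)) (𝓝[≠] x) (𝓝 (c * deriv D.curve (φ x))) :=
    ((Complex.continuous_ofReal.tendsto _).comp
      (h1.norm.div h2.norm (norm_ne_zero_iff.2 hv))).mul h2
  refine tendsto_nhds_unique (h1.congr' ?_) h3
  filter_upwards [self_mem_nhdsWithin, h2.eventually_ne hv] with y hy hy'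
  obtain ⟨r, hr, hr'⟩ := hrel y hy
  rw [hr', norm_mul, Complex.norm_real, Real.norm_of_nonneg hr.le,
    mul_div_assoc, div_self (norm_ne_zero_iff.2 hy'), mul_one]

theorem meets_rotation_iff (hm : StrictMono φ) (h1 : ∀ x, φ (x + 1) = φ x + 1) (ho : o ≠ 0)
    (h : ∀ x, D.curve (φ x) = o * D.curve x) {x y : ℝ} :
    Meets D.curve (φ x) (φ y) ↔ Meets D.curve x y := by
  have hn : ∀ n : ℤ, φ (x + n) = φ x + n := by
    intro n
    induction n with
    | zero => simp
    | succ i ih => push_cast at ih ⊢; rw [← add_assoc, h1, ih]; ring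
    | pred i ih =>
      have := h1 (x + ((-i - 1 : ℤ) : ℝ))
      rw [show x + ((-i - 1 : ℤ) : ℝ) + 1 = x + ((-i : ℤ) : ℝ) by push_cast; ring, ih] at this
      push_cast at this ⊢
      linarith
  unfold Meets
  rw [h, h]
  refine and_congr ⟨mul_left_cancel₀ ho, congrArg _⟩ (forall_congr' fun n => ?_)
  rw [← hn n, hm.injective.ne_iff]

/-- The determinant of the tangent vectors is multiplied by positive factors only: the squared norm
of `o` and the two reparametrization factors. -/
theorem side_rotation (hφ : Continuous φ) (hm : StrictMono φ) (h1 : ∀ x, φ (x + 1) = φ x + 1)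
    (ho : o ≠ 0) (h : ∀ x, D.curve (φ x) = o * D.curve x) {x y : ℝ}
    (hxy : Meets D.curve x y) : D.side (φ x) = D.side x := by
  rw [side_eq hxy, side_eq ((meets_rotation_iff hm h1 ho h).2 hxy)]
  obtain ⟨c, hc, hcx⟩ := exists_pos_mul_deriv hφ hm ho h x
  obtain ⟨e, he, hey⟩ := exists_pos_mul_deriv hφ hm ho h y
  have k1 : planeDet (o * deriv D.curve x) (o * deriv D.curve y) =
      Complex.normSq o * planeDet (deriv D.curve x) (deriv D.curve y) := by
    simp only [planeDet, Complex.mul_re, Complex.mul_im, Complex.normSq_apply]; ring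
  have k2 : planeDet (c * deriv D.curve (φ x)) (e * deriv D.curve (φ y)) =
      c * e * planeDet (deriv D.curve (φ x)) (deriv D.curve (φ y)) := by
    simp only [planeDet, Complex.mul_re, Complex.mul_im, Complex.ofReal_re, Complex.ofReal_im]
    ring
  rw [hcx, hey, k2] at k1
  have h2 : (0 < planeDet (deriv D.curve (φ x)) (deriv D.curve (φ y))) ↔
      0 < planeDet (deriv D.curve x) (deriv D.curve y) := by
    rw [← mul_pos_iff_of_pos_left (mul_pos hc he), k1,
      mul_pos_iff_of_pos_left (Complex.normSq_pos.2 ho)]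
  simp only [h2]

theorem exists_add_of_strictMono_surjective {f : ℤ → ℤ} (hf : StrictMono f)
    (hs : Function.Surjective f) : ∃ d, ∀ k, f k = k + d := by
  have h1 : ∀ k, f (k + 1) = f k + 1 := by
    intro k
    obtain ⟨j, hj⟩ := hs (f k + 1)
    have h2 : k < j := hf.lt_iff_lt.1 (by omega)
    have h3 := hf.monotone (show k + 1 ≤ j by omega)
    have h4 := hf (show k < k + 1 by omega)
    omega
  refine ⟨f 0, fun k => ?_⟩
  induction k with
  | zero => simp
  | succ i ih => rw [h1, ih]; ring
  | pred i ih =>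
    have := h1 (-i - 1)
    rw [sub_add_cancel, ih] at this
    linarith

theorem continuous_iterate_surjective (hφ : Continuous φ) (h1 : ∀ x, φ (x + 1) = φ x + 1)
    (hm : StrictMono φ) : Function.Surjective φ := by
  have hn : ∀ n : ℕ, φ n = φ 0 + n ∧ φ (-n) = φ 0 - n := by
    intro n
    induction n with
    | zero => simp
    | succ n ih =>
      refine ⟨by push_cast; rw [h1, ih.1]; ring, ?_⟩
      have := h1 (-((n + 1 : ℕ) : ℝ))
      rw [show -((n + 1 : ℕ) : ℝ) + 1 = -n by push_cast; ring, ih.2] at this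
      push_cast at this ⊢
      linarith
  refine hφ.surjective ?_ ?_
  · refine tendsto_atTop_atTop_of_monotone hm.monotone fun b => ?_
    obtain ⟨n, hn'⟩ := exists_nat_ge (b - φ 0)
    exact ⟨n, by rw [(hn n).1]; linarith⟩
  · refine tendsto_atBot_atBot_of_monotone hm.monotone fun b => ?_
    obtain ⟨n, hn'⟩ := exists_nat_ge (φ 0 - b)
    exact ⟨-n, by rw [(hn n).2]; linarith⟩

/-- Bézout: the greatest common divisor is an integral combination of the two periods. -/
theorem periodic_gcd {V : Type} {f : ℤ → V} {d : ℤ} {N : ℕ} (hd : ∀ k, f (k + d) = f k)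
    (hN : ∀ k, f (k + N) = f k) (k : ℤ) : f (k + (d.gcd N : ℕ)) = f k := by
  have h1 : Function.Periodic f d := hd
  have h2 : Function.Periodic f N := hN
  have h3 := (h1.int_mul (Int.gcdA d N)).add_period (h2.int_mul (Int.gcdB d N))
  rw [Int.gcd_eq_gcd_ab]
  have := h3 k
  rwa [mul_comm, mul_comm _ (N : ℤ)] at this

/-- The hypotheses say that `d` has order `n` in the cyclic group of order `N`, and this order is `N
/ gcd`. -/
theorem eq_mul_gcd {d : ℤ} {n N : ℕ} (hN : N ≠ 0) (h1 : (N : ℤ) ∣ n * d)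
    (h2 : ∀ m : ℕ, (N : ℤ) ∣ m * d → n ∣ m) : N = n * d.gcd N := by
  have h3 : addOrderOf (d : ZMod N) = n := by
    refine Nat.dvd_antisymm ?_ (h2 _ ?_)
    · rw [addOrderOf_dvd_iff_nsmul_eq_zero, nsmul_eq_mul]
      exact_mod_cast (ZMod.intCast_zmod_eq_zero_iff_dvd _ N).2 h1
    · rw [← ZMod.intCast_zmod_eq_zero_iff_dvd]
      have := addOrderOf_nsmul_eq_zero (d : ZMod N)
      rw [nsmul_eq_mul] at this
      exact_mod_cast this
  have : NeZero N := ⟨hN⟩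
  obtain ⟨g, hg1, hg2⟩ : ∃ g : ℕ, g = d.gcd N ∧ g ≠ 0 :=
    ⟨_, rfl, by simp [Int.gcd_eq_zero_iff, hN]⟩
  rw [← hg1]
  obtain ⟨d', hd'⟩ : (g : ℤ) ∣ d := by rw [hg1]; exact Int.gcd_dvd_left _ _
  obtain ⟨N', hN'⟩ : g ∣ N := by
    have : (g : ℤ) ∣ N := by rw [hg1]; exact Int.gcd_dvd_right _ _
    exact_mod_cast this
  have hg0 : (g : ℤ) ≠ 0 := by exact_mod_cast hg2
  have hcop : IsCoprime (N' : ℤ) d' := by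
    rw [Int.isCoprime_iff_gcd_eq_one]
    have h4 : (g : ℕ) = g * Int.gcd d' N' := by
      conv_lhs => rw [hg1, hd', hN']
      push_cast
      rw [Int.gcd_mul_left]; simp
    rw [Int.gcd_comm]
    exact (Nat.eq_of_mul_eq_mul_left (Nat.pos_of_ne_zero hg2) (by rw [← h4, mul_one]))
  have h5 : N' ∣ n := by
    rw [hd', hN'] at h1
    push_cast at h1
    rw [show (n : ℤ) * (g * d') = g * (n * d') by ring] at h1
    exact_mod_cast hcop.dvd_of_dvd_mul_right ((mul_dvd_mul_iff_left hg0).1 h1)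
  have h6 : n ∣ N' := h2 N' ⟨d', by rw [hN', hd']; push_cast; ring⟩
  rw [hN', Nat.dvd_antisymm h5 h6, mul_comm]

theorem Enumeration.isInvariant_length (E : D.Enumeration) : E.IsInvariant D.word.length where
  kind_add k := by simpa using E.kind_add_mul k 1
  side_add k := by simpa using E.side_add_mul k 1
  mate_add k := (E.mate_of_modEq _ k (by simp)).trans (by simp)

/-- A periodic diagram has an enumeration that is invariant under a shift. -/
theorem IsPeriodic.exists_isInvariant {n : ℕ} (hn : n ≠ 0) (h : D.IsPeriodic n)
    (E : D.Enumeration) : ∃ L : ℕ, D.word.length = n * L ∧ E.IsInvariant L := by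
  obtain ⟨h0, φ, hφ, hm, h1, hrot, hkind⟩ := h
  set o : ℂ := Complex.exp (2 * Real.pi * Complex.I / n) with ho'
  have hprim : IsPrimitiveRoot o n := Complex.isPrimitiveRoot_exp n hn
  have ho : o ≠ 0 := Complex.exp_ne_zero _
  have hmeets : ∀ {x y}, Meets D.curve (φ x) (φ y) ↔ Meets D.curve x y :=
    meets_rotation_iff hm h1 ho hrot
  have hsurj := continuous_iterate_surjective hφ h1 hm
  have hex : ∀ k, ∃ l, E.param l = φ (E.param k) := fun k =>
    E.surjective _ ⟨_, hmeets.2 (E.meets_mate k)⟩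
  choose ψ hψ using hex
  -- The rotation permutes the passages and preserves their order on the line; an increasing
  -- bijection of the integers is a translation.
  obtain ⟨d, hd⟩ := exists_add_of_strictMono_surjective (f := ψ)
    (fun k l hkl => E.strictMono.lt_iff_lt.1 (by rw [hψ, hψ]; exact hm (E.strictMono hkl)))
    (fun l => by
      obtain ⟨x, hx⟩ := hsurj (E.param l)
      obtain ⟨y, hy⟩ := hsurj (E.param (E.mate l))
      obtain ⟨k, rfl⟩ := E.surjective x ⟨y, hmeets.1 (by rw [hx, hy]; exact E.meets_mate l)⟩
      exact ⟨k, E.strictMono.injective (by rw [hψ, hx])⟩)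
  have hφd : ∀ k, φ (E.param k) = E.param (k + d) := fun k => by rw [← hψ, hd]
  have hiter : ∀ (m : ℕ) k, φ^[m] (E.param k) = E.param (k + m * d) := by
    intro m
    induction m with
    | zero => simp
    | succ m ih =>
      intro k
      rw [Function.iterate_succ_apply', ih, hφd]
      congr 1; push_cast; ring
  have hcurve : ∀ (m : ℕ) x, D.curve (φ^[m] x) = o ^ m * D.curve x := by
    intro m x
    induction m with
    | zero => simp
    | succ m ih => rw [Function.iterate_succ_apply', hrot, ih, pow_succ]; ring
  set N := D.word.length with hN
  have hN0 : N ≠ 0 := E.length_pos.ne'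
  -- If an iterate of the rotation shifts by whole turns, it fixes a point of the curve. That point
  -- is not the origin, so the rotation factor is `1`.
  have hfree : ∀ m : ℕ, (N : ℤ) ∣ m * d → n ∣ m := by
    rintro m ⟨c, hc⟩
    have e1 := hiter m 0
    rw [zero_add, hc, show (N : ℤ) * c = 0 + c * D.word.length by rw [zero_add, mul_comm],
      E.add_mul_length] at e1
    have e2 := hcurve m (E.param 0)
    rw [e1, D.curve_add_int] at e2
    refine (hprim.pow_eq_one_iff_dvd m).1 ?_
    refine mul_right_cancel₀ (h0 (E.param 0)) ?_
    rw [← e2, one_mul]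
  -- The `n`-th iterate maps each parameter to one with the same image, hence to an integral
  -- translate unless the parameter is a crossing. The crossing parameters are countable, so this
  -- holds on a dense set, and the condition is closed; it therefore holds at crossings as well.
  have hord : (N : ℤ) ∣ n * d := by
    have hcl : IsClosed {x | φ^[n] x - x ∈ Set.range ((↑) : ℤ → ℝ)} :=
      Int.isClosedEmbedding_coe_real.isClosed_range.preimage ((hφ.iterate n).sub continuous_id)
    have hdense : Dense {x | φ^[n] x - x ∈ Set.range ((↑) : ℤ → ℝ)} := by
      refine ((Set.countable_range E.param).dense_compl ℝ).mono fun x hx => ?_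
      by_contra hx'
      refine hx (E.surjective x ⟨φ^[n] x, ?_, fun c hc => hx' ⟨c, by rw [hc]; ring⟩⟩)
      rw [hcurve, hprim.pow_eq_one, one_mul]
    have hall := hcl.closure_eq.symm.trans hdense.closure_eq
    obtain ⟨c, hc⟩ : E.param 0 ∈ {x | φ^[n] x - x ∈ Set.range ((↑) : ℤ → ℝ)} := by
      rw [hall]; trivial
    rw [hiter, eq_sub_iff_add_eq, add_comm] at hc
    have := E.param_eq_add_int_iff.1 hc.symm
    exact ⟨c, by rw [hN]; linarith⟩
  have hkd : ∀ k, D.kind (E.param (k + d)) = D.kind (E.param k) := fun k => by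
    rw [← hφd]; exact hkind _ _ (E.meets_mate k)
  have hsd : ∀ k, D.side (E.param (k + d)) = D.side (E.param k) := fun k => by
    rw [← hφd]; exact side_rotation hφ hm h1 ho hrot (E.meets_mate k)
  have hmd : ∀ k, E.mate (k + d) ≡ E.mate k + d [ZMOD N] := fun k => by
    refine E.modEq_of_meets (E.meets_mate _) ?_
    rw [← hφd, ← hφd, hmeets]
    exact E.meets_mate k
  have hmN : ∀ k, E.mate (k + N) ≡ E.mate k + N [ZMOD N] := E.isInvariant_length.mate_add
  refine ⟨d.gcd N, eq_mul_gcd hN0 hord hfree, ?_, ?_, ?_⟩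
  · exact periodic_gcd (f := fun k => D.kind (E.param k)) hkd fun k => by
      have := E.kind_add_mul k 1
      rwa [one_mul] at this
  · exact periodic_gcd (f := fun k => D.side (E.param k)) hsd fun k => by
      have := E.side_add_mul k 1
      rwa [one_mul] at this
  · intro k
    -- The mate commutes with translation exactly when its difference from the identity is periodic,
    -- so Bézout applies here too.
    have key := periodic_gcd (f := fun k => ((E.mate k - k : ℤ) : ZMod N)) (d := d) (N := N)
      (fun k => by
        have := (ZMod.intCast_eq_intCast_iff _ _ _).2 (hmd k)
        push_cast at this ⊢
        rw [this]; ring)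
      (fun k => by
        have := (ZMod.intCast_eq_intCast_iff _ _ _).2 (hmN k)
        push_cast at this ⊢
        rw [this]; ring) k
    refine (ZMod.intCast_eq_intCast_iff _ _ _).1 ?_
    push_cast at key ⊢
    linear_combination key

end VirtualKnotDiagram

end Rotation

/-! ### The width in `q` and the number of virtual crossings -/

section Width

open Polynomial

theorem Polynomial.natDegree_det_le_sum {ι A : Type} [Fintype ι] [DecidableEq ι] [CommRing A]
    (P : Matrix ι ι A[X]) (d : ι → ℕ) (h : ∀ i j, (P i j).natDegree ≤ d i) :
    P.det.natDegree ≤ ∑ i, d i := by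
  rw [← Matrix.det_transpose, Matrix.det_apply]
  refine natDegree_sum_le_of_forall_le _ _ fun σ _ => ?_
  refine (natDegree_smul_le _ _).trans ((natDegree_prod_le _ _).trans ?_)
  exact Finset.sum_le_sum fun i _ => h i _

variable {A : Type} [CommRing A]

/-- Clearing denominators costs a power of `X`, which is coprime to `X - C c` because `c` is a unit.
-/
theorem Polynomial.X_sub_C_pow_dvd_of_toLaurent {P : A[X]} {c : A} (hc : IsUnit c) {n : ℕ}
    (h : toLaurent (X - C c) ^ n ∣ toLaurent P) : (X - C c) ^ n ∣ P := by
  obtain ⟨g, hg⟩ := h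
  obtain ⟨m, G, hG⟩ := LaurentPolynomial.exists_T_pow g
  have h1 : X ^ m * P = (X - C c) ^ n * G := by
    apply toLaurent_injective
    rw [map_mul, map_mul, map_pow, map_pow, toLaurent_X, LaurentPolynomial.T_pow, hG, hg]
    simp only [mul_one]
    ring
  have hcop : IsCoprime (X - C c) X := by
    obtain ⟨u, rfl⟩ := hc
    refine ⟨-C ((u⁻¹ : Aˣ) : A), C ((u⁻¹ : Aˣ) : A), ?_⟩
    have : C ((u⁻¹ : Aˣ) : A) * C (u : A) = 1 := by rw [← C_mul]; simp
    linear_combination this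
  exact (hcop.pow (m := n) (n := m)).dvd_of_dvd_mul_left ⟨G, h1⟩

/-- The two linear factors are distinct primes, so the product of their powers divides `P`. -/
theorem Polynomial.add_le_natDegree_of_dvd [IsDomain A] {P : A[X]} (hP : P ≠ 0) {c e : A}
    (hce : c ≠ e) {n : ℕ} (h1 : (X - C c) ^ n ∣ P) (h2 : (X - C e) ^ n ∣ P) :
    n + n ≤ P.natDegree := by
  obtain ⟨G, rfl⟩ := h1
  have h3 : ¬ (X - C e) ∣ (X - C c) ^ n := by
    intro h
    have := (prime_X_sub_C e).dvd_of_dvd_pow h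
    rw [dvd_iff_isRoot] at this
    simp only [IsRoot.def, eval_sub, eval_X, eval_C, sub_eq_zero] at this
    exact hce this.symm
  obtain ⟨H, rfl⟩ := (prime_X_sub_C e).pow_dvd_of_dvd_mul_left n h3 h2
  have hH : H ≠ 0 := by rintro rfl; simp at hP
  have hc0 : (X - C c) ^ n ≠ 0 := pow_ne_zero _ (X_sub_C_ne_zero _)
  have he0 : (X - C e) ^ n ≠ 0 := pow_ne_zero _ (X_sub_C_ne_zero _)
  rw [natDegree_mul hc0 (mul_ne_zero he0 hH), natDegree_mul he0 hH, natDegree_pow, natDegree_pow,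
    natDegree_X_sub_C, natDegree_X_sub_C]
  omega

/-- The weights in Laurent polynomials in `q` over a ring that contains `s` and `t`. -/
noncomputable def Weights.laurent (s t : Aˣ) : Weights A[T;T⁻¹] :=
  ⟨Units.map (LaurentPolynomial.C (R := A)).toMonoidHom s,
    Units.map (LaurentPolynomial.C (R := A)).toMonoidHom t, laurentVar A⟩

namespace VirtualKnotDiagram.Enumeration

variable {D : VirtualKnotDiagram} (E : D.Enumeration)

/-- Only a virtual passage involves `q`. When its coefficient is `q⁻¹`, multiplying the whole row by
`q` makes all entries polynomials of degree at most one. -/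
theorem exists_toLaurent_coeff (s t : Aˣ) (k : ℤ) : ∃ (u : A[T;T⁻¹]) (P₁ P₂ P₃ : A[X]),
    IsUnit u ∧ toLaurent P₁ = u ∧ toLaurent P₂ = u * E.coeff (Weights.laurent s t) k ∧
    toLaurent P₃ = u * E.overCoeff (Weights.laurent s t) k ∧
    ∀ P ∈ ({P₁, P₂, P₃} : Set A[X]),
      P.natDegree ≤ if D.kind (E.param k) = .virt then 1 else 0 := by
  by_cases hk : D.kind (E.param k) = .virt
  · have h0 : E.overCoeff (Weights.laurent s t) k = 0 := by simp [overCoeff, hk]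
    rw [if_pos hk]
    rcases Int.units_eq_one_or (D.passageSign (E.param k)) with he | he
    · refine ⟨1, 1, X, 0, isUnit_one, map_one _, ?_, by simp [h0], ?_⟩
      · rw [coeff, hk, he, Weights.coeff_virt_one, one_mul]
        exact toLaurent_X
      · rintro P (rfl | rfl | rfl) <;> simp [natDegree_X_le]
    · refine ⟨LaurentPolynomial.T 1, X, 1, 0, LaurentPolynomial.isUnit_T 1, toLaurent_X, ?_,
        by simp [h0], ?_⟩
      · rw [coeff, hk, he, Weights.coeff_virt_neg_one, map_one]
        exact ((laurentVar A).mul_inv).symm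
      · rintro P (rfl | rfl | rfl) <;> simp [natDegree_X_le]
  · rw [if_neg hk]
    obtain ⟨c, hc⟩ : ∃ c : A, E.coeff (Weights.laurent s t) k = LaurentPolynomial.C c := by
      unfold coeff
      rcases hk' : D.kind (E.param k)
      · exact ⟨((s ^ (D.passageSign (E.param k) : ℤ) : Aˣ) : A), by
          simp only [Weights.coeff, Weights.laurent]; rw [← map_zpow]; rfl⟩
      · exact ⟨((t ^ (D.passageSign (E.param k) : ℤ) : Aˣ) : A), by
          simp only [Weights.coeff, Weights.laurent]; rw [← map_zpow]; rfl⟩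
      · exact absurd hk' hk
    obtain ⟨e, he⟩ : ∃ e : A, E.overCoeff (Weights.laurent s t) k = LaurentPolynomial.C e := by
      unfold overCoeff
      rcases hk' : D.kind (E.param k)
      · exact ⟨0, by simp⟩
      · exact ⟨1 - (((s * t) ^ (D.passageSign (E.param k) : ℤ) : Aˣ) : A), by
          simp only [Weights.overCoeff, Weights.laurent]
          rw [← map_mul, ← map_zpow, map_sub, map_one]; rfl⟩
      · exact absurd hk' hk
    refine ⟨1, 1, C c, C e, isUnit_one, map_one _, by rw [hc, toLaurent_C, one_mul],
      by rw [he, toLaurent_C, one_mul], ?_⟩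
    rintro P (rfl | rfl | rfl) <;> simp

/-- Up to a unit, the determinant of a diagram is a polynomial in `q` whose degree is at most the
number of virtual passages. -/
theorem exists_toLaurent_det [NeZero D.word.length] (s t : Aˣ) :
    ∃ (u : A[T;T⁻¹]) (P : A[X]), IsUnit u ∧
      toLaurent P = u * (E.quotientMatrix (Weights.laurent s t) D.word.length).det ∧
      P.natDegree ≤ (Finset.univ.filter fun j : ZMod D.word.length =>
        D.kind (E.param j.val) = .virt).card := by
  choose u P₁ P₂ P₃ hu h1 h2 h3 hd using fun k => E.exists_toLaurent_coeff s t k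
  set P : Matrix (ZMod D.word.length) (ZMod D.word.length) A[X] := fun i j =>
    (if ((i.val + 1 : ℤ) : ZMod D.word.length) = j then P₁ i.val else 0) -
    (if i = j then P₂ i.val else 0) -
    (if ((E.mate i.val : ℤ) : ZMod D.word.length) = j then P₃ i.val else 0) with hP
  refine ⟨∏ i : ZMod D.word.length, u i.val, P.det, ?_, ?_, ?_⟩
  · rw [IsUnit.prod_univ_iff]
    exact fun i => hu _
  · rw [← Matrix.det_mul_column, RingHom.map_det]
    congr 1
    ext1 i j
    rw [RingHom.mapMatrix_apply, Matrix.map_apply, Matrix.of_apply, hP]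
    simp only [quotientMatrix, shiftMatrix, map_sub, mul_sub, mul_ite, mul_one, mul_zero]
    congr 1
    · congr 1
      · split_ifs
        · exact h1 _
        · simp
      · split_ifs
        · exact h2 _
        · simp
    · split_ifs
      · exact h3 _
      · simp
  · rw [Finset.card_filter]
    refine Polynomial.natDegree_det_le_sum P _ fun i j => ?_
    have e1 := hd i.val (P₁ i.val) (by simp)
    have e2 := hd i.val (P₂ i.val) (by simp)
    have e3 := hd i.val (P₃ i.val) (by simp)
    have e4 : ∀ {X Y Z : A[X]} {m : ℕ}, X.natDegree ≤ m → Y.natDegree ≤ m → Z.natDegree ≤ m →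
        (X - Y - Z).natDegree ≤ m := fun hX hY hZ => by
      simpa using natDegree_sub_le_of_le (natDegree_sub_le_of_le hX hY) hZ
    have e5 : ∀ {c : Prop} [Decidable c] {X : A[X]} {m : ℕ}, X.natDegree ≤ m →
        (if c then X else 0).natDegree ≤ m := fun hX => by
      split_ifs
      · exact hX
      · simp
    exact e4 (e5 e1) (e5 e2) (e5 e3)

theorem card_virtual_le [NeZero D.word.length] :
    (Finset.univ.filter fun j : ZMod D.word.length => D.kind (E.param j.val) = .virt).card ≤
      2 * D.virtualCrossings.ncard := by
  classical
  have hcast : ∀ {i j : ZMod D.word.length}, (i.val : ℤ) ≡ j.val [ZMOD D.word.length] → i = j := by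
    intro i j h
    have := (ZMod.intCast_eq_intCast_iff _ _ _).2 h
    simpa using this
  set S := Finset.univ.filter fun j : ZMod D.word.length => D.kind (E.param j.val) = .virt with hS
  set f : ZMod D.word.length → ℂ := fun j => D.curve (E.param j.val) with hf
  -- Each fibre of the map from passages to points consists of a passage and its mate.
  have h1 : S.card ≤ 2 * (S.image f).card := by
    refine Finset.card_le_mul_card_image S 2 fun z hz => ?_
    obtain ⟨j, hj, rfl⟩ := Finset.mem_image.1 hz
    refine (Finset.card_le_card (t := {j, ((E.mate j.val : ℤ) : ZMod D.word.length)}) ?_).trans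
      Finset.card_le_two
    intro i hi
    rw [Finset.mem_filter] at hi
    rw [Finset.mem_insert, Finset.mem_singleton]
    rcases E.curve_eq_iff.1 hi.2.symm with h | h
    · exact Or.inl (hcast h.symm)
    · refine Or.inr ?_
      have := (ZMod.intCast_eq_intCast_iff _ _ _).2 h
      rw [this]; simp
  have h2 : (S.image f : Set ℂ) = D.virtualCrossings := by
    ext z
    simp only [Finset.coe_image, Set.mem_image, Finset.mem_coe, hS, Finset.mem_filter,
      Finset.mem_univ, true_and, hf]
    constructor
    · rintro ⟨j, hj, rfl⟩
      exact ⟨_, _, E.meets_mate _, rfl, hj⟩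
    · rintro ⟨x, y, hxy, rfl, hx⟩
      obtain ⟨k, rfl⟩ := E.surjective x ⟨y, hxy⟩
      have hk := val_intCast_modEq (L := D.word.length) k
      exact ⟨(k : ZMod D.word.length), (E.kind_of_modEq hk).trans hx, E.curve_eq_iff.2 (Or.inl hk)⟩
  rw [← h2, Set.ncard_coe_finset]
  exact h1

end VirtualKnotDiagram.Enumeration

end Width

/-! ### Reduction modulo `p` and the comparison of degrees -/

section Reduction

variable {R S : Type} [CommRing R] [CommRing S]

/-- The ring homomorphism of Laurent polynomials induced by one of the coefficients. -/
noncomputable def LaurentPolynomial.mapCoeff (f : R →+* S) : R[T;T⁻¹] →+* S[T;T⁻¹] :=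
  AddMonoidAlgebra.mapRingHom ℤ f

theorem LaurentPolynomial.mapCoeff_C (f : R →+* S) (x : R) :
    mapCoeff f (C x) = C (f x) := AddMonoidAlgebra.mapRingHom_single f 0 x

theorem LaurentPolynomial.mapCoeff_T (f : R →+* S) (n : ℤ) :
    mapCoeff f (T n) = T n :=
  (AddMonoidAlgebra.mapRingHom_single f n 1).trans (by rw [map_one]; rfl)

/-- Divisibility by an integer is tested on coefficients. The form of the hypothesis allows
iteration over the three layers of Laurent polynomials. -/
theorem LaurentPolynomial.natCast_dvd_of_mapCoeff_eq_zero {f : R →+* S} {p : ℕ}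
    (hf : ∀ x, f x = 0 → (p : R) ∣ x) (x : R[T;T⁻¹]) (hx : mapCoeff f x = 0) :
    (p : R[T;T⁻¹]) ∣ x := by
  rw [← AddMonoidAlgebra.sum_coeff_single x]
  refine Finset.dvd_sum fun n _ => ?_
  obtain ⟨y, hy⟩ := hf (x.coeff n) (by
    rw [← AddMonoidAlgebra.coeff_mapRingHom]
    exact congrArg (fun z : S[T;T⁻¹] => z.coeff n) hx)
  refine ⟨AddMonoidAlgebra.single n y, ?_⟩
  rw [hy, ← nsmul_eq_mul, ← nsmul_eq_mul, AddMonoidAlgebra.smul_single]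

theorem LaurentPolynomial.charP (R : Type) [CommRing R] (p : ℕ) [CharP R p] :
    CharP R[T;T⁻¹] p := by
  have hinj : Function.Injective (C : R →+* R[T;T⁻¹]) := fun x y h => by
    have := congrArg (fun z : R[T;T⁻¹] => z.coeff 0) h
    simpa using this
  exact charP_of_injective_ringHom hinj p

theorem Weights.map_mapCoeff_laurent (f : R →+* S) (s t : Rˣ) :
    (Weights.laurent s t).map (LaurentPolynomial.mapCoeff f) =
      Weights.laurent (Units.map f.toMonoidHom s) (Units.map f.toMonoidHom t) := by
  simp only [Weights.map, Weights.laurent, Weights.mk.injEq]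
  refine ⟨Units.ext ?_, Units.ext ?_, Units.ext ?_⟩
  · exact LaurentPolynomial.mapCoeff_C f _
  · exact LaurentPolynomial.mapCoeff_C f _
  · exact LaurentPolynomial.mapCoeff_T f 1

theorem units_map_mapCoeff_laurentVar (f : R →+* S) :
    Units.map (LaurentPolynomial.mapCoeff f).toMonoidHom (laurentVar R) = laurentVar S :=
  Units.ext (LaurentPolynomial.mapCoeff_T f 1)

theorem units_map_mapCoeff_C (f : R →+* S) (u : Rˣ) :
    Units.map (LaurentPolynomial.mapCoeff f).toMonoidHom
      (Units.map (LaurentPolynomial.C (R := R)).toMonoidHom u) =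
      Units.map (LaurentPolynomial.C (R := S)).toMonoidHom (Units.map f.toMonoidHom u) :=
  Units.ext (LaurentPolynomial.mapCoeff_C f _)

end Reduction

/-- Without crossings the only relation is trivial, so constant vectors are killed. A nonzero
determinant therefore guarantees that an enumeration exists. -/
theorem det_alexanderMatrix_of_length_eq_zero {α R : Type} [CommRing R] [IsDomain R]
    (a : Weights R) {w : List (Passage α)} (h : w.length = 0) : (alexanderMatrix a w).det = 0 := by
  rw [← Matrix.exists_mulVec_eq_zero_iff]
  have h0 : IsEmpty (Fin w.length) := by rw [h]; infer_instance
  have hw : IsMatched w := ⟨fun i => isEmptyElim i, fun i => isEmptyElim i⟩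
  refine ⟨fun _ => 1, fun h1 => one_ne_zero (congrFun h1 0), ?_⟩
  have := (mem_solutions_alexanderMatrix (V := R) a hw fun _ => 1).2
    ⟨fun k => isEmptyElim k, rfl⟩
  ext i
  exact this i

open Polynomial in
theorem VirtualKnotDiagram.IsPeriodic.le_ncard_virtualCrossings {A : Type} [CommRing A]
    [IsDomain A] {p r : ℕ} [hp : Fact p.Prime] [CharP A p] {s t : Aˣ} (hst : (s : A) * t ≠ 1)
    {D D' : VirtualKnotDiagram} {K : VirtualKnot} (hD : D.Represents K) (hD' : D'.Represents K)
    (h : D.IsPeriodic (p ^ r))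
    (h0 : (alexanderMatrix (Weights.laurent s t) D.word).det ≠ 0) :
    p ^ r ≤ D'.virtualCrossings.ncard := by
  have hchar := LaurentPolynomial.charP A p
  set a := Weights.laurent s t with ha
  obtain ⟨n, hn⟩ : ∃ n, n = p ^ r := ⟨_, rfl⟩
  rw [← hn] at h ⊢
  have hn0 : n ≠ 0 := by rw [hn]; exact pow_ne_zero _ hp.out.ne_zero
  have : NeZero n := ⟨hn0⟩
  have hassoc := hD.associated_det a hD'
  have h0' : (alexanderMatrix a D'.word).det ≠ 0 := hassoc.ne_zero_iff.1 h0
  have hlen : D.word.length ≠ 0 := fun e => h0 (det_alexanderMatrix_of_length_eq_zero a e)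
  have hlen' : D'.word.length ≠ 0 := fun e => h0' (det_alexanderMatrix_of_length_eq_zero a e)
  obtain ⟨E⟩ := D.nonempty_enumeration (Nat.pos_of_ne_zero hlen)
  obtain ⟨E'⟩ := D'.nonempty_enumeration (Nat.pos_of_ne_zero hlen')
  obtain ⟨L, hL, hE⟩ := h.exists_isInvariant hn0 E
  have : NeZero L := ⟨by rintro rfl; simp [hL] at hlen⟩
  have : NeZero D'.word.length := ⟨hlen'⟩
  have h1 := hE.associated_det a hn hL
  -- For the second diagram the trivial symmetry is used, with `r = 0` and one sheet.
  have h2 := E'.isInvariant_length.associated_det a (p := p) (r := 0) (n := 1) (by simp) (by simp)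
  rw [pow_one] at h2
  obtain ⟨u, P, hu, hP, hdeg⟩ := E'.exists_toLaurent_det s t
  -- A factor of the quotient determinant of the periodic diagram occurs with multiplicity `n` in
  -- the determinant of either diagram.
  have hdvd : ∀ x, x ∣ (E.quotientMatrix a L).det → x ^ n ∣ toLaurent P := by
    intro x hx
    rw [hP]
    exact (((pow_dvd_pow_of_dvd hx n).trans h1.symm.dvd).trans (hassoc.trans h2).dvd).mul_left _
  have hP0 : P ≠ 0 := by
    rintro rfl
    rw [map_zero, eq_comm, hu.mul_right_eq_zero] at hP
    exact h0' ((h2.eq_zero_iff).2 hP)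
  have h3 : (X - C (s : A)) ^ n ∣ P := by
    refine X_sub_C_pow_dvd_of_toLaurent s.isUnit (hdvd _ ?_)
    have : toLaurent (X - C (s : A)) = (a.q : A[T;T⁻¹]) - (a.s : A[T;T⁻¹]) := by
      rw [map_sub, toLaurent_X, toLaurent_C]; rfl
    rw [this]
    exact hE.sub_dvd_det a hn0 hL
  have h4 : (X - C ((t⁻¹ : Aˣ) : A)) ^ n ∣ P := by
    refine X_sub_C_pow_dvd_of_toLaurent (t⁻¹).isUnit (hdvd _ (Dvd.dvd.trans ?_
      (hE.one_sub_dvd_det a hn0 hL)))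
    -- The factor `1 - t * q` is `q - t⁻¹` times the unit `-t`.
    refine ⟨-LaurentPolynomial.C (t : A), ?_⟩
    have e1 : (a.t : A[T;T⁻¹]) = LaurentPolynomial.C (t : A) := rfl
    have e2 : (a.q : A[T;T⁻¹]) = LaurentPolynomial.T 1 := rfl
    have e3 : LaurentPolynomial.C ((t⁻¹ : Aˣ) : A) * LaurentPolynomial.C (t : A) = 1 := by
      rw [← map_mul]; simp
    rw [map_sub, toLaurent_X, toLaurent_C, e1, e2]
    linear_combination -e3
  -- The roots `s` and `t⁻¹` are distinct by `hst`. The resulting inequality `2 * n ≤ degree ≤ 2 *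
  -- (virtual crossings)` is the claim.
  have h5 := add_le_natDegree_of_dvd hP0 (fun e => hst (by rw [e]; simp)) h3 h4
  have h6 := E'.card_virtual_le
  omega

theorem mainTheorem8 (p r : ℕ) (hp : p.Prime) (K : VirtualKnot) (hK : K.IsPeriodic (p ^ r))
    (h : LaurentSTQ) (hh : K.IsVirtualAlexanderPolynomial h) (hmod : ¬ (p : LaurentSTQ) ∣ h) :
    p ^ r ≤ K.virtualCrossingNumber := by
  have : Fact p.Prime := ⟨hp⟩
  obtain ⟨D, hD, hper⟩ := hK
  obtain ⟨D', hD', hdet⟩ := hh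
  -- The infimum is attained, since the periodic diagram shows that the set is nonempty. Three
  -- diagrams are involved: periodic, minimal, and the one computing `h`.
  obtain ⟨D'', hD'', hmin⟩ := Nat.sInf_mem (s := {n | ∃ D : VirtualKnotDiagram,
    D.Represents K ∧ D.virtualCrossings.ncard = n}) ⟨_, D, hD, rfl⟩
  rw [VirtualKnot.virtualCrossingNumber, ← hmin]
  let f₁ := LaurentPolynomial.mapCoeff (Int.castRingHom (ZMod p))
  let f₂ := LaurentPolynomial.mapCoeff f₁
  let Φ := LaurentPolynomial.mapCoeff f₂
  -- The kernel of the reduction consists of multiples of `p`, so the hypothesis on `h` says that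
  -- its reduction is nonzero.
  have hker : ∀ x, Φ x = 0 → (p : LaurentSTQ) ∣ x :=
    LaurentPolynomial.natCast_dvd_of_mapCoeff_eq_zero <|
    LaurentPolynomial.natCast_dvd_of_mapCoeff_eq_zero <|
    LaurentPolynomial.natCast_dvd_of_mapCoeff_eq_zero fun x hx =>
      (ZMod.intCast_zmod_eq_zero_iff_dvd x p).1 hx
  have hΦ : Φ h ≠ 0 := fun e => hmod (hker h e)
  have hchar₁ := LaurentPolynomial.charP (ZMod p) p
  have hchar₂ := LaurentPolynomial.charP (ZMod p)[T;T⁻¹] p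
  set s : (ZMod p)[T;T⁻¹][T;T⁻¹]ˣ :=
    Units.map (LaurentPolynomial.C (R := (ZMod p)[T;T⁻¹])).toMonoidHom (laurentVar (ZMod p))
    with hs
  set t : (ZMod p)[T;T⁻¹][T;T⁻¹]ˣ := laurentVar (ZMod p)[T;T⁻¹] with ht
  have hw : laurentWeights.map Φ = Weights.laurent s t := by
    have : laurentWeights = Weights.laurent
        (Units.map (LaurentPolynomial.C (R := ℤ[T;T⁻¹])).toMonoidHom (laurentVar ℤ))
        (laurentVar ℤ[T;T⁻¹]) := rfl
    rw [this, Weights.map_mapCoeff_laurent, units_map_mapCoeff_C, units_map_mapCoeff_laurentVar,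
      units_map_mapCoeff_laurentVar]
  refine hper.le_ncard_virtualCrossings (s := s) (t := t) ?_ hD hD'' ?_
  · intro e
    have e2 : (s : (ZMod p)[T;T⁻¹][T;T⁻¹]) * (t : (ZMod p)[T;T⁻¹][T;T⁻¹]) =
        AddMonoidAlgebra.single 1 (LaurentPolynomial.T 1) :=
      (LaurentPolynomial.single_eq_C_mul_T _ _).symm
    -- The product `s * t` is a monomial of degree one in `t`, so its constant coefficient is zero
    -- and it is not `1`.
    have e3 := congrArg (fun z : (ZMod p)[T;T⁻¹][T;T⁻¹] => z.coeff 0) (e2.symm.trans e)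
    beta_reduce at e3
    rw [AddMonoidAlgebra.coeff_single, Finsupp.single_eq_of_ne (by decide),
      ← LaurentPolynomial.T_zero, LaurentPolynomial.T_apply, if_pos rfl] at e3
    exact zero_ne_one e3
  · rw [virtualAlexanderMatrix_eq] at hdet
    have h1 := hdet.map Φ
    have h2 : Φ (alexanderMatrix laurentWeights D'.word).det =
        (alexanderMatrix (Weights.laurent s t) D'.word).det := by
      rw [← hw, ← alexanderMatrix_map]
      exact RingHom.map_det Φ _
    rw [h2] at h1
    exact (hD'.associated_det _ hD).ne_zero_iff.1 (h1.ne_zero_iff.1 hΦ)
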